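/- **Strings.** Let $\Sigma_s$ be a finite ordered set of static symbols and $\Sigma_p$ a finite set of parameter symbols (p-symbols), disjoint from $\Sigma_s$. A p-string is a string over $\Sigma_s\cup\Sigma_p$. Two p-strings p-match if one is obtained from the other by applying a bijection of $\Sigma_p$ to every occurrence of a p-symbol. The prev-encoding $\langle w\rangle$ of a p-string $w$ is obtained by replacing each occurrence of a p-symbol by the distance to the previous occurrence of the same p-symbol in $w$, or by $0$ if there is none. Prev-encodings are compared lexicographically, static symbols being smaller than all integers. Let $T$ be a p-string of length $n\ge 1$ that ends in a static symbol $\$$ which occurs nowhere else in $T$ and is smaller than all other static symbols of $T$. For $1\le k\le n$ let $T_k=T[k..n]\,T[1..k-1]$, and let $\tau$ be the permutation of $[1..n]$ such that $\langle T_{\tau[1]}\rangle<\dots<\langle T_{\tau[n]}\rangle$. The parameterized Burrows–Wheeler transform (pBWT) of $T$ is the sequence $L[1..n]$ in which $L[i]=T_{\tau[i]}[n]$ if this symbol is static, and otherwise $L[i]$ is the number of zeros in $\langle T_{\tau[i]}[1..j]\rangle$ (that is, the number of distinct p-symbols in $T_{\tau[i]}[1..j]$), where $j$ is the smallest position with $T_{\tau[i]}[j]=T_{\tau[i]}[n]$.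 The LF-mapping of $T$ is the permutation $LF$ of $[1..n]$ with $\tau[LF[i]]\equiv\tau[i]-1 \pmod n$. Let $\sigma_p\le n$ be the number of distinct p-symbols used in $T$. **Model.** The machine is a word RAM with unit-cost load, store, conditional jump, comparison, and the usual arithmetic, bitwise and shift operations on $w$-bit words, with $2^w\ge A\,n$ for a sufficiently large absolute constant $A$ (that is, $w\ge\lg n+O(1)$). Symbols are represented by integers; each static symbol, with one tag bit, fits in a word. All registers and memory cells are initially zero, except for one register that holds $n$. **Statement.** There is one word-RAM program (not depending on $w$, the alphabets or $T$) which, given $n$ and constant-time read access to $L[i]$ and $LF[i]$ for every $i$, writes into memory a p-string $T'$ over $\Sigma_s\cup\Sigma_p$ that p-matches $T$ and halts after $$O\!\left(n\,\frac{\lg\sigma_p}{\lg\lg\sigma_p}\right)$$ steps, where the constant of the $O$ is absolute and $\sigma_p$ is to be read as $\max(\sigma_p,4)$ in the bound (so the bound is $O(n)$ when $\sigma_p<4$). -/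

import Mathlib

/-! ## Parameterized strings -/

namespace PBWT

/-- A symbol: `Sum.inl s` is a static symbol (of the ordered alphabet `Fin a`), `Sum.inr p` is a
parameter symbol (of the alphabet `Fin b`).  A p-string is a list of symbols; a string need not use
all the symbols of its alphabets. -/
abbrev Sym (a b : ℕ) : Type := Fin a ⊕ Fin b

/-- The symbols of a prev-encoding: static symbols and natural numbers, ordered so that every
static symbol is smaller than every number. -/
abbrev EncSym (a : ℕ) : Type := Fin a ⊕ₗ ℕ

variable {a b : ℕ}

/-- `x` and `y` p-match: a bijection on the parameter symbols, applied to every occurrence of a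
parameter symbol in `x`, turns `x` into `y`. -/
def PMatch (x y : List (Sym a b)) : Prop :=
  ∃ f : Equiv.Perm (Fin b), x.map (Sum.map id f) = y

/-- The distance from position `i` (counted from `0`) of `w` to the previous occurrence of the same
symbol, and `0` if there is no previous occurrence. -/
def prevDist (w : List (Sym a b)) (i : ℕ) : ℕ :=
  if h : ((Finset.range i).filter fun j => w[j]? = w[i]?).Nonempty then
    i - ((Finset.range i).filter fun j => w[j]? = w[i]?).max' h
  else 0

/-- The prev-encoding of a p-string. -/
def prevEnc (w : List (Sym a b)) : List (EncSym a) :=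
  List.ofFn fun i : Fin w.length =>
    match w[i] with
    | Sum.inl s => toLex (Sum.inl s)
    | Sum.inr _ => toLex (Sum.inr (prevDist w i))

/-- The number of zeros in a prev-encoded string. -/
def zeros (W : List (EncSym a)) : ℕ := W.count (toLex (Sum.inr 0))

/-- `T` ends in an end-marker: a static symbol that occurs nowhere else in `T` and is smaller than
all the other static symbols of `T`. -/
def HasEndMarker (T : List (Sym a b)) : Prop :=
  ∃ (u : List (Sym a b)) (d : Fin a),
    T = u ++ [Sum.inl d] ∧ ∀ s : Fin a, Sum.inl s ∈ u → d < s

/-- The number `σ_p` of distinct parameter symbols used in `T`. -/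
def numParams (T : List (Sym a b)) : ℕ :=
  (T.filterMap Sum.getRight?).toFinset.card

/-- The permutation `τ` that sorts the cyclic rotations of `T` by the lexicographic order of their
prev-encodings, with positions and ranks counted from `0`: `T.rotate (psa T i)` is the rotation
whose prev-encoding has rank `i`. -/
def psa (T : List (Sym a b)) : Equiv.Perm (Fin T.length) :=
  Tuple.sort fun k : Fin T.length => prevEnc (T.rotate k)

theorem rotate_ne_nil (T : List (Sym a b)) (i : Fin T.length) (k : ℕ) : T.rotate k ≠ [] := by
  intro h
  rw [List.rotate_eq_nil_iff] at h
  subst h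
  exact i.elim0

/-- The parameterized Burrows-Wheeler transform `L` of `T` (ranks counted from `0`). -/
def pbwt (T : List (Sym a b)) (i : Fin T.length) : Fin a ⊕ ℕ :=
  match (T.rotate (psa T i)).getLast (rotate_ne_nil T i _) with
  | Sum.inl s => Sum.inl s
  | Sum.inr p =>
    Sum.inr (zeros (prevEnc ((T.rotate (psa T i)).take
      ((T.rotate (psa T i)).idxOf (Sum.inr p) + 1))))

/-- The LF-mapping of `T`: `psa T (lfMap T i)` is the cyclic predecessor of `psa T i`. -/
def lfMap (T : List (Sym a b)) : Equiv.Perm (Fin T.length) :=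
  (psa T).trans ((finRotate T.length).symm.trans (psa T).symm)

/-! ## The word RAM

Words have `w` bits.  A machine has registers and a memory of `2 ^ w` words addressed by words, and
it has random access to two read-only input arrays.  Every instruction takes one unit of time.
The text of a program does not depend on `w`. -/

/-- The operations on words.  Arithmetic is modulo `2 ^ w`; comparisons return `1` or `0`. -/
inductive Op where
  | add | sub | mul | div | mod | and | or | xor | shl | shr | eq | lt

def Op.eval {w : ℕ} (o : Op) (x y : BitVec w) : BitVec w :=
  match o with
  | .add => x + y
  | .sub => x - y
  | .mul => x * y
  | .div => x / y
  | .mod => x % y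
  | .and => x &&& y
  | .or => x ||| y
  | .xor => x ^^^ y
  | .shl => x <<< y.toNat
  | .shr => x >>> y.toNat
  | .eq => if x = y then 1#w else 0#w
  | .lt => if x.toNat < y.toNat then 1#w else 0#w

/-- The two read-only input arrays. -/
inductive Input where
  | bwt | lf

/-- Instructions.  `dst`, `x`, `y`, `src`, `addr`, `idx` are names of registers. -/
inductive Instr where
  /-- put the constant `c` into `dst` -/
  | const (dst : ℕ) (c : ℕ)
  /-- put the result of `o` on the contents of `x` and `y` into `dst` -/
  | op (o : Op) (dst x y : ℕ)
  /-- put the memory cell whose address is in `addr` into `dst` -/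
  | load (dst addr : ℕ)
  /-- put the content of `src` into the memory cell whose address is in `addr` -/
  | store (addr src : ℕ)
  /-- put the entry of the input array `s` whose index is in `idx` into `dst` -/
  | read (s : Input) (dst idx : ℕ)
  /-- continue at instruction `target` if the content of `x` is zero -/
  | jumpIfZero (x : ℕ) (target : ℕ)

abbrev Program : Type := List Instr

structure Config (w : ℕ) where
  pc : ℕ
  reg : ℕ → BitVec w
  mem : BitVec w → BitVec w

/-- The effect of one instruction, with `input` the contents of the input arrays. -/
def Instr.exec {w : ℕ} (input : Input → BitVec w → BitVec w) (c : Config w) : Instr → Config w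
  | .const dst k => ⟨c.pc + 1, Function.update c.reg dst (BitVec.ofNat w k), c.mem⟩
  | .op o dst x y => ⟨c.pc + 1, Function.update c.reg dst (o.eval (c.reg x) (c.reg y)), c.mem⟩
  | .load dst addr => ⟨c.pc + 1, Function.update c.reg dst (c.mem (c.reg addr)), c.mem⟩
  | .store addr src => ⟨c.pc + 1, c.reg, Function.update c.mem (c.reg addr) (c.reg src)⟩
  | .read s dst idx => ⟨c.pc + 1, Function.update c.reg dst (input s (c.reg idx)), c.mem⟩
  | .jumpIfZero x target => ⟨if c.reg x = 0#w then target else c.pc + 1, c.reg, c.mem⟩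

/-- One step of the machine; a machine whose program counter has left the program has halted. -/
def step {w : ℕ} (P : Program) (input : Input → BitVec w → BitVec w) (c : Config w) : Config w :=
  match P[c.pc]? with
  | some ins => ins.exec input c
  | none => c

def Config.Halted {w : ℕ} (P : Program) (c : Config w) : Prop := P.length ≤ c.pc

/-- The initial configuration: register `0` holds `n`, everything else is zero. -/
def initConfig (w n : ℕ) : Config w :=
  ⟨0, Function.update (fun _ => 0#w) 0 (BitVec.ofNat w n), fun _ => 0#w⟩

/-! ## The computational problem -/

/-- The integer code of an entry of the transform: even for static symbols, odd for numbers. -/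
def codeL : Fin a ⊕ ℕ → ℕ
  | Sum.inl s => 2 * s
  | Sum.inr k => 2 * k + 1

/-- The integer code of a symbol: even for static symbols, odd for parameter symbols. -/
def codeSym : Sym a b → ℕ
  | Sum.inl s => 2 * s
  | Sum.inr p => 2 * p + 1

/-- The input arrays: the pBWT and the LF-mapping of `T` (ranks counted from `0`; reading beyond
the end of an array returns `0`). -/
def inputOf (w : ℕ) (T : List (Sym a b)) : Input → BitVec w → BitVec w
  | .bwt, i => if h : i.toNat < T.length then BitVec.ofNat w (codeL (pbwt T ⟨i.toNat, h⟩)) else 0#w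
  | .lf, i => if h : i.toNat < T.length then BitVec.ofNat w (lfMap T ⟨i.toNat, h⟩).val else 0#w

/-- The memory cells `0, …, |T'| - 1` hold the codes of the symbols of `T'`. -/
def Holds {w : ℕ} (mem : BitVec w → BitVec w) (T' : List (Sym a b)) : Prop :=
  ∀ k : Fin T'.length, (mem (BitVec.ofNat w k)).toNat = codeSym T'[k]

/-- The function `lg σ / lg lg σ`, with the arguments below `4` (where it is not defined or not
meaningful) treated like `4`. -/
noncomputable def lgOverLgLg (σ : ℕ) : ℝ :=
  Real.logb 2 (max σ 4 : ℕ) / Real.logb 2 (Real.logb 2 (max σ 4 : ℕ))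

end PBWT

/-!
Why a pBWT can be inverted in time `O(n lg σ / lg lg σ)`.

*Reduction to move-to-front.*  The end-marker makes the rotation that starts with it the one of rank
`0`, so iterating the LF-mapping from rank `0` visits the rotations from the last position of the
text down (`psa_visit`).  For a rotation whose last symbol is a parameter symbol, the transform
holds the position of this symbol, counted from `1`, in the list of all parameter symbols in the
order of their first occurrences (`pbwt_eq`), and stepping back by one position moves the symbol to
the front of this list (`firsts_rotate_succ`).  Inversion up to renaming is therefore move-to-front
decoding, started from any list of distinct names (`mtf_decode`), with at most `σ` names
(`codeAt_bounds`).

*Phases and slots.*  The requests are handled off-line, in phases of `Q` requests, `Q` being the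
least power of two that is at least the largest number in the transform.  The list is laid out in
`2 Q` slots, of which the right half is occupied at first.  Request `t` with rank `m` deletes the
occupied slot of rank `m` and occupies slot `Q - 1 - t` on the left of all others (`slotList`).  If
all slots on the left are considered live from the start, request `t` just deletes the live slot of
rank `Q - t + m` (`live_slotAt`).  Once the deleted slots are known, the symbols are obtained by
passing labels from slot to slot (`map_slotList_succ`).

*The descent.*  The deleted slots are found by moving all requests together down a tree over the
slots in which every inner node has about `2 ^ β` children, where `4 ^ β` is about `b = lg (2 Q)`;
the tree has `O(b / β) = O(lg σ / lg lg σ)` levels (`wp_descent`, `params_le`).  At its node, a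
request is the deletion of the live slot of a given rank, its key.  Only requests at the same node
matter for each other (`Grouped.live_eq`), so the requests may be grouped by nodes and inside a node
by time, and cut into chunks of at most `2 ^ β` requests at one node; there are few chunks
(`mul_chunks_le`).  To find the child of a request, its key is compared with thresholds, the numbers
of live slots on the left of the children.  At the start of a chunk the thresholds are merged with
the sorted keys of the chunk.  During the chunk each threshold decreases by less than `2 ^ β`, so
the outcome of all comparisons is unchanged if the gaps between consecutive values are cut down to
`2 ^ β + 1` (`Merged`, `wp_setup`).  After this, `2 * β + 4` bits suffice for a threshold; the
thresholds of a node fit into one word of `lg n + O(1)` bits (`width_mul_le`), and are compared with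
a key, and updated, by constantly many operations (`pack_and`, `pack_indicator_mod`, `Ready.step`).
Sorting is done by counting, and a level takes time `O(Q)` (`wp_level`).

*The machine.*  The program is written in a small structured language whose total-correctness
semantics `wp` counts machine steps as a ghost variable and excludes overflows.  Its compilation to
the word RAM is correct (`Stmt.sim`, `Stmt.run`), and `wp_decoder` is the specification of the
program.
-/

set_option linter.constructorNameAsVariable false
set_option linter.unusedSimpArgs false

namespace PBWT

/-! ### A structured language over the word RAM -/

/-- The scalar variables; each is kept in its own register, and `Var.n` in register `0`.  Those
with a fixed meaning: `n` is the length of the text, `r` the current rank and `g` the current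
step; `sg` is the largest number of the transform, `q` the length of a phase,
`nn = 2 * q = 2 ^ b` the number of slots and `base` the first step of the phase; `bt` is the number
of bits decided by one level, `f` the width of a field, `h = 2 ^ (f - 1)`, `fm = 2 ^ f - 1`; blocks
have `2 ^ s` slots before and `2 ^ s2` slots after the level at hand, `s2 = s - d`, `bb = 2 ^ d`,
`cap = bb + 1`, and `ones` has a one in each of `bb` fields. -/
inductive Var where
  | n | r | g | c | sg | q | nn | b | bt | pw | cap | f | h | fm | s | d | s2 | bb | ones | u | i
  | t | k | acc | p | v | cv | cs | x | y | z | dd | pp | ptr | base | j | e | kv | rr | w | o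
  deriving DecidableEq

/-- The arrays; `Arr.out` starts at memory cell `0`.  The move-to-front ranks are in `rank`, the
labels of the slots in `lab`; `node` and `key` hold the block of each operation of a phase and its
rank among the live slots of the block, `cnt` the numbers of live slots of the blocks, `idn` the
identity, `oA`, `oK`, `oC` orders of the operations, `cid` the chunk of each operation, `parr` the
thresholds of a chunk and `kc` the keys in small coordinates; `cN` is used for counting sort. -/
inductive Arr where
  | out | rank | lab | tmp | node | key | cN | oA | oK | oC | idn | cid | cnt | parr | kc
  deriving DecidableEq

/-- Expressions: variables, constants, operations, array cells and input cells. -/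
inductive Expr where
  | vr (x : Var)
  | cst (k : ℕ)
  | op (o : Op) (e₁ e₂ : Expr)
  | ld (a : Arr) (e : Expr)
  | rd (s : Input) (e : Expr)

/-- Structured statements; `loop e₁ e₂ s` repeats `s` as long as `e₁` and then `e₂` are nonzero,
and `e₂` is not evaluated when `e₁` vanishes. -/
inductive Stmt where
  | skip
  | set (x : Var) (e : Expr)
  | put (a : Arr) (e₁ e₂ : Expr)
  | seq (s₁ s₂ : Stmt)
  | ite (e : Expr) (s₁ s₂ : Stmt)
  | loop (e₁ e₂ : Expr) (s : Stmt)

/-- Sequential composition. -/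
infixr:30 " ;; " => Stmt.seq

/-- The state of a structured program.  `time` is a ghost component: the number of machine steps
made so far. -/
structure St where
  var : Var → ℕ
  arr : Arr → ℕ → ℕ
  time : ℕ

namespace St

/-- Assignment to a variable. -/
def setVar (σ : St) (x : Var) (k : ℕ) : St := ⟨Function.update σ.var x k, σ.arr, σ.time⟩

/-- Assignment to the cell `i` of the array `a`. -/
def setArr (σ : St) (a : Arr) (i k : ℕ) : St :=
  ⟨σ.var, Function.update σ.arr a (Function.update (σ.arr a) i k), σ.time⟩

/-- `c` more machine steps. -/
def tick (σ : St) (c : ℕ) : St := ⟨σ.var, σ.arr, σ.time + c⟩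

@[simp] theorem var_setVar (σ : St) (x y : Var) (k : ℕ) :
    (σ.setVar x k).var y = if y = x then k else σ.var y := by
  simp [setVar, Function.update_apply]

@[simp] theorem arr_setVar (σ : St) (x : Var) (k : ℕ) : (σ.setVar x k).arr = σ.arr := rfl

@[simp] theorem time_setVar (σ : St) (x : Var) (k : ℕ) : (σ.setVar x k).time = σ.time := rfl

@[simp] theorem var_setArr (σ : St) (a : Arr) (i k : ℕ) : (σ.setArr a i k).var = σ.var := rfl

@[simp] theorem arr_setArr (σ : St) (a b : Arr) (i k : ℕ) :
    (σ.setArr a i k).arr b = if b = a then Function.update (σ.arr b) i k else σ.arr b := by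
  by_cases h : b = a
  · subst h; simp [setArr]
  · simp [setArr, h]

@[simp] theorem time_setArr (σ : St) (a : Arr) (i k : ℕ) : (σ.setArr a i k).time = σ.time := rfl

@[simp] theorem var_tick (σ : St) (c : ℕ) : (σ.tick c).var = σ.var := rfl

@[simp] theorem arr_tick (σ : St) (c : ℕ) : (σ.tick c).arr = σ.arr := rfl

@[simp] theorem time_tick (σ : St) (c : ℕ) : (σ.tick c).time = σ.time + c := rfl

end St

/-- The fixed surroundings of a run: the word length `w`, the length `n` of the input arrays, the
distance `stride` between the starting points of consecutive arrays in memory, and the contents of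
the input arrays. -/
structure Env where
  w : ℕ
  n : ℕ
  stride : ℕ
  inp : Input → ℕ → ℕ

/-- The exact result of an operation on natural numbers. -/
def Op.nat (o : Op) (x y : ℕ) : ℕ :=
  match o with
  | .add => x + y
  | .sub => x - y
  | .mul => x * y
  | .div => x / y
  | .mod => x % y
  | .and => x &&& y
  | .or => x ||| y
  | .xor => x ^^^ y
  | .shl => x * 2 ^ y
  | .shr => x / 2 ^ y
  | .eq => if x = y then 1 else 0
  | .lt => if x < y then 1 else 0

/-- The condition under which an operation on `w`-bit words gives the exact result. -/
def Op.Exact (w : ℕ) (o : Op) (x y : ℕ) : Prop :=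
  match o with
  | .add => x + y < 2 ^ w
  | .sub => y ≤ x
  | .mul => x * y < 2 ^ w
  | .shl => x * 2 ^ y < 2 ^ w
  | _ => True

namespace Expr

/-- The exact value, without reduction modulo `2 ^ w`. -/
def val (E : Env) (σ : St) : Expr → ℕ
  | vr x => σ.var x
  | cst k => k
  | op o e₁ e₂ => o.nat (e₁.val E σ) (e₂.val E σ)
  | ld a e => σ.arr a (e.val E σ)
  | rd s e => E.inp s (e.val E σ)

/-- Evaluation meets no overflow and no index out of range. -/
def Safe (E : Env) (σ : St) : Expr → Prop
  | vr _ => True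
  | cst k => k < 2 ^ E.w
  | op o e₁ e₂ => e₁.Safe E σ ∧ e₂.Safe E σ ∧ o.Exact E.w (e₁.val E σ) (e₂.val E σ)
  | ld _ e => e.Safe E σ ∧ e.val E σ < E.stride
  | rd _ e => e.Safe E σ ∧ e.val E σ < E.n

/-- The number of instructions that evaluate the expression. -/
def cost : Expr → ℕ
  | vr _ => 1
  | cst _ => 1
  | op _ e₁ e₂ => e₁.cost + e₂.cost + 1
  | ld _ e => e.cost + 4
  | rd _ e => e.cost + 1

instance : Add Expr := ⟨op .add⟩
instance : Sub Expr := ⟨op .sub⟩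
instance : Mul Expr := ⟨op .mul⟩
instance : Div Expr := ⟨op .div⟩
instance : Mod Expr := ⟨op .mod⟩

section
variable (E : Env) (σ : St) (e₁ e₂ : Expr)

@[simp] theorem val_vr (x) : (vr x).val E σ = σ.var x := rfl
@[simp] theorem val_cst (k) : (cst k).val E σ = k := rfl
@[simp] theorem val_ld (a) : (ld a e₁).val E σ = σ.arr a (e₁.val E σ) := rfl
@[simp] theorem val_rd (s) : (rd s e₁).val E σ = E.inp s (e₁.val E σ) := rfl
@[simp] theorem val_add : (e₁ + e₂).val E σ = e₁.val E σ + e₂.val E σ := rfl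
@[simp] theorem val_sub : (e₁ - e₂).val E σ = e₁.val E σ - e₂.val E σ := rfl
@[simp] theorem val_mul : (e₁ * e₂).val E σ = e₁.val E σ * e₂.val E σ := rfl
@[simp] theorem val_div : (e₁ / e₂).val E σ = e₁.val E σ / e₂.val E σ := rfl
@[simp] theorem val_mod : (e₁ % e₂).val E σ = e₁.val E σ % e₂.val E σ := rfl
@[simp] theorem val_and : (op .and e₁ e₂).val E σ = e₁.val E σ &&& e₂.val E σ := rfl
@[simp] theorem val_shl : (op .shl e₁ e₂).val E σ = e₁.val E σ * 2 ^ e₂.val E σ := rfl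
@[simp] theorem val_shr : (op .shr e₁ e₂).val E σ = e₁.val E σ / 2 ^ e₂.val E σ := rfl
@[simp] theorem val_eq :
    (op .eq e₁ e₂).val E σ = if e₁.val E σ = e₂.val E σ then 1 else 0 := rfl
@[simp] theorem val_lt :
    (op .lt e₁ e₂).val E σ = if e₁.val E σ < e₂.val E σ then 1 else 0 := rfl

@[simp] theorem safe_vr (x) : (vr x).Safe E σ ↔ True := Iff.rfl
@[simp] theorem safe_cst (k) : (cst k).Safe E σ ↔ k < 2 ^ E.w := Iff.rfl
@[simp] theorem safe_ld (a) :
    (ld a e₁).Safe E σ ↔ e₁.Safe E σ ∧ e₁.val E σ < E.stride := Iff.rfl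
@[simp] theorem safe_rd (s) : (rd s e₁).Safe E σ ↔ e₁.Safe E σ ∧ e₁.val E σ < E.n := Iff.rfl
@[simp] theorem safe_add : (e₁ + e₂).Safe E σ ↔
    e₁.Safe E σ ∧ e₂.Safe E σ ∧ e₁.val E σ + e₂.val E σ < 2 ^ E.w := Iff.rfl
@[simp] theorem safe_sub : (e₁ - e₂).Safe E σ ↔
    e₁.Safe E σ ∧ e₂.Safe E σ ∧ e₂.val E σ ≤ e₁.val E σ := Iff.rfl
@[simp] theorem safe_mul : (e₁ * e₂).Safe E σ ↔
    e₁.Safe E σ ∧ e₂.Safe E σ ∧ e₁.val E σ * e₂.val E σ < 2 ^ E.w := Iff.rfl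
@[simp] theorem safe_div : (e₁ / e₂).Safe E σ ↔ e₁.Safe E σ ∧ e₂.Safe E σ ∧ True := Iff.rfl
@[simp] theorem safe_mod : (e₁ % e₂).Safe E σ ↔ e₁.Safe E σ ∧ e₂.Safe E σ ∧ True := Iff.rfl
@[simp] theorem safe_and :
    (op .and e₁ e₂).Safe E σ ↔ e₁.Safe E σ ∧ e₂.Safe E σ ∧ True := Iff.rfl
@[simp] theorem safe_shl : (op .shl e₁ e₂).Safe E σ ↔
    e₁.Safe E σ ∧ e₂.Safe E σ ∧ e₁.val E σ * 2 ^ e₂.val E σ < 2 ^ E.w := Iff.rfl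
@[simp] theorem safe_shr :
    (op .shr e₁ e₂).Safe E σ ↔ e₁.Safe E σ ∧ e₂.Safe E σ ∧ True := Iff.rfl
@[simp] theorem safe_eq :
    (op .eq e₁ e₂).Safe E σ ↔ e₁.Safe E σ ∧ e₂.Safe E σ ∧ True := Iff.rfl
@[simp] theorem safe_lt :
    (op .lt e₁ e₂).Safe E σ ↔ e₁.Safe E σ ∧ e₂.Safe E σ ∧ True := Iff.rfl

@[simp] theorem cost_vr (x) : (vr x).cost = 1 := rfl
@[simp] theorem cost_cst (k) : (cst k).cost = 1 := rfl
@[simp] theorem cost_ld (a) : (ld a e₁).cost = e₁.cost + 4 := rfl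
@[simp] theorem cost_rd (s) : (rd s e₁).cost = e₁.cost + 1 := rfl
@[simp] theorem cost_op (o) : (op o e₁ e₂).cost = e₁.cost + e₂.cost + 1 := rfl
@[simp] theorem cost_add : (e₁ + e₂).cost = e₁.cost + e₂.cost + 1 := rfl
@[simp] theorem cost_sub : (e₁ - e₂).cost = e₁.cost + e₂.cost + 1 := rfl
@[simp] theorem cost_mul : (e₁ * e₂).cost = e₁.cost + e₂.cost + 1 := rfl
@[simp] theorem cost_div : (e₁ / e₂).cost = e₁.cost + e₂.cost + 1 := rfl
@[simp] theorem cost_mod : (e₁ % e₂).cost = e₁.cost + e₂.cost + 1 := rfl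

end

end Expr

/-- `wp` of a loop with at most `k` evaluations of the condition; `W` is the `wp` of the body. -/
def wpLoop (E : Env) (e₁ e₂ : Expr) (W : (St → Prop) → St → Prop) (Φ : St → Prop) : ℕ → St → Prop
  | 0, _ => False
  | k + 1, σ => e₁.Safe E σ ∧
      if e₁.val E σ = 0 then Φ (σ.tick (e₁.cost + 1))
      else e₂.Safe E σ ∧
        if e₂.val E σ = 0 then Φ (σ.tick (e₁.cost + e₂.cost + 2))
        else W (fun σ' => wpLoop E e₁ e₂ W Φ k (σ'.tick 1)) (σ.tick (e₁.cost + e₂.cost + 2))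

/-- Weakest preconditions for total correctness: from `σ`, the statement runs without overflow and
without an index out of range, and ends in a state that satisfies `Φ`. -/
def wp (E : Env) : Stmt → (St → Prop) → St → Prop
  | .skip, Φ, σ => Φ σ
  | .set x e, Φ, σ => e.Safe E σ ∧ Φ ((σ.setVar x (e.val E σ)).tick (e.cost + 1))
  | .put a e₁ e₂, Φ, σ => e₁.Safe E σ ∧ e₂.Safe E σ ∧ e₁.val E σ < E.stride ∧
      Φ ((σ.setArr a (e₁.val E σ) (e₂.val E σ)).tick (e₁.cost + e₂.cost + 4))
  | .seq s₁ s₂, Φ, σ => wp E s₁ (wp E s₂ Φ) σ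
  | .ite e s₁ s₂, Φ, σ => e.Safe E σ ∧
      if e.val E σ = 0 then wp E s₂ Φ (σ.tick (e.cost + 1))
      else wp E s₁ (fun σ' => Φ (σ'.tick 1)) (σ.tick (e.cost + 1))
  | .loop e₁ e₂ s, Φ, σ => ∃ k, wpLoop E e₁ e₂ (wp E s) Φ k σ

section
variable {E : Env} {Φ Ψ : St → Prop} {σ : St}

@[simp] theorem wp_skip : wp E .skip Φ σ ↔ Φ σ := Iff.rfl
@[simp] theorem wp_set {x e} : wp E (.set x e) Φ σ ↔
    e.Safe E σ ∧ Φ ((σ.setVar x (e.val E σ)).tick (e.cost + 1)) := Iff.rfl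
@[simp] theorem wp_put {a e₁ e₂} : wp E (.put a e₁ e₂) Φ σ ↔
    e₁.Safe E σ ∧ e₂.Safe E σ ∧ e₁.val E σ < E.stride ∧
      Φ ((σ.setArr a (e₁.val E σ) (e₂.val E σ)).tick (e₁.cost + e₂.cost + 4)) := Iff.rfl
@[simp] theorem wp_seq {s₁ s₂} : wp E (s₁ ;; s₂) Φ σ ↔ wp E s₁ (wp E s₂ Φ) σ := Iff.rfl
@[simp] theorem wp_ite {e s₁ s₂} : wp E (.ite e s₁ s₂) Φ σ ↔ e.Safe E σ ∧
      if e.val E σ = 0 then wp E s₂ Φ (σ.tick (e.cost + 1))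
      else wp E s₁ (fun σ' => Φ (σ'.tick 1)) (σ.tick (e.cost + 1)) := Iff.rfl

end

/-- The variables a statement may change. -/
def Stmt.Sets : Stmt → Var → Prop
  | .skip, _ => False
  | .set x _, y => y = x
  | .put _ _ _, _ => False
  | .seq s₁ s₂, y => s₁.Sets y ∨ s₂.Sets y
  | .ite _ s₁ s₂, y => s₁.Sets y ∨ s₂.Sets y
  | .loop _ _ s, y => s.Sets y

/-- The arrays a statement may change. -/
def Stmt.Puts : Stmt → Arr → Prop
  | .skip, _ => False
  | .set _ _, _ => False
  | .put a _ _, y => y = a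
  | .seq s₁ s₂, y => s₁.Puts y ∨ s₂.Puts y
  | .ite _ s₁ s₂, y => s₁.Puts y ∨ s₂.Puts y
  | .loop _ _ s, y => s.Puts y

section
variable (x y : Var) (a b : Arr) (e e₁ e₂ : Expr) (s s₁ s₂ : Stmt)
@[simp] theorem sets_skip : Stmt.skip.Sets y ↔ False := Iff.rfl
@[simp] theorem sets_set : (Stmt.set x e).Sets y ↔ y = x := Iff.rfl
@[simp] theorem sets_put : (Stmt.put a e₁ e₂).Sets y ↔ False := Iff.rfl
@[simp] theorem sets_seq : (s₁ ;; s₂).Sets y ↔ s₁.Sets y ∨ s₂.Sets y := Iff.rfl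
@[simp] theorem sets_ite : (Stmt.ite e s₁ s₂).Sets y ↔ s₁.Sets y ∨ s₂.Sets y := Iff.rfl
@[simp] theorem sets_loop : (Stmt.loop e₁ e₂ s).Sets y ↔ s.Sets y := Iff.rfl
@[simp] theorem puts_skip : Stmt.skip.Puts b ↔ False := Iff.rfl
@[simp] theorem puts_set : (Stmt.set x e).Puts b ↔ False := Iff.rfl
@[simp] theorem puts_put : (Stmt.put a e₁ e₂).Puts b ↔ b = a := Iff.rfl
@[simp] theorem puts_seq : (s₁ ;; s₂).Puts b ↔ s₁.Puts b ∨ s₂.Puts b := Iff.rfl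
@[simp] theorem puts_ite : (Stmt.ite e s₁ s₂).Puts b ↔ s₁.Puts b ∨ s₂.Puts b := Iff.rfl
@[simp] theorem puts_loop : (Stmt.loop e₁ e₂ s).Puts b ↔ s.Puts b := Iff.rfl
end

/-- `τ` differs from `σ` only in what `s` may change. -/
def Stmt.Frame (s : Stmt) (σ τ : St) : Prop :=
  (∀ x, ¬ s.Sets x → τ.var x = σ.var x) ∧ ∀ a, ¬ s.Puts a → τ.arr a = σ.arr a

theorem wpLoop_mono {E : Env} {e₁ e₂ : Expr} {W : (St → Prop) → St → Prop} {I : St → Prop}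
    (hW : ∀ Φ Ψ : St → Prop, ∀ σ, I σ → (∀ τ, I τ → Φ τ → Ψ τ) → W Φ σ → W Ψ σ)
    (hI : ∀ σ c, I σ → I (σ.tick c)) {Φ Ψ : St → Prop} (h : ∀ τ, I τ → Φ τ → Ψ τ) (k : ℕ) :
    ∀ σ, I σ → wpLoop E e₁ e₂ W Φ k σ → wpLoop E e₁ e₂ W Ψ k σ := by
  induction k with
  | zero => intro σ _ h; exact h
  | succ k ih =>
    intro σ hσ hk
    unfold wpLoop at hk ⊢
    refine ⟨hk.1, ?_⟩
    have hk := hk.2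
    split_ifs at hk ⊢ with h₁ h₂
    · exact h _ (hI _ _ hσ) hk
    · exact ⟨hk.1, h _ (hI _ _ hσ) hk.2⟩
    · exact ⟨hk.1, hW _ _ _ (hI _ _ hσ) (fun τ hτ h' => ih _ (hI _ _ hτ) h') hk.2⟩

/-- The rule of consequence, with the frame condition for free. -/
theorem wp_frame {E : Env} (s : Stmt) : ∀ {Φ Ψ : St → Prop} {σ : St}, wp E s Φ σ →
    (∀ τ, s.Frame σ τ → Φ τ → Ψ τ) → wp E s Ψ σ := by
  induction s with
  | skip => intro Φ Ψ σ h h'; exact h' _ ⟨fun _ _ => rfl, fun _ _ => rfl⟩ h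
  | set x e =>
    intro Φ Ψ σ h h'
    refine ⟨h.1, h' _ ⟨fun y hy => ?_, fun _ _ => rfl⟩ h.2⟩
    have : y ≠ x := hy
    simp [this]
  | put a e₁ e₂ =>
    intro Φ Ψ σ h h'
    refine ⟨h.1, h.2.1, h.2.2.1, h' _ ⟨fun _ _ => rfl, fun y hy => ?_⟩ h.2.2.2⟩
    have : y ≠ a := hy
    simp [this]
  | seq s₁ s₂ ih₁ ih₂ =>
    intro Φ Ψ σ h h'
    refine ih₁ h fun τ hτ h₂ => ih₂ h₂ fun υ hυ h₃ => h' _ ⟨fun x hx => ?_, fun x hx => ?_⟩ h₃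
    · rw [sets_seq, not_or] at hx
      rw [hυ.1 _ hx.2, hτ.1 _ hx.1]
    · rw [puts_seq, not_or] at hx
      rw [hυ.2 _ hx.2, hτ.2 _ hx.1]
  | ite e s₁ s₂ ih₁ ih₂ =>
    intro Φ Ψ σ h h'
    rw [wp_ite] at h ⊢
    refine ⟨h.1, ?_⟩
    have h := h.2
    split_ifs at h ⊢ with h₁
    · refine ih₂ h fun τ hτ h₂ => h' _ ⟨fun x hx => ?_, fun x hx => ?_⟩ h₂
      · rw [sets_ite, not_or] at hx; exact hτ.1 _ hx.2
      · rw [puts_ite, not_or] at hx; exact hτ.2 _ hx.2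
    · refine ih₁ h fun τ hτ h₂ => h' _ ⟨fun x hx => ?_, fun x hx => ?_⟩ h₂
      · rw [sets_ite, not_or] at hx; exact hτ.1 _ hx.1
      · rw [puts_ite, not_or] at hx; exact hτ.2 _ hx.1
  | loop e₁ e₂ s ih =>
    intro Φ Ψ σ h h'
    obtain ⟨k, hk⟩ := h
    refine ⟨k, wpLoop_mono (I := fun τ => s.Frame σ τ) ?_ ?_ (fun τ hτ => h' τ hτ) k σ
      ⟨fun _ _ => rfl, fun _ _ => rfl⟩ hk⟩
    · intro Φ Ψ τ hτ hΦ hw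
      refine ih hw fun υ hυ => hΦ υ ⟨fun x hx => ?_, fun x hx => ?_⟩
      · rw [hυ.1 x hx, hτ.1 x hx]
      · rw [hυ.2 x hx, hτ.2 x hx]
    · exact fun τ c hτ => hτ

theorem wp_mono {E : Env} {s : Stmt} {Φ Ψ : St → Prop} {σ : St} (h : wp E s Φ σ)
    (h' : ∀ τ, Φ τ → Ψ τ) : wp E s Ψ σ :=
  wp_frame s h fun τ _ => h' τ

theorem Stmt.Frame.refl (s : Stmt) (σ : St) : s.Frame σ σ := ⟨fun _ _ => rfl, fun _ _ => rfl⟩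

theorem Stmt.Frame.trans {s : Stmt} {σ τ υ : St} (h : s.Frame σ τ) (h' : s.Frame τ υ) :
    s.Frame σ υ :=
  ⟨fun x hx => (h'.1 x hx).trans (h.1 x hx), fun a ha => (h'.2 a ha).trans (h.2 a ha)⟩

/-- The rule for loops, with an invariant `I` and a variant `μ`. -/
theorem wp_loop {E : Env} {e₁ e₂ : Expr} {s : Stmt} {Φ : St → Prop} {σ : St} (I : St → Prop)
    (μ : St → ℕ)
    (h : ∀ τ, s.Frame σ τ → I τ → e₁.Safe E τ ∧
      if e₁.val E τ = 0 then Φ (τ.tick (e₁.cost + 1))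
      else e₂.Safe E τ ∧
        if e₂.val E τ = 0 then Φ (τ.tick (e₁.cost + e₂.cost + 2))
        else wp E s (fun υ => I (υ.tick 1) ∧ μ (υ.tick 1) < μ τ)
          (τ.tick (e₁.cost + e₂.cost + 2))) (hσ : I σ) :
    wp E (.loop e₁ e₂ s) Φ σ := by
  have key : ∀ m τ, s.Frame σ τ → I τ → μ τ < m → wpLoop E e₁ e₂ (wp E s) Φ m τ := by
    intro m
    induction m with
    | zero => intro τ _ _ hm; omega
    | succ m ih =>
      intro τ hf hτ hm
      unfold wpLoop
      refine ⟨(h τ hf hτ).1, ?_⟩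
      have h := (h τ hf hτ).2
      split_ifs at h ⊢ with h₁ h₂
      · exact h
      · exact h
      · exact ⟨h.1, wp_frame s h.2 fun υ hυ hI => ih _ (hf.trans hυ) hI.1 (by omega)⟩
  exact ⟨_, key _ σ (.refl s σ) hσ (Nat.lt_succ_self _)⟩

/-- Counting loops: `x` runs from the value of `lo` up to, but not including, the value of `hi`. -/
def Stmt.count (x : Var) (lo : Expr) (hi : Var) (s : Stmt) : Stmt :=
  .set x lo ;; .loop (.op .lt (.vr x) (.vr hi)) (.cst 1) (s ;; .set x (.vr x + .cst 1))

@[simp] theorem sets_count (x y : Var) (lo : Expr) (hi : Var) (s : Stmt) :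
    (Stmt.count x lo hi s).Sets y ↔ y = x ∨ s.Sets y := by
  simp [Stmt.count]; tauto

@[simp] theorem puts_count (x : Var) (y : Arr) (lo : Expr) (hi : Var) (s : Stmt) :
    (Stmt.count x lo hi s).Puts y ↔ s.Puts y := by
  simp [Stmt.count]

/-- The rule for counting loops.  The invariant speaks of arrays, of variables and of the time
spent so far. -/
theorem wp_count {E : Env} {x hi : Var} {lo : Expr} {s : Stmt} {Φ : St → Prop} {σ : St}
    (I : ℕ → St → Prop) (a N : ℕ) (hx : ¬ s.Sets x) (hhi : ¬ s.Sets hi) (hne : hi ≠ x)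
    (hsafe : lo.Safe E σ) (ha : lo.val E σ = a) (haN : a ≤ N) (hN : σ.var hi = N)
    (hNw : N < 2 ^ E.w)
    (h0 : I a ((σ.setVar x a).tick (lo.cost + 1)))
    (hstep : ∀ i τ, a ≤ i → i < N → I i τ → τ.var x = i → τ.var hi = N →
      (∀ y, y ≠ x → ¬ s.Sets y → τ.var y = σ.var y) → (∀ a, ¬ s.Puts a → τ.arr a = σ.arr a) →
      wp E s (fun υ => I (i + 1) ((υ.setVar x (i + 1)).tick 5)) (τ.tick 6))
    (hend : ∀ τ, I N τ → τ.var x = N → Φ (τ.tick 4)) :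
    wp E (Stmt.count x lo hi s) Φ σ := by
  unfold Stmt.count
  rw [wp_seq, wp_set]
  refine ⟨hsafe, ?_⟩
  rw [ha]
  refine wp_loop (fun τ => I (τ.var x) τ ∧ a ≤ τ.var x ∧ τ.var x ≤ N ∧ τ.var hi = N)
    (fun τ => N - τ.var x) ?_ ?_
  · rintro τ hf ⟨hI, h1, h2, h3⟩
    refine ⟨by simp, ?_⟩
    rcases Nat.lt_or_ge (τ.var x) N with hlt | hge
    · have h1w : 1 < 2 ^ E.w := by omega
      simp only [Expr.val_lt, Expr.val_vr, h3, hlt, if_true, one_ne_zero, if_false,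
        Expr.safe_cst, Expr.val_cst]
      refine ⟨h1w, ?_⟩
      rw [wp_seq]
      refine wp_frame s (hstep _ τ h1 hlt hI rfl h3 (fun y hy hs => ?_) (fun b hb => ?_)) ?_
      · simpa [hy] using hf.1 y (by simp [hy, hs])
      · simpa using hf.2 b (by simp [hb])
      intro υ hυ hIυ
      have e1 := hυ.1 x hx
      have e2 := hυ.1 hi hhi
      simp only [St.var_tick] at e1 e2
      simp only [wp_set, Expr.safe_add, Expr.safe_vr, Expr.safe_cst, Expr.val_vr, Expr.val_cst,
        Expr.val_add, St.var_tick, St.var_setVar, if_true, hne, if_false, e1, e2]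
      refine ⟨⟨trivial, h1w, by omega⟩, ⟨?_, by omega, by omega, h3⟩, by omega⟩
      exact hIυ
    · have hN' : τ.var x = N := le_antisymm h2 hge
      simp only [Expr.val_lt, Expr.val_vr, h3, hN', lt_irrefl, if_false, if_true]
      exact hend τ (hN' ▸ hI) hN'
  · simp [hne, hN, haN, h0]

/-! ### Compilation -/

/-- The register of a variable. -/
def Var.reg (x : Var) : ℕ := x.ctorIdx

/-- The number of an array: the array `a` starts at the memory cell `a.idx * stride`. -/
def Arr.idx (a : Arr) : ℕ := a.ctorIdx

theorem Var.reg_injective : Function.Injective Var.reg := fun x y h => by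
  have := congrArg Var.ofNat h
  rwa [Var.reg, Var.reg, Var.ofNat_ctorIdx, Var.ofNat_ctorIdx] at this

theorem Var.reg_lt (x : Var) : x.reg < 60 := by cases x <;> decide

theorem Arr.idx_injective : Function.Injective Arr.idx := fun x y h => by
  have := congrArg Arr.ofNat h
  rwa [Arr.idx, Arr.idx, Arr.ofNat_ctorIdx, Arr.ofNat_ctorIdx] at this

theorem Arr.idx_lt (a : Arr) : a.idx < 15 := by cases a <;> decide

/-- Code that evaluates an expression into register `d` and changes no register below `d`.  Register
`62` holds the stride. -/
def Expr.code : Expr → ℕ → List Instr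
  | vr x, d => [.op .or d x.reg x.reg]
  | cst k, d => [.const d k]
  | op o e₁ e₂, d => e₁.code d ++ (e₂.code (d + 1) ++ [.op o d d (d + 1)])
  | ld a e, d => e.code d ++
      [.const (d + 1) a.idx, .op .mul (d + 1) (d + 1) 62, .op .add d d (d + 1), .load d d]
  | rd s e, d => e.code d ++ [.read s d d]

/-- Code for a statement, to be placed at position `pc`.  Register `61` holds zero. -/
def Stmt.code : Stmt → ℕ → List Instr
  | .skip, _ => []
  | .set x e, _ => e.code 64 ++ [.op .or x.reg 64 64]
  | .put a e₁ e₂, _ => e₁.code 64 ++ (e₂.code 65 ++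
      [.const 66 a.idx, .op .mul 66 66 62, .op .add 64 64 66, .store 64 65])
  | .seq s₁ s₂, pc => s₁.code pc ++ s₂.code (pc + (s₁.code pc).length)
  | .ite e s₁ s₂, pc =>
      let c₀ := e.code 64
      let c₁ := s₁.code (pc + c₀.length + 1)
      let c₂ := s₂.code (pc + c₀.length + 1 + c₁.length + 1)
      c₀ ++ (.jumpIfZero 64 (pc + c₀.length + 1 + c₁.length + 1) ::
        (c₁ ++ (.jumpIfZero 61 (pc + c₀.length + 1 + c₁.length + 1 + c₂.length) :: c₂)))
  | .loop e₁ e₂ s, pc =>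
      let c₁ := e₁.code 64
      let c₂ := e₂.code 64
      let c := s.code (pc + c₁.length + 1 + c₂.length + 1)
      let fin := pc + c₁.length + 1 + c₂.length + 1 + c.length + 1
      c₁ ++ (.jumpIfZero 64 fin :: (c₂ ++ (.jumpIfZero 64 fin :: (c ++ [.jumpIfZero 61 pc]))))

theorem Expr.length_code (e : Expr) (d : ℕ) : (e.code d).length = e.cost := by
  induction e generalizing d <;> simp [Expr.code, Expr.cost, *]; omega

/-- The program `P` has the code `l` at position `pc`. -/
def CodeAt (P : Program) (pc : ℕ) (l : List Instr) : Prop :=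
  ∀ i (h : i < l.length), P[pc + i]? = some l[i]

theorem CodeAt.left {P : Program} {pc : ℕ} {l₁ l₂ : List Instr} (h : CodeAt P pc (l₁ ++ l₂)) :
    CodeAt P pc l₁ := fun i hi => by
  rw [h i (by simp; omega), List.getElem_append_left hi]

theorem CodeAt.right {P : Program} {pc : ℕ} {l₁ l₂ : List Instr} (h : CodeAt P pc (l₁ ++ l₂)) :
    CodeAt P (pc + l₁.length) l₂ := fun i hi => by
  rw [Nat.add_assoc, h (l₁.length + i) (by simp; omega)]
  rw [List.getElem_append_right (by omega)]
  simp

theorem CodeAt.head {P : Program} {pc : ℕ} {x : Instr} {l : List Instr} (h : CodeAt P pc (x :: l)) :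
    P[pc]? = some x := h 0 (by simp)

theorem CodeAt.tail {P : Program} {pc : ℕ} {x : Instr} {l : List Instr} (h : CodeAt P pc (x :: l)) :
    CodeAt P (pc + 1) l := fun i hi => by
  have := h (i + 1) (by simpa using hi)
  rwa [Nat.add_assoc, Nat.add_comm 1 i]

/-- The configuration `c` represents the state `σ` (apart from the time). -/
structure Rep (E : Env) (σ : St) (c : Config E.w) : Prop where
  var : ∀ x : Var, (c.reg x.reg).toNat = σ.var x
  arr : ∀ (a : Arr) (i : ℕ), i < E.stride →
    (c.mem (BitVec.ofNat E.w (a.idx * E.stride + i))).toNat = σ.arr a i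
  stride : (c.reg 62).toNat = E.stride
  zero : c.reg 61 = 0#E.w

/-- What the simulation needs to know of the surroundings: the arrays fit into the memory, and
`input` holds the input arrays. -/
structure Env.Fits (E : Env) (input : Input → BitVec E.w → BitVec E.w) : Prop where
  mem : 15 * E.stride ≤ 2 ^ E.w
  inp : ∀ s i, i < E.n → (input s (BitVec.ofNat E.w i)).toNat = E.inp s i

theorem Op.toNat_eval {w : ℕ} (o : Op) (x y : BitVec w) (hw : 1 < 2 ^ w)
    (h : o.Exact w x.toNat y.toNat) : (o.eval x y).toNat = o.nat x.toNat y.toNat := by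
  have h1 : (1#w).toNat = 1 := by simp [Nat.mod_eq_of_lt hw]
  cases o
  case add => simpa [Op.eval, Op.nat] using Nat.mod_eq_of_lt h
  case sub => exact BitVec.toNat_sub_of_le (by simpa [BitVec.le_def, Op.Exact] using h)
  case mul => simpa [Op.eval, Op.nat] using Nat.mod_eq_of_lt h
  case shl => simpa [Op.eval, Op.nat, Nat.shiftLeft_eq] using Nat.mod_eq_of_lt h
  case shr => simp [Op.eval, Op.nat, Nat.shiftRight_eq_div_pow]
  case eq =>
    simp only [Op.eval, Op.nat, BitVec.toNat_inj]
    split_ifs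
    · exact h1
    · rfl
  case lt =>
    simp only [Op.eval, Op.nat]
    split_ifs
    · exact h1
    · rfl
  all_goals simp [Op.eval, Op.nat]

theorem step_of {w : ℕ} {P : Program} {input : Input → BitVec w → BitVec w} {c : Config w}
    {ins : Instr} (h : P[c.pc]? = some ins) : step P input c = ins.exec input c := by
  simp [step, h]

section
variable {E : Env} {input : Input → BitVec E.w → BitVec E.w} {P : Program}

theorem Env.Fits.address (hE : E.Fits input) (a : Arr) {i : ℕ} (hi : i < E.stride) :
    a.idx * E.stride + i < 2 ^ E.w := by
  have h1 := a.idx_lt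
  have h2 := hE.mem
  have : (a.idx + 1) * E.stride ≤ 15 * E.stride := Nat.mul_le_mul_right _ h1
  rw [Nat.add_mul, Nat.one_mul] at this
  omega

/-- The machine evaluates expressions. -/
theorem Expr.sim (hE : E.Fits input) (hw : 1 < 2 ^ E.w) (e : Expr) {σ : St} :
    ∀ (c : Config E.w) (d : ℕ), 64 ≤ d → Rep E σ c → CodeAt P c.pc (e.code d) → e.Safe E σ →
      ∃ c', (step P input)^[e.cost] c = c' ∧ c'.pc = c.pc + e.cost ∧ c'.mem = c.mem ∧
        (c'.reg d).toNat = e.val E σ ∧ ∀ r, r < d → c'.reg r = c.reg r := by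
  have keep : ∀ {c c' : Config E.w} {d : ℕ}, 64 ≤ d → c'.mem = c.mem →
      (∀ r, r < d → c'.reg r = c.reg r) → Rep E σ c → Rep E σ c' := by
    intro c c' d hd hm hr h
    refine ⟨fun x => ?_, fun a i hi => ?_, ?_, ?_⟩
    · rw [hr _ (by have := x.reg_lt; omega), h.var]
    · rw [hm, h.arr a i hi]
    · rw [hr _ (by omega), h.stride]
    · rw [hr _ (by omega), h.zero]
  induction e with
  | vr x =>
    intro c d hd hr hc _
    refine ⟨_, rfl, ?_⟩
    simp only [Expr.cost, Function.iterate_one]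
    rw [step_of hc.head]
    refine ⟨rfl, rfl, ?_, fun r hr => Function.update_of_ne (by omega) _ _⟩
    simp [Instr.exec, Op.eval, Expr.val, hr.var]
  | cst k =>
    intro c d hd hr hc hs
    refine ⟨_, rfl, ?_⟩
    simp only [Expr.cost, Function.iterate_one]
    rw [step_of hc.head]
    refine ⟨rfl, rfl, ?_, fun r hr => Function.update_of_ne (by omega) _ _⟩
    simpa [Instr.exec, Expr.val] using Nat.mod_eq_of_lt hs
  | op o e₁ e₂ ih₁ ih₂ =>
    intro c d hd hr hc hs
    obtain ⟨c₁, hs₁, hpc₁, hm₁, hv₁, hk₁⟩ := ih₁ c d hd hr hc.left hs.1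
    have hc₂ := hc.right
    rw [Expr.length_code, ← hpc₁] at hc₂
    obtain ⟨c₂, hs₂, hpc₂, hm₂, hv₂, hk₂⟩ := ih₂ c₁ (d + 1) (by omega) (keep hd hm₁ hk₁ hr)
      hc₂.left hs.2.1
    have hc₃ := hc₂.right
    rw [Expr.length_code, ← hpc₂] at hc₃
    refine ⟨_, rfl, ?_⟩
    have : (Expr.op o e₁ e₂).cost = 1 + (e₂.cost + e₁.cost) := by simp [Expr.cost]; ring
    rw [this, Function.iterate_add_apply, Function.iterate_add_apply, hs₁, hs₂,
      Function.iterate_one, step_of hc₃.head]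
    refine ⟨?_, by simp [Instr.exec, hm₁, hm₂], ?_, fun r hr => ?_⟩
    · simp [Instr.exec, hpc₁, hpc₂]; ring
    · have hd1 : (c₂.reg d).toNat = e₁.val E σ := by rw [hk₂ d (by omega), hv₁]
      simp only [Instr.exec, Function.update_self]
      rw [Op.toNat_eval _ _ _ hw (by rw [hd1, hv₂]; exact hs.2.2), hd1, hv₂]
      rfl
    · simp only [Instr.exec]
      rw [Function.update_of_ne (by omega), hk₂ r (by omega), hk₁ r hr]
  | ld a e ih =>
    intro c d hd hr hc hs
    obtain ⟨c₁, hs₁, hpc₁, hm₁, hv₁, hk₁⟩ := ih c d hd hr hc.left hs.1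
    have hr₁ := keep hd hm₁ hk₁ hr
    have hc₂ := hc.right
    rw [Expr.length_code, ← hpc₁] at hc₂
    have hadr := hE.address a hs.2
    have hidx : a.idx * E.stride < 2 ^ E.w := by omega
    have hidx' : a.idx < 2 ^ E.w := by
      have : 0 < E.stride := by have := hs.2; omega
      exact lt_of_le_of_lt (Nat.le_mul_of_pos_right _ this) hidx
    have ht := hc₂.tail
    have ht2 := ht.tail
    have ht3 := ht2.tail
    refine ⟨_, rfl, ?_⟩
    have : (Expr.ld a e).cost = 4 + e.cost := by simp [Expr.cost]; ring
    rw [this, Function.iterate_add_apply, hs₁]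
    have e1 := step_of (input := input) hc₂.head
    simp only [Function.iterate_succ, Function.comp, Function.iterate_zero, id_eq]
    rw [e1]
    simp only [Instr.exec]
    rw [step_of (c := ⟨c₁.pc + 1, _, _⟩) ht.head]
    simp only [Instr.exec]
    rw [step_of (c := ⟨c₁.pc + 1 + 1, _, _⟩) ht2.head]
    simp only [Instr.exec]
    rw [step_of (c := ⟨c₁.pc + 1 + 1 + 1, _, _⟩) ht3.head]
    simp only [Instr.exec]
    refine ⟨by omega, hm₁, ?_, fun r hr => ?_⟩
    · have h62 : (62 : ℕ) ≠ d + 1 := by omega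
      simp only [Function.update_self, Function.update_of_ne h62,
        Function.update_of_ne (show d ≠ d + 1 by omega), Expr.val]
      rw [← hr₁.arr a _ hs.2]
      congr 2
      apply BitVec.eq_of_toNat_eq
      rw [Op.toNat_eval, Op.toNat_eval]
      · simp [Op.nat, hr₁.stride, hv₁, Nat.mod_eq_of_lt hidx', Nat.mod_eq_of_lt hadr]
        omega
      · exact hw
      · simp [Op.Exact, hr₁.stride, Nat.mod_eq_of_lt hidx', hidx]
      · exact hw
      · rw [Op.toNat_eval _ _ _ hw]
        · simp [Op.Exact, Op.nat, hr₁.stride, hv₁, Nat.mod_eq_of_lt hidx']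
          omega
        · simp [Op.Exact, hr₁.stride, Nat.mod_eq_of_lt hidx', hidx]
    · rw [Function.update_of_ne (by omega), Function.update_of_ne (by omega),
        Function.update_of_ne (by omega), Function.update_of_ne (by omega), hk₁ r hr]
  | rd s e ih =>
    intro c d hd hr hc hs
    obtain ⟨c₁, hs₁, hpc₁, hm₁, hv₁, hk₁⟩ := ih c d hd hr hc.left hs.1
    have hc₂ := hc.right
    rw [Expr.length_code, ← hpc₁] at hc₂
    refine ⟨_, rfl, ?_⟩
    have : (Expr.rd s e).cost = 1 + e.cost := by simp [Expr.cost]; ring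
    rw [this, Function.iterate_add_apply, hs₁, Function.iterate_one, step_of hc₂.head]
    refine ⟨by simp [Instr.exec, hpc₁]; ring, hm₁, ?_, fun r hr => ?_⟩
    · simp only [Instr.exec, Function.update_self, Expr.val]
      rw [← hE.inp s _ hs.2]
      congr 2
      apply BitVec.eq_of_toNat_eq
      rw [hv₁, BitVec.toNat_ofNat, Nat.mod_eq_of_lt]
      rw [← hv₁]; exact (c₁.reg d).isLt
    · simp only [Instr.exec]
      rw [Function.update_of_ne (by omega), hk₁ r hr]

/-- Evaluating into a register from `64` on leaves the represented state unchanged. -/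
theorem Rep.of_keep {σ : St} {c c' : Config E.w} {d : ℕ} (hd : 64 ≤ d) (hm : c'.mem = c.mem)
    (hr : ∀ r, r < d → c'.reg r = c.reg r) (h : Rep E σ c) : Rep E σ c' := by
  refine ⟨fun x => ?_, fun a i hi => ?_, ?_, ?_⟩
  · rw [hr _ (by have := x.reg_lt; omega), h.var]
  · rw [hm, h.arr a i hi]
  · rw [hr _ (by omega), h.stride]
  · rw [hr _ (by omega), h.zero]

theorem Rep.congr {σ τ : St} {c : Config E.w} (h : Rep E σ c) (hv : τ.var = σ.var)
    (ha : τ.arr = σ.arr) : Rep E τ c :=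
  ⟨fun x => hv ▸ h.var x, fun a i hi => ha ▸ h.arr a i hi, h.stride, h.zero⟩

theorem Rep.jump {σ : St} {c : Config E.w} (h : Rep E σ c) (k x tgt : ℕ) :
    Rep E (σ.tick k) ((Instr.jumpIfZero x tgt).exec input c) :=
  ⟨h.var, h.arr, h.stride, h.zero⟩

theorem Expr.val_tick (e : Expr) (σ : St) (k : ℕ) : e.val E (σ.tick k) = e.val E σ := by
  induction e <;> simp [Expr.val, *]

theorem Expr.safe_tick (e : Expr) (σ : St) (k : ℕ) : e.Safe E (σ.tick k) ↔ e.Safe E σ := by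
  induction e <;> simp [Expr.Safe, Expr.val_tick, *]

/-- `s`, started in `σ`, is simulated by its code at position `pc`, and ends in `Φ`. -/
def Simulates (input : Input → BitVec E.w → BitVec E.w) (P : Program) (len : ℕ) (Φ : St → Prop)
    (σ : St) (c : Config E.w) : Prop :=
  ∃ (τ : St) (m : ℕ), Φ τ ∧ τ.time = σ.time + m ∧ Rep E τ ((step P input)^[m] c) ∧
    ((step P input)^[m] c).pc = c.pc + len

/-- The machine evaluates a condition and jumps. -/
theorem cond_sim (hE : E.Fits input) (hw : 1 < 2 ^ E.w) (e : Expr) {σ : St} {c : Config E.w}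
    {tgt : ℕ} {l : List Instr} (hr : Rep E σ c)
    (hc : CodeAt P c.pc (e.code 64 ++ (.jumpIfZero 64 tgt :: l))) (hs : e.Safe E σ) :
    Rep E (σ.tick (e.cost + 1)) ((step P input)^[e.cost + 1] c) ∧
      ((step P input)^[e.cost + 1] c).pc =
        if e.val E σ = 0 then tgt else c.pc + e.cost + 1 := by
  obtain ⟨c₁, hs₁, hpc₁, hm₁, hv₁, hk₁⟩ := e.sim hE hw c 64 le_rfl hr hc.left hs
  have hc₂ := hc.right
  rw [Expr.length_code, ← hpc₁] at hc₂
  rw [Function.iterate_succ_apply', hs₁, step_of hc₂.head]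
  refine ⟨(hr.of_keep le_rfl hm₁ hk₁).jump _ _ _, ?_⟩
  simp only [Instr.exec, ← hv₁, hpc₁]
  congr 1
  rw [← BitVec.toNat_inj]; simp

/-- The code of a statement does what `wp` says. -/
theorem Stmt.sim (hE : E.Fits input) (hw : 1 < 2 ^ E.w) (s : Stmt) :
    ∀ {Φ : St → Prop} {σ : St} {c : Config E.w}, wp E s Φ σ → Rep E σ c →
      CodeAt P c.pc (s.code c.pc) → Simulates input P (s.code c.pc).length Φ σ c := by
  induction s with
  | skip => intro Φ σ c h hr _; exact ⟨σ, 0, h, rfl, hr, rfl⟩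
  | set x e =>
    intro Φ σ c h hr hc
    obtain ⟨c₁, hs₁, hpc₁, hm₁, hv₁, hk₁⟩ := e.sim hE hw c 64 le_rfl hr hc.left h.1
    have hc₂ := hc.right
    rw [Expr.length_code, ← hpc₁] at hc₂
    refine ⟨_, e.cost + 1, h.2, by simp, ?_⟩
    rw [Function.iterate_succ_apply', hs₁, step_of hc₂.head]
    have hr₁ := hr.of_keep le_rfl hm₁ hk₁
    have hxl := x.reg_lt
    refine ⟨⟨fun y => ?_, hr₁.arr, ?_, ?_⟩, ?_⟩
    · simp only [Instr.exec, St.var_tick, St.var_setVar]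
      split_ifs with hyx
      · subst hyx
        simp [Op.eval, hv₁]
      · rw [Function.update_of_ne (fun hh => hyx (Var.reg_injective hh)), hr₁.var]
    · simp only [Instr.exec]; rw [Function.update_of_ne (by omega), hr₁.stride]
    · simp only [Instr.exec]; rw [Function.update_of_ne (by omega), hr₁.zero]
    · simp [Instr.exec, hpc₁, Stmt.code, Expr.length_code]; ring
  | put a e₁ e₂ =>
    intro Φ σ c h hr hc
    obtain ⟨h1, h2, h3, h4⟩ := h
    obtain ⟨c₁, hs₁, hpc₁, hm₁, hv₁, hk₁⟩ := e₁.sim hE hw c 64 le_rfl hr hc.left h1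
    have hr₁ := hr.of_keep le_rfl hm₁ hk₁
    have hc₂ := hc.right
    rw [Expr.length_code, ← hpc₁] at hc₂
    obtain ⟨c₂, hs₂, hpc₂, hm₂, hv₂, hk₂⟩ := e₂.sim hE hw c₁ 65 (by omega) hr₁ hc₂.left h2
    have hr₂ := hr₁.of_keep (by omega) hm₂ hk₂
    have hc₃ := hc₂.right
    rw [Expr.length_code, ← hpc₂] at hc₃
    have hadr := hE.address a h3
    have hidx : a.idx * E.stride < 2 ^ E.w := by omega
    have hidx' : a.idx < 2 ^ E.w := by
      have : 0 < E.stride := by omega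
      exact lt_of_le_of_lt (Nat.le_mul_of_pos_right _ this) hidx
    have h64 : (c₂.reg 64).toNat = e₁.val E σ := by rw [hk₂ 64 (by omega), hv₁]
    have ht := hc₃.tail
    have ht2 := ht.tail
    have ht3 := ht2.tail
    refine ⟨_, 4 + (e₂.cost + e₁.cost), h4, by simp; ring, ?_⟩
    rw [Function.iterate_add_apply, Function.iterate_add_apply, hs₁, hs₂]
    have e1 := step_of (input := input) hc₃.head
    simp only [Function.iterate_succ, Function.comp, Function.iterate_zero, id_eq]
    rw [e1]
    simp only [Instr.exec]
    rw [step_of (c := ⟨c₂.pc + 1, _, _⟩) ht.head]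
    simp only [Instr.exec]
    rw [step_of (c := ⟨c₂.pc + 1 + 1, _, _⟩) ht2.head]
    simp only [Instr.exec]
    rw [step_of (c := ⟨c₂.pc + 1 + 1 + 1, _, _⟩) ht3.head]
    simp only [Instr.exec]
    have n1 : (62 : ℕ) ≠ 66 := by decide
    have n2 : (64 : ℕ) ≠ 66 := by decide
    have n3 : (65 : ℕ) ≠ 64 := by decide
    have n4 : (65 : ℕ) ≠ 66 := by decide
    have hA : Op.add.eval (c₂.reg 64) (Op.mul.eval (BitVec.ofNat E.w a.idx) (c₂.reg 62)) =
        BitVec.ofNat E.w (a.idx * E.stride + e₁.val E σ) := by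
      apply BitVec.eq_of_toNat_eq
      rw [Op.toNat_eval _ _ _ hw, Op.toNat_eval _ _ _ hw]
      · simp [Op.nat, hr₂.stride, h64, Nat.mod_eq_of_lt hidx', Nat.mod_eq_of_lt hadr]
        omega
      · simp [Op.Exact, hr₂.stride, Nat.mod_eq_of_lt hidx', hidx]
      · rw [Op.toNat_eval _ _ _ hw]
        · simp [Op.Exact, Op.nat, hr₂.stride, h64, Nat.mod_eq_of_lt hidx']
          omega
        · simp [Op.Exact, hr₂.stride, Nat.mod_eq_of_lt hidx', hidx]
    simp only [Function.update_self, Function.update_of_ne n1, Function.update_of_ne n2,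
      Function.update_of_ne n3, Function.update_of_ne n4, hA]
    refine ⟨⟨fun y => ?_, fun b i hi => ?_, ?_, ?_⟩, ?_⟩
    · have := y.reg_lt
      simp only []
      rw [Function.update_of_ne (by omega), Function.update_of_ne (by omega),
        Function.update_of_ne (by omega), hr₂.var]
      rfl
    · simp only [St.arr_tick, St.arr_setArr]
      have hadr' := hE.address b hi
      by_cases hb : b = a
      · subst hb
        by_cases hi' : i = e₁.val E σ
        · subst hi'; simp [hv₂]
        · rw [Function.update_of_ne, hr₂.arr b i hi]
          · simp [hi']
          · intro hh
            have := congrArg BitVec.toNat hh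
            rw [BitVec.toNat_ofNat, BitVec.toNat_ofNat, Nat.mod_eq_of_lt hadr,
              Nat.mod_eq_of_lt hadr'] at this
            omega
      · rw [Function.update_of_ne, hr₂.arr b i hi]
        · simp [hb]
        · intro hh
          have := congrArg BitVec.toNat hh
          rw [BitVec.toNat_ofNat, BitVec.toNat_ofNat, Nat.mod_eq_of_lt hadr,
            Nat.mod_eq_of_lt hadr'] at this
          apply hb
          apply Arr.idx_injective
          have := congrArg (· / E.stride) this
          have hS : 0 < E.stride := by omega
          simpa [Nat.mul_comm _ E.stride, Nat.mul_add_div hS, Nat.div_eq_of_lt hi,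
            Nat.div_eq_of_lt h3] using this
    · simp only []
      rw [Function.update_of_ne (by omega), Function.update_of_ne (by omega),
        Function.update_of_ne (by omega), hr₂.stride]
    · simp only []
      rw [Function.update_of_ne (by omega), Function.update_of_ne (by omega),
        Function.update_of_ne (by omega), hr₂.zero]
    · simp [Stmt.code, Expr.length_code]; omega
  | seq s₁ s₂ ih₁ ih₂ =>
    intro Φ σ c h hr hc
    obtain ⟨τ, m, h₂, ht, hr₁, hpc⟩ := ih₁ h hr hc.left
    have hc₂ := hc.right
    rw [← hpc] at hc₂
    obtain ⟨υ, m', h₃, ht', hr₂, hpc'⟩ := ih₂ h₂ hr₁ hc₂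
    refine ⟨υ, m' + m, h₃, by omega, ?_⟩
    rw [Function.iterate_add_apply]
    refine ⟨hr₂, ?_⟩
    rw [hpc', hpc]
    simp [Stmt.code, Nat.add_assoc]
  | ite e s₁ s₂ ih₁ ih₂ =>
    intro Φ σ c h hr hc
    rw [wp_ite] at h
    obtain ⟨h0, h⟩ := h
    have hc' := hc
    simp only [Stmt.code] at hc'
    obtain ⟨hr₁, hpc₁⟩ := cond_sim hE hw e hr hc' h0
    have hc₁ := hc'.right.tail
    have hc₂ := hc₁.right.tail
    have hj := hc₁.right.head
    simp only [Expr.length_code] at hc₁ hc₂ hj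
    unfold Simulates
    simp only [Stmt.code, Expr.length_code, List.length_append, List.length_cons]
    split_ifs at h with hv
    · rw [if_pos hv] at hpc₁
      simp only [Expr.length_code] at hpc₁
      rw [← hpc₁] at hc₂
      obtain ⟨τ, m, hΦ, ht, hr₂, hpc₂⟩ := ih₂ h hr₁ hc₂
      refine ⟨τ, m + (e.cost + 1), hΦ, by rw [ht]; simp; omega, ?_⟩
      rw [Function.iterate_add_apply]
      refine ⟨hr₂, ?_⟩
      rw [hpc₂, hpc₁]
      omega
    · rw [if_neg hv] at hpc₁
      have hc₁ := hc₁.left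
      rw [← hpc₁] at hc₁ hj
      obtain ⟨τ, m, hΦ, ht, hr₂, hpc₂⟩ := ih₁ h hr₁ hc₁
      refine ⟨_, 1 + (m + (e.cost + 1)), hΦ, by simp [ht]; omega, ?_⟩
      rw [Function.iterate_add_apply, Function.iterate_add_apply, Function.iterate_one]
      rw [← hpc₂] at hj
      rw [step_of hj]
      refine ⟨hr₂.jump _ _ _, ?_⟩
      simp only [Instr.exec, hr₂.zero, if_true]
      rw [hpc₂, hpc₁]
      omega
  | loop e₁ e₂ s ih =>
    intro Φ σ c h hr hc
    obtain ⟨k, hk⟩ := h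
    have key : ∀ (k : ℕ) (σ : St) (c' : Config E.w), c'.pc = c.pc → Rep E σ c' →
        wpLoop E e₁ e₂ (wp E s) Φ k σ →
        Simulates input P ((Stmt.loop e₁ e₂ s).code c.pc).length Φ σ c' := by
      intro k
      induction k with
      | zero => intro _ _ _ _ h; exact h.elim
      | succ k ihk =>
        intro σ c' hcc hr hk
        have hc' := hc
        unfold wpLoop at hk
        obtain ⟨h1, hk⟩ := hk
        simp only [Stmt.code] at hc'
        rw [← hcc] at hc'
        obtain ⟨hr₁, hpc₁⟩ := cond_sim hE hw e₁ hr hc' h1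
        have hc₁ := hc'.right.tail
        simp only [Expr.length_code] at hc₁ hpc₁
        have hlen : c.pc + ((Stmt.loop e₁ e₂ s).code c.pc).length =
            c'.pc + e₁.cost + 1 + e₂.cost + 1 +
              (s.code (c'.pc + e₁.cost + 1 + e₂.cost + 1)).length + 1 := by
          simp only [Stmt.code, Expr.length_code, List.length_append, List.length_cons, hcc,
            List.length_nil]
          omega
        split_ifs at hk with hv₁ hv₂
        · rw [if_pos hv₁] at hpc₁
          exact ⟨_, e₁.cost + 1, hk, rfl, hr₁, by rw [hpc₁, hcc, hlen, hcc]⟩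
        · obtain ⟨h2, hk⟩ := hk
          rw [if_neg hv₁] at hpc₁
          rw [← hpc₁] at hc₁
          obtain ⟨hr₂, hpc₂⟩ := cond_sim hE hw e₂ hr₁ hc₁ ((Expr.safe_tick _ _ _).2 h2)
          have hv₂' : e₂.val E (σ.tick (e₁.cost + 1)) = 0 := by
            rwa [Expr.val_tick]
          rw [if_pos hv₂', hpc₁] at hpc₂
          refine ⟨_, (e₂.cost + 1) + (e₁.cost + 1), hk, by simp; omega, ?_⟩
          rw [Function.iterate_add_apply]
          exact ⟨hr₂.congr rfl rfl, by rw [hpc₂, hcc, hlen, hcc]⟩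
        · obtain ⟨h2, hk⟩ := hk
          rw [if_neg hv₁] at hpc₁
          rw [← hpc₁] at hc₁
          obtain ⟨hr₂, hpc₂⟩ := cond_sim hE hw e₂ hr₁ hc₁ ((Expr.safe_tick _ _ _).2 h2)
          have hv₂' : ¬ e₂.val E (σ.tick (e₁.cost + 1)) = 0 := by
            rwa [Expr.val_tick]
          rw [if_neg hv₂'] at hpc₂
          have hc₂ := hc₁.right.tail
          have hc₃ := hc₂.right.head
          have hc₂ := hc₂.left
          simp only [Expr.length_code] at hc₂ hc₃
          rw [← hpc₂] at hc₂ hc₃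
          obtain ⟨τ, m, hτ, ht, hr₃, hpc₃⟩ := ih hk (hr₂.congr rfl rfl) hc₂
          rw [← hpc₃] at hc₃
          have hr₄ : Rep E (τ.tick 1) (step P input ((step P input)^[m]
              ((step P input)^[e₂.cost + 1] ((step P input)^[e₁.cost + 1] c')))) := by
            rw [step_of hc₃]
            exact hr₃.jump _ _ _
          obtain ⟨υ, m', hυ, ht', hr₅, hpc₅⟩ := ihk (τ.tick 1) _ (by
            rw [step_of hc₃]
            simp only [Instr.exec, hr₃.zero, if_true, hcc]) hr₄ hτ
          refine ⟨υ, m' + (1 + (m + ((e₂.cost + 1) + (e₁.cost + 1)))), hυ, ?_, ?_⟩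
          · simp at ht'; rw [ht', ht]; simp; omega
          · rw [Function.iterate_add_apply, Function.iterate_add_apply,
              Function.iterate_add_apply, Function.iterate_add_apply, Function.iterate_one]
            refine ⟨hr₅, ?_⟩
            rw [hpc₅, step_of hc₃]
            simp only [Instr.exec, hr₃.zero, if_true, hcc]
    exact key k σ c rfl hr hk

end

/-- The program that computes the stride `8 n`, a bound for the sizes of all arrays, and then runs
`s`. -/
def Stmt.program (s : Stmt) : Program :=
  [.const 64 8, .op .mul 62 0 64] ++ s.code 2

/-- The state in which a program starts. -/
def St.init (n : ℕ) : St := ⟨fun x => if x = .n then n else 0, fun _ _ => 0, 0⟩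

/-- A program whose `wp` is known reaches, from the initial configuration of the machine, a halting
configuration that represents a state with the required property, in as many steps as its ghost
time says, and two more for the stride. -/
theorem Stmt.run {E : Env} {input : Input → BitVec E.w → BitVec E.w} (hE : E.Fits input)
    (hS : E.stride = 8 * E.n) (hn : 0 < E.n) (s : Stmt) {Φ : St → Prop}
    (h : wp E s Φ (St.init E.n)) :
    ∃ (τ : St) (m : ℕ), Φ τ ∧ m = τ.time + 2 ∧
      Rep E τ ((step s.program input)^[m] (initConfig E.w E.n)) ∧
      ((step s.program input)^[m] (initConfig E.w E.n)).Halted s.program := by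
  have hw : 8 * E.n < 2 ^ E.w := by have := hE.mem; omega
  have hcode : CodeAt s.program 0 s.program := fun i hi => by
    rw [Nat.zero_add, List.getElem?_eq_getElem hi]
  have e1 : (step s.program input)^[2] (initConfig E.w E.n) = ⟨2, Function.update
      (Function.update (initConfig E.w E.n).reg 64 (BitVec.ofNat E.w 8)) 62
      (BitVec.ofNat E.w E.n * BitVec.ofNat E.w 8), fun _ => 0#E.w⟩ := by
    simp only [Function.iterate_succ, Function.comp, Function.iterate_zero, id_eq]
    rw [step_of (c := initConfig E.w E.n) (hcode 0 (by simp [Stmt.program]))]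
    simp only [Stmt.program, List.cons_append, List.nil_append, List.getElem_cons_zero, Instr.exec]
    rw [step_of (hcode 1 (by simp [Stmt.program]))]
    simp [Stmt.program, Instr.exec, initConfig, Op.eval]
  have hr : Rep E (St.init E.n) ((step s.program input)^[2] (initConfig E.w E.n)) := by
    rw [e1]
    refine ⟨fun x => ?_, fun a i hi => ?_, ?_, ?_⟩
    · have := x.reg_lt
      simp only [initConfig]
      rw [Function.update_of_ne (by omega), Function.update_of_ne (by omega)]
      by_cases hx : x = .n
      · subst hx
        have : Var.n.reg = 0 := rfl
        rw [this, Function.update_self, BitVec.toNat_ofNat, Nat.mod_eq_of_lt (by omega)]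
        simp [St.init]
      · have : x.reg ≠ 0 := fun hh => hx (Var.reg_injective hh)
        rw [Function.update_of_ne this]
        simp [St.init, hx]
    · simp [St.init]
    · simp only [Function.update_self, BitVec.toNat_mul, BitVec.toNat_ofNat]
      rw [Nat.mod_eq_of_lt (show E.n < _ by omega), Nat.mod_eq_of_lt (show 8 < _ by omega),
        Nat.mod_eq_of_lt (by omega), hS]
      omega
    · simp [initConfig]
  have hpc : ((step s.program input)^[2] (initConfig E.w E.n)).pc = 2 := by rw [e1]
  have hc2 : CodeAt s.program 2 (s.code 2) := hcode.right
  obtain ⟨τ, m, hΦ, ht, hr', hpc'⟩ := s.sim hE (by omega) h hr (by rw [hpc]; exact hc2)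
  rw [hpc] at hpc'
  refine ⟨τ, m + 2, hΦ, by rw [ht]; simp [St.init], ?_⟩
  rw [Function.iterate_add_apply]
  refine ⟨hr', ?_⟩
  rw [Config.Halted, hpc']
  simp [Stmt.program]; omega

/-! ### Numbers packed into one word -/

/-- The word with the field `g i` at bit position `f * i`, for `i < m`. -/
def pack (f : ℕ) (g : ℕ → ℕ) (m : ℕ) : ℕ := ∑ i ∈ Finset.range m, g i * 2 ^ (f * i)

theorem pack_succ (f : ℕ) (g : ℕ → ℕ) (m : ℕ) :
    pack f g (m + 1) = pack f g m + g m * 2 ^ (f * m) := Finset.sum_range_succ _ _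

theorem pack_add (f : ℕ) (g h : ℕ → ℕ) (m : ℕ) :
    pack f g m + pack f h m = pack f (fun i => g i + h i) m := by
  simp [pack, ← Finset.sum_add_distrib, Nat.add_mul]

theorem mul_pack (f k : ℕ) (g : ℕ → ℕ) (m : ℕ) :
    k * pack f g m = pack f (fun i => k * g i) m := by
  simp [pack, Finset.mul_sum, Nat.mul_assoc]

theorem pack_congr {f : ℕ} {g h : ℕ → ℕ} {m : ℕ} (H : ∀ i < m, g i = h i) :
    pack f g m = pack f h m :=
  Finset.sum_congr rfl fun i hi => by rw [H i (Finset.mem_range.1 hi)]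

theorem pack_lt {f : ℕ} {g : ℕ → ℕ} {m : ℕ} (H : ∀ i < m, g i < 2 ^ f) :
    pack f g m < 2 ^ (f * m) := by
  induction m with
  | zero => simp [pack]
  | succ m ih =>
    have h1 := ih fun i hi => H i (by omega)
    have h2 : (g m + 1) * 2 ^ (f * m) ≤ 2 ^ f * 2 ^ (f * m) :=
      Nat.mul_le_mul_right _ (H m (by omega))
    rw [pack_succ, Nat.mul_succ, pow_add, mul_comm (2 ^ (f * m))]
    rw [Nat.add_mul, Nat.one_mul] at h2
    omega

/-- The fields above position `j` are a multiple of the weight of field `j + 1`. -/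
theorem pack_split (f : ℕ) (g : ℕ → ℕ) {j m : ℕ} (hj : j ≤ m) :
    ∃ u, pack f g m = pack f g j + 2 ^ (f * j) * u := by
  induction m, hj using Nat.le_induction with
  | base => exact ⟨0, by simp⟩
  | succ m hm ih =>
    obtain ⟨u, hu⟩ := ih
    refine ⟨u + g m * 2 ^ (f * (m - j)), ?_⟩
    rw [pack_succ, hu, Nat.mul_add, Nat.add_assoc]
    congr 2
    rw [Nat.mul_left_comm, ← pow_add, ← Nat.mul_add, Nat.add_sub_cancel' hm]

theorem testBit_pack {f : ℕ} {g : ℕ → ℕ} {m : ℕ} (H : ∀ i < m, g i < 2 ^ f) {j r : ℕ}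
    (hj : j < m) (hr : r < f) : (pack f g m).testBit (f * j + r) = (g j).testBit r := by
  obtain ⟨u, hu⟩ := pack_split f g (Nat.succ_le_of_lt hj)
  have h1 : pack f g j < 2 ^ (f * j) := pack_lt fun i hi => H i (by omega)
  have h2 : pack f g m = 2 ^ (f * j) * (2 ^ f * u + g j) + pack f g j := by
    rw [hu, pack_succ, Nat.mul_succ, pow_add]; ring
  rw [h2, Nat.testBit_two_pow_mul_add _ h1, if_neg (by omega), Nat.add_sub_cancel_left,
    Nat.testBit_two_pow_mul_add _ (H j hj), if_pos hr]

theorem pack_div_mod {f : ℕ} {g : ℕ → ℕ} {m : ℕ} (H : ∀ i < m, g i < 2 ^ f) {j : ℕ}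
    (hj : j < m) : pack f g m / 2 ^ (f * j) % 2 ^ f = g j := by
  obtain ⟨u, hu⟩ := pack_split f g (Nat.succ_le_of_lt hj)
  have h1 : pack f g j < 2 ^ (f * j) := pack_lt fun i hi => H i (by omega)
  have h2 : pack f g m = 2 ^ (f * j) * (2 ^ f * u + g j) + pack f g j := by
    rw [hu, pack_succ, Nat.mul_succ, pow_add]; ring
  rw [h2, Nat.mul_add_div (by positivity), Nat.div_eq_of_lt h1, Nat.add_zero, Nat.mul_add_mod,
    Nat.mod_eq_of_lt (H j hj)]

/-- Parallel comparison: after a shift by `f - 1` and masking, each field says whether the leading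
bit of the old field was set. -/
theorem pack_and {f : ℕ} {g : ℕ → ℕ} {m : ℕ} (hf : 0 < f) (H : ∀ i < m, g i < 2 ^ f) :
    (pack f g m / 2 ^ (f - 1)) &&& pack f (fun _ => 1) m =
      pack f (fun i => if 2 ^ (f - 1) ≤ g i then 1 else 0) m := by
  have hf2 : 1 < 2 ^ f := Nat.one_lt_two_pow (by omega)
  have h1 : ∀ i < m, (fun _ : ℕ => 1) i < 2 ^ f := fun _ _ => hf2
  have h2 : ∀ i < m, (fun i => if 2 ^ (f - 1) ≤ g i then 1 else 0) i < 2 ^ f := fun i _ => by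
    dsimp only; split_ifs <;> omega
  apply Nat.eq_of_testBit_eq
  intro k
  rw [Nat.testBit_and, Nat.testBit_div_two_pow]
  rcases Nat.lt_or_ge k (f * m) with hk | hk
  · have hj : k / f < m := Nat.div_lt_of_lt_mul hk
    have hr : k % f < f := Nat.mod_lt _ hf
    have e : k = f * (k / f) + k % f := (Nat.div_add_mod k f).symm
    set j := k / f
    set r := k % f
    rw [e, testBit_pack h1 hj hr, testBit_pack h2 hj hr]
    rcases Nat.eq_zero_or_pos r with h0 | h0
    · rw [h0, show f * j + 0 + (f - 1) = f * j + (f - 1) by omega,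
        testBit_pack H hj (by omega)]
      have hg := H j hj
      have e2 : 2 ^ f = 2 * 2 ^ (f - 1) := by rw [← pow_succ']; congr 1; omega
      have : (g j).testBit (f - 1) = decide (2 ^ (f - 1) ≤ g j) := by
        rw [Nat.testBit_eq_decide_div_mod_eq]
        congr 1
        rw [eq_iff_iff]
        rcases Nat.lt_or_ge (g j) (2 ^ (f - 1)) with h | h
        · rw [Nat.div_eq_of_lt h]; simp; omega
        · have : g j / 2 ^ (f - 1) = 1 := by
            apply Nat.div_eq_of_lt_le <;> omega
          rw [this]; simp [h]
      rw [this]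
      split_ifs with hh <;> simp [hh]
    · have t1 : Nat.testBit 1 r = false := by
        rw [Nat.testBit_one_eq_true_iff_self_eq_zero.not.2 (by omega) |> Bool.eq_false_iff.2]
      rw [t1, Bool.and_false]
      split_ifs
      · exact t1.symm
      · simp
  · rw [Nat.testBit_lt_two_pow (lt_of_lt_of_le (pack_lt h1) (Nat.pow_le_pow_right two_pos hk)),
      Nat.testBit_lt_two_pow (lt_of_lt_of_le (pack_lt h2) (Nat.pow_le_pow_right two_pos hk)),
      Bool.and_false]

/-- A mask of ones in the first `j` fields is counted by one division. -/
theorem pack_indicator_mod {f j m : ℕ} (hj : j ≤ m) (hf : j < 2 ^ f - 1) :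
    pack f (fun i => if i < j then 1 else 0) m % (2 ^ f - 1) = j := by
  have h1 : ∀ m, pack f (fun i => if i < j then 1 else 0) m ≡ min j m [MOD (2 ^ f - 1)] := by
    intro m
    induction m with
    | zero => simp [pack]; rfl
    | succ m ih =>
      rw [pack_succ]
      have h2 : 2 ^ (f * m) ≡ 1 [MOD (2 ^ f - 1)] := by
        have : 2 ^ f ≡ 1 [MOD (2 ^ f - 1)] := by
          rw [Nat.ModEq.comm, Nat.modEq_iff_dvd' Nat.one_le_two_pow]
        simpa [pow_mul] using this.pow m
      split_ifs with h
      · have := ih.add (h2.mul_left 1)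
        rw [show min j (m + 1) = min j m + 1 * 1 by omega]
        exact this
      · rw [show min j (m + 1) = min j m by omega]; simpa using ih
  have := h1 m
  rw [min_eq_left hj] at this
  rw [this, Nat.mod_eq_of_lt hf]

theorem pack_one {f : ℕ} (hf : 0 < f) (m : ℕ) :
    (1 * 2 ^ (f * m) - 1) / (2 ^ f - 1) = pack f (fun _ => 1) m := by
  have h := Nat.geomSum_eq (m := 2 ^ f) (Nat.le_self_pow (by omega) 2) m
  rw [one_mul, pow_mul, ← h]
  simp [pack, pow_mul]

/-! ### The transform as a move-to-front code -/

instance {α β : Type*} [BEq α] [BEq β] [LawfulBEq α] [LawfulBEq β] : LawfulBEq (α ⊕ β) where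
  rfl {x} := by
    cases x with
    | inl x => exact beq_self_eq_true x
    | inr x => exact beq_self_eq_true x
  eq_of_beq {x y} h := by
    cases x with
    | inl x =>
      cases y with
      | inl y => exact congrArg Sum.inl (eq_of_beq (show (x == y) = true from h))
      | inr y => exact absurd (show false = true from h) (by decide)
    | inr x =>
      cases y with
      | inl y => exact absurd (show false = true from h) (by decide)
      | inr y => exact congrArg Sum.inr (eq_of_beq (show (x == y) = true from h))

instance {α : Type*} [BEq α] [LawfulBEq α] : LawfulBEq (Lex α) where
  rfl {x} := beq_self_eq_true (α := α) x
  eq_of_beq {_ _} h := eq_of_beq (α := α) h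

section
variable {a b : ℕ}

/-- The parameter symbols of a p-string, in the order of their first occurrences. -/
def firsts : List (Sym a b) → List (Fin b)
  | [] => []
  | Sum.inl _ :: l => firsts l
  | Sum.inr p :: l => p :: (firsts l).erase p

theorem nodup_firsts (l : List (Sym a b)) : (firsts l).Nodup := by
  induction l with
  | nil => simp [firsts]
  | cons x l ih =>
    cases x with
    | inl s => exact ih
    | inr p => exact List.nodup_cons.2 ⟨ih.not_mem_erase, ih.erase p⟩

theorem mem_firsts {l : List (Sym a b)} {p : Fin b} : p ∈ firsts l ↔ Sum.inr p ∈ l := by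
  induction l with
  | nil => simp [firsts]
  | cons x l ih =>
    cases x with
    | inl s => simp [firsts, ih]
    | inr q =>
      by_cases h : p = q
      · simp [firsts, h]
      · simp [firsts, h, ih, List.mem_erase_of_ne h]

theorem firsts_append_inl (l : List (Sym a b)) (s : Fin a) :
    firsts (l ++ [Sum.inl s]) = firsts l := by
  induction l with
  | nil => simp [firsts]
  | cons x l ih => cases x <;> simp [firsts, ih]

theorem firsts_append_inr (l : List (Sym a b)) (p : Fin b) :
    firsts (l ++ [Sum.inr p]) = if p ∈ firsts l then firsts l else firsts l ++ [p] := by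
  induction l with
  | nil => simp [firsts]
  | cons x l ih =>
    cases x with
    | inl s => exact ih
    | inr q =>
      simp only [List.cons_append, firsts, ih]
      by_cases h : p = q
      · subst h
        simp only [List.mem_cons, true_or, if_true, List.cons.injEq, true_and]
        split_ifs with h'
        · rfl
        · rw [List.erase_append_right _ h', List.erase_of_not_mem h']; simp
      · simp only [List.mem_cons, h, false_or, List.mem_erase_of_ne h]
        split_ifs with h'
        · rfl
        · rw [List.erase_append]
          split_ifs with hq
          · rfl
          · rw [List.erase_of_not_mem hq, List.erase_of_not_mem (by simpa using Ne.symm h)]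

theorem firsts_prefix (u v : List (Sym a b)) : firsts u <+: firsts (u ++ v) := by
  induction v using List.reverseRecOn with
  | nil => simp
  | append_singleton v x ih =>
    rw [← List.append_assoc]
    cases x with
    | inl s => rwa [firsts_append_inl]
    | inr p =>
      rw [firsts_append_inr]
      split_ifs
      · exact ih
      · exact ih.trans (List.prefix_append _ _)

theorem length_firsts (l : List (Sym a b)) : (firsts l).length = numParams l := by
  rw [numParams, ← List.toFinset_card_of_nodup (nodup_firsts l)]
  congr 1
  ext p
  simp [mem_firsts]

theorem numParams_perm {l l' : List (Sym a b)} (h : l.Perm l') : numParams l = numParams l' := by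
  unfold numParams
  rw [List.toFinset_eq_of_perm _ _ (h.filterMap _)]

/-- Moving a symbol from the end of a p-string to its front moves it to the front of the list of
first occurrences. -/
theorem firsts_cons_eq (l : List (Sym a b)) (p : Fin b) :
    firsts (Sum.inr p :: l) = p :: (firsts (l ++ [Sum.inr p])).erase p := by
  rw [firsts_append_inr, firsts]
  split_ifs with h
  · rfl
  · rw [List.erase_append_right _ h, List.erase_of_not_mem h]; simp

theorem length_prevEnc (l : List (Sym a b)) : (prevEnc l).length = l.length := by simp [prevEnc]

theorem prevDist_append (l : List (Sym a b)) (x : Sym a b) {i : ℕ} (hi : i < l.length) :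
    prevDist (l ++ [x]) i = prevDist l i := by
  have : ((Finset.range i).filter fun j => (l ++ [x])[j]? = (l ++ [x])[i]?) =
      (Finset.range i).filter fun j => l[j]? = l[i]? := by
    apply Finset.filter_congr
    intro j hj
    have : j < i := Finset.mem_range.1 hj
    rw [List.getElem?_append_left hi, List.getElem?_append_left (by omega)]
  unfold prevDist
  simp only [this]

theorem prevEnc_append (l : List (Sym a b)) (x : Sym a b) :
    prevEnc (l ++ [x]) = prevEnc l ++ [match x with
      | Sum.inl s => toLex (Sum.inl s)
      | Sum.inr _ => toLex (Sum.inr (prevDist (l ++ [x]) l.length))] := by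
  apply List.ext_getElem
  · simp [length_prevEnc]
  · intro i h1 h2
    rw [length_prevEnc] at h1
    rw [List.length_append, List.length_singleton] at h1
    rcases Nat.lt_or_ge i l.length with hi | hi
    · rw [List.getElem_append_left (by rwa [length_prevEnc])]
      simp only [prevEnc, List.getElem_ofFn, Fin.getElem_fin]
      rw [prevDist_append l x hi]
      simp only [List.getElem_append_left hi]
    · have hi : i = l.length := by omega
      subst hi
      rw [List.getElem_append_right (by rw [length_prevEnc])]
      simp only [prevEnc, List.getElem_ofFn, Fin.getElem_fin, List.getElem_concat_length,
        List.length_ofFn, Nat.sub_self, List.getElem_singleton]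

theorem prevDist_last (l : List (Sym a b)) (x : Sym a b) :
    prevDist (l ++ [x]) l.length = 0 ↔ x ∉ l := by
  have hx : (l ++ [x])[l.length]? = some x := by simp
  unfold prevDist
  split_ifs with h
  · have hm := Finset.max'_mem _ h
    set m := Finset.max' _ h
    rw [Finset.mem_filter, Finset.mem_range, hx] at hm
    obtain ⟨hm1, hm2⟩ := hm
    rw [List.getElem?_append_left hm1] at hm2
    constructor
    · omega
    · exact fun hx' => absurd (List.mem_of_getElem? hm2) hx'
  · simp only [true_iff]
    intro hx'
    obtain ⟨i, hi, rfl⟩ := List.getElem_of_mem hx'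
    refine h ⟨i, ?_⟩
    rw [Finset.mem_filter, Finset.mem_range, hx]
    exact ⟨hi, by rw [List.getElem?_append_left hi, List.getElem?_eq_getElem hi]⟩

/-- The zeros of a prev-encoding mark the first occurrences of the parameter symbols. -/
theorem zeros_prevEnc (l : List (Sym a b)) : zeros (prevEnc l) = (firsts l).length := by
  induction l using List.reverseRecOn with
  | nil => simp [prevEnc, zeros, firsts]
  | append_singleton l x ih =>
    rw [prevEnc_append, zeros, List.count_append, ← zeros, ih]
    cases x with
    | inl s =>
      rw [firsts_append_inl]
      have : ([toLex (Sum.inl s)] : List (EncSym a)).count (toLex (Sum.inr 0)) = 0 := by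
        rw [List.count_eq_zero]; simp
      simp [this]
    | inr p =>
      rw [firsts_append_inr]
      have h := prevDist_last l (Sum.inr p)
      rw [← mem_firsts] at h
      split_ifs with hp
      · have : prevDist (l ++ [Sum.inr p]) l.length ≠ 0 := fun h' => (h.1 h') hp
        have : ([toLex (Sum.inr (prevDist (l ++ [Sum.inr p]) l.length))] :
            List (EncSym a)).count (toLex (Sum.inr 0)) = 0 := by
          rw [List.count_eq_zero]; simpa using Ne.symm this
        simp [this]
      · simp [h.2 hp]

theorem zeros_first (l : List (Sym a b)) {p : Fin b} (hp : Sum.inr p ∈ l) :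
    zeros (prevEnc (l.take (l.idxOf (Sum.inr p) + 1))) = (firsts l).idxOf p + 1 := by
  have hi : l.idxOf (Sum.inr p) < l.length := List.idxOf_lt_length_iff.2 hp
  have h1 : l.take (l.idxOf (Sum.inr p) + 1) = l.take (l.idxOf (Sum.inr p)) ++ [Sum.inr p] := by
    rw [List.take_succ_eq_append_getElem hi]; simp
  have h2 : p ∉ firsts (l.take (l.idxOf (Sum.inr p))) := by
    rw [mem_firsts]
    intro h
    obtain ⟨j, hj, hj'⟩ := List.getElem_of_mem h
    rw [List.length_take, lt_min_iff] at hj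
    rw [List.getElem_take] at hj'
    have := List.not_of_lt_findIdx (p := (· == Sum.inr p)) (xs := l) (i := j)
      (by simpa [List.idxOf] using hj.1)
    simp [hj'] at this
  have h3 := firsts_append_inr (l.take (l.idxOf (Sum.inr p))) p
  rw [if_neg h2] at h3
  have h4 := firsts_prefix (l.take (l.idxOf (Sum.inr p) + 1)) (l.drop (l.idxOf (Sum.inr p) + 1))
  rw [List.take_append_drop, h1, h3] at h4
  obtain ⟨v, hv⟩ := h4
  rw [h1, zeros_prevEnc, h3, ← hv, List.idxOf_append_of_mem (by simp),
    List.idxOf_append_of_notMem h2]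
  simp

theorem rotate_eq_cons (T : List (Sym a b)) {q : ℕ} (hq : q < T.length) :
    ∃ l, T.rotate q = T[q] :: l ∧ T.rotate (q + 1) = l ++ [T[q]] := by
  have h : T.rotate q ≠ [] := rotate_ne_nil T ⟨q, hq⟩ q
  obtain ⟨x, l, hl⟩ := List.exists_cons_of_ne_nil h
  have hx : x = T[q] := by
    have h0 : (T.rotate q)[0]'(by simp; omega) = x := by simp [hl]
    rw [List.getElem_rotate] at h0
    simp [Nat.mod_eq_of_lt hq] at h0
    exact h0.symm
  subst hx
  refine ⟨l, hl, ?_⟩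
  rw [← List.rotate_rotate, hl]
  simp

/-- An entry of the transform, in terms of the symbol it describes. -/
theorem pbwt_eq (T : List (Sym a b)) (i : Fin T.length) {q : ℕ} (hq : q < T.length)
    (h : T.rotate (psa T i) = T.rotate (q + 1)) :
    pbwt T i = match T[q] with
      | Sum.inl s => Sum.inl s
      | Sum.inr p => Sum.inr ((firsts (T.rotate (q + 1))).idxOf p + 1) := by
  obtain ⟨l, hl, hl'⟩ := rotate_eq_cons T hq
  have hlast : (T.rotate (psa T i)).getLast (rotate_ne_nil T i _) = T[q] := by
    simp only [h, hl', List.getLast_append_singleton]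
  unfold pbwt
  simp only [hlast]
  split
  · rfl
  · next p hp =>
    rw [h, zeros_first]
    rw [hl', hp]
    simp

/-- The end-marker is smaller than every other symbol, so the rotation that starts with it comes
first. -/
theorem psa_zero (T : List (Sym a b)) (hT : HasEndMarker T) (hn : 0 < T.length) :
    (psa T ⟨0, hn⟩).val = T.length - 1 := by
  obtain ⟨u, d, hu, hd⟩ := hT
  have hlen : T.length = u.length + 1 := by simp [hu]
  have hlast : T[T.length - 1]'(by omega) = Sum.inl d := by
    simp only [hlen, Nat.add_sub_cancel]
    simp [hu]
  have hmono : Monotone ((fun k : Fin T.length => prevEnc (T.rotate k)) ∘ psa T) :=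
    Tuple.monotone_sort (fun k : Fin T.length => prevEnc (T.rotate k))
  by_contra hne
  set k := psa T ⟨0, hn⟩ with hk
  have hkn : k.val < u.length := by have := k.isLt; omega
  set m : Fin T.length := ⟨T.length - 1, by omega⟩ with hm
  have hle : prevEnc (T.rotate k) ≤ prevEnc (T.rotate m) := by
    have := hmono (show (⟨0, hn⟩ : Fin T.length) ≤ (psa T).symm m from Nat.zero_le _)
    simpa [hk] using this
  refine absurd hle (not_le.2 ?_)
  obtain ⟨l₁, h₁, -⟩ := rotate_eq_cons T k.isLt
  obtain ⟨l₂, h₂, -⟩ := rotate_eq_cons T m.isLt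
  rw [h₁, h₂]
  have hTm : T[m.val]'m.isLt = Sum.inl d := hlast
  have hTk : T[k.val]'k.isLt ∈ u := by
    have : T[k.val]'k.isLt = u[k.val] := by
      simp only [hu]
      rw [List.getElem_append_left hkn]
    rw [this]; exact List.getElem_mem _
  have enc_cons : ∀ (x : Sym a b) l, ∃ v, prevEnc (x :: l) = (match x with
      | Sum.inl s => toLex (Sum.inl s)
      | Sum.inr _ => toLex (Sum.inr (prevDist (x :: l) 0)) : EncSym a) :: v := by
    intro x l
    exact ⟨_, List.ofFn_succ (n := l.length)⟩
  obtain ⟨v₁, e₁⟩ := enc_cons (T[k.val]'k.isLt) l₁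
  obtain ⟨v₂, e₂⟩ := enc_cons (T[m.val]'m.isLt) l₂
  rw [e₁, e₂, List.cons_lt_cons_iff]
  left
  simp only [hTm]
  revert hTk
  generalize T[k.val]'k.isLt = x
  intro hTk
  cases x with
  | inl s => simpa using hd s hTk
  | inr p => simp

/-- The rank visited at time `g`. -/
def visit (T : List (Sym a b)) (hn : 0 < T.length) (g : ℕ) : Fin T.length :=
  (lfMap T)^[g] ⟨0, hn⟩

theorem visit_succ (T : List (Sym a b)) (hn : 0 < T.length) (g : ℕ) :
    visit T hn (g + 1) = lfMap T (visit T hn g) := Function.iterate_succ_apply' _ _ _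

theorem val_finRotate_symm {n : ℕ} (k : Fin n) (hk : k.val ≠ 0) :
    ((finRotate n).symm k).val = k.val - 1 := by
  cases n with
  | zero => exact k.elim0
  | succ m =>
    have : (finRotate (m + 1)).symm k = ⟨k.val - 1, by omega⟩ := by
      rw [Equiv.symm_apply_eq]
      apply Fin.ext
      rw [finRotate_apply, Fin.val_add_one]
      split_ifs with h
      · have := congrArg Fin.val h
        simp only [Fin.val_last] at this
        omega
      · simp only []; omega
    rw [this]

/-- The LF-mapping steps back by one position, so that iterating it from the rank `0` visits the
rotations from the last position down. -/
theorem psa_visit (T : List (Sym a b)) (hT : HasEndMarker T) (hn : 0 < T.length) (g : ℕ)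
    (hg : g < T.length) : (psa T (visit T hn g)).val = T.length - 1 - g := by
  induction g with
  | zero => exact psa_zero T hT hn
  | succ g ih =>
    have ih := ih (by omega)
    rw [visit_succ]
    have h : psa T (lfMap T (visit T hn g)) = (finRotate T.length).symm (psa T (visit T hn g)) := by
      simp [lfMap]
    rw [h]
    generalize psa T (visit T hn g) = k at ih
    have hk0 : k.val ≠ 0 := by omega
    rw [val_finRotate_symm k hk0]
    omega

/-- The position of the symbol that is described at time `g`.  The entry for a rotation describes
its last symbol, which stands in front of its first symbol; at the last time it is the end-marker.
-/
def pos (n g : ℕ) : ℕ := if g + 1 < n then n - 2 - g else n - 1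

theorem pos_lt {n g : ℕ} (hn : 0 < n) : pos n g < n := by unfold pos; split_ifs <;> omega

theorem rotate_visit (T : List (Sym a b)) (hT : HasEndMarker T) (hn : 0 < T.length) (g : ℕ)
    (hg : g < T.length) :
    T.rotate (psa T (visit T hn g)) = T.rotate (pos T.length g + 1) := by
  rw [psa_visit T hT hn g hg, pos]
  split_ifs with h
  · congr 1; omega
  · rw [show T.length - 1 - g = 0 by omega, show T.length - 1 + 1 = T.length by omega]
    simp

/-- The integer code of the entry of the transform that is visited at time `g`. -/
def codeAt (T : List (Sym a b)) (hn : 0 < T.length) (g : ℕ) : ℕ := codeL (pbwt T (visit T hn g))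

/-- The move-to-front rank that corresponds to a code; for a static symbol it is `0`, which leaves
the list unchanged. -/
def rankOf (c : ℕ) : ℕ := if c % 2 = 0 then 0 else c / 2 - 1

/-- Move the `m`-th element to the front. -/
def moveToFront (l : List ℕ) (m : ℕ) : List ℕ := l.getD m 0 :: l.eraseIdx m

/-- The list after `g` moves with ranks `m 0, m 1, …`, starting from `l`. -/
def mtfIter (l : List ℕ) (m : ℕ → ℕ) : ℕ → List ℕ
  | 0 => l
  | g + 1 => moveToFront (mtfIter l m g) (m g)

theorem length_mtfIter {l : List ℕ} {m : ℕ → ℕ} (h : ∀ g, m g < l.length) (g : ℕ) :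
    (mtfIter l m g).length = l.length := by
  induction g with
  | zero => rfl
  | succ g ih =>
    have := h g
    simp only [mtfIter, moveToFront, List.length_cons]
    rw [List.length_eraseIdx_of_lt (by omega)]
    omega

theorem codeAt_eq (T : List (Sym a b)) (hT : HasEndMarker T) (hn : 0 < T.length) (g : ℕ)
    (hg : g < T.length) :
    codeAt T hn g = match T[pos T.length g]'(pos_lt hn) with
      | Sum.inl s => 2 * s.val
      | Sum.inr p => 2 * ((firsts (T.rotate (pos T.length g + 1))).idxOf p + 1) + 1 := by
  rw [codeAt, pbwt_eq T _ (pos_lt hn) (rotate_visit T hT hn g hg)]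
  split <;> rfl

theorem idxOf_firsts_rotate_lt (T : List (Sym a b)) {q : ℕ} (hq : q < T.length) {p : Fin b}
    (hp : T[q] = Sum.inr p) (k : ℕ) : (firsts (T.rotate k)).idxOf p < numParams T := by
  rw [← numParams_perm (List.rotate_perm T k), ← length_firsts]
  apply List.idxOf_lt_length_of_mem
  rw [mem_firsts, List.mem_rotate, ← hp]
  exact List.getElem_mem _

/-- The codes of parameter symbols stand for positive numbers of at most `σ_p`. -/
theorem codeAt_bounds (T : List (Sym a b)) (hT : HasEndMarker T) (hn : 0 < T.length) (g : ℕ)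
    (hg : g < T.length) (h : codeAt T hn g % 2 = 1) :
    1 ≤ codeAt T hn g / 2 ∧ codeAt T hn g / 2 ≤ numParams T := by
  have hc := codeAt_eq T hT hn g hg
  cases hx : T[pos T.length g]'(pos_lt hn) with
  | inl s =>
    rw [hx] at hc
    simp only [] at hc
    omega
  | inr p =>
    rw [hx] at hc
    simp only [] at hc
    have := idxOf_firsts_rotate_lt T (pos_lt hn) hx (pos T.length g + 1)
    omega

/-- Stepping back over a parameter symbol moves it to the front of the list of first occurrences. -/
theorem firsts_rotate_succ (T : List (Sym a b)) {q : ℕ} (hq : q < T.length) :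
    firsts (T.rotate q) = match T[q] with
      | Sum.inl _ => firsts (T.rotate (q + 1))
      | Sum.inr p => p :: (firsts (T.rotate (q + 1))).erase p := by
  obtain ⟨l, hl, hl'⟩ := rotate_eq_cons T hq
  rw [hl, hl']
  generalize T[q] = x
  cases x with
  | inl s => simp only []; rw [firsts_append_inl]; rfl
  | inr p => exact firsts_cons_eq l p

/-- Distinct parameter symbols can be renamed to `0, 1, 2, …` in a given order. -/
theorem exists_labelling (F : List (Fin b)) (hF : F.Nodup) :
    ∃ f : Equiv.Perm (Fin b), ∀ i (h : i < F.length), (f F[i]).val = i := by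
  classical
  set G := F ++ (List.finRange b).filter (· ∉ F) with hG
  have hnd : G.Nodup := by
    refine hF.append ((List.nodup_finRange b).filter _) ?_
    intro x hx hx'
    simp at hx'
    exact hx' hx
  have hmem : ∀ x, x ∈ G := fun x => by
    by_cases h : x ∈ F <;> simp [hG, h]
  have hlen : G.length = b := by
    rw [← List.toFinset_card_of_nodup hnd, Finset.card_eq_of_equiv_fin (n := b)]
    exact (Equiv.subtypeUnivEquiv fun x => by simp [hmem x])
  have hlt : ∀ x, G.idxOf x < b := fun x =>
    lt_of_lt_of_eq (List.idxOf_lt_length_of_mem (hmem x)) hlen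
  have hinj : Function.Injective fun x : Fin b => (⟨G.idxOf x, hlt x⟩ : Fin b) := by
    intro x y h
    have h := congrArg Fin.val h
    exact (List.idxOf_inj (hmem x)).1 h
  refine ⟨Equiv.ofBijective _ (Finite.injective_iff_bijective.1 hinj), fun i h => ?_⟩
  have hiG : i < G.length := by rw [hG, List.length_append]; omega
  have : F[i] = G[i] := by simp only [hG]; rw [List.getElem_append_left h]
  simp only [Equiv.ofBijective_apply, this]
  exact hnd.idxOf_getElem i hiG

/-- Moves among the first `N` elements do not touch the others. -/
theorem take_moveToFront {l : List ℕ} {m N : ℕ} (hm : m < N) :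
    (moveToFront l m).take N = moveToFront (l.take N) m := by
  obtain ⟨N, rfl⟩ : ∃ k, N = k + 1 := ⟨N - 1, by omega⟩
  simp only [moveToFront, List.take_succ_cons, List.cons.injEq]
  refine ⟨by simp [List.getD, hm], ?_⟩
  rw [List.eraseIdx_eq_take_drop_succ, List.eraseIdx_eq_take_drop_succ]
  apply List.ext_getElem?
  intro i
  simp only [List.getElem?_take, List.getElem?_append, List.length_take, List.getElem?_drop]
  have : min m (min (N + 1) l.length) = min m l.length := by omega
  grind

/-- Decoding the ranks by move-to-front recovers the p-string up to the names of its parameter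
symbols: if the list starts as `0, 1, …, Q - 1`, the decoded names are the values of a permutation
of the alphabet. -/
theorem mtf_decode (T : List (Sym a b)) (hT : HasEndMarker T) (hn : 0 < T.length) (Q : ℕ)
    (hQ : ∀ g < T.length, rankOf (codeAt T hn g) < Q) :
    ∃ f : Equiv.Perm (Fin b), ∀ g < T.length,
      codeSym (Sum.map id f (T[pos T.length g]'(pos_lt hn))) =
        if codeAt T hn g % 2 = 0 then codeAt T hn g
        else 2 * (mtfIter (List.range Q) (fun g => rankOf (codeAt T hn g)) g).getD
          (rankOf (codeAt T hn g)) 0 + 1 := by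
  obtain ⟨f, hf⟩ := exists_labelling _ (nodup_firsts (T.rotate (pos T.length 0 + 1)))
  set N := min Q (numParams T) with hN
  have hlenF : ∀ k, (firsts (T.rotate k)).length = numParams T := fun k => by
    rw [length_firsts, numParams_perm (List.rotate_perm T k)]
  -- as long as some parameter symbol is described, its rank is below `N`
  have hrank : ∀ g (hg : g < T.length) p, T[pos T.length g]'(pos_lt hn) = Sum.inr p →
      rankOf (codeAt T hn g) = (firsts (T.rotate (pos T.length g + 1))).idxOf p ∧
        (firsts (T.rotate (pos T.length g + 1))).idxOf p < N := by
    intro g hg p hp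
    have h1 := codeAt_eq T hT hn g hg
    rw [hp] at h1
    simp only [] at h1
    have h2 : rankOf (codeAt T hn g) = (firsts (T.rotate (pos T.length g + 1))).idxOf p := by
      rw [h1, rankOf, if_neg (by omega)]; omega
    have h3 := idxOf_firsts_rotate_lt T (pos_lt hn) hp (pos T.length g + 1)
    have h4 := hQ g hg
    exact ⟨h2, by omega⟩
  have key : ∀ g, g < T.length →
      (mtfIter (List.range Q) (fun g => rankOf (codeAt T hn g)) g).take N =
        ((firsts (T.rotate (pos T.length g + 1))).map fun p => (f p).val).take N := by
    intro g
    induction g with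
    | zero =>
      intro _
      apply List.ext_getElem
      · simp [mtfIter, hlenF]; omega
      · intro i h1 h2
        simp only [List.length_take, List.length_map] at h2
        simp [mtfIter, hf i (by omega)]
    | succ g ih =>
      intro hg
      have ih := ih (by omega)
      have hpos : pos T.length (g + 1) + 1 = pos T.length g ∨
          T.rotate (pos T.length (g + 1) + 1) = T.rotate (pos T.length g) := by
        unfold pos
        split_ifs
        · left; omega
        · right
          rw [show T.length - 1 + 1 = T.length by omega, show T.length - 2 - g = 0 by omega]
          simp
      have hrot : T.rotate (pos T.length (g + 1) + 1) = T.rotate (pos T.length g) := by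
        rcases hpos with h | h
        · rw [h]
        · exact h
      rw [hrot, firsts_rotate_succ T (pos_lt hn)]
      have hcode := codeAt_eq T hT hn g (by omega)
      have hr := hrank g (by omega)
      simp only [mtfIter]
      cases hx : T[pos T.length g]'(pos_lt hn) with
      | inl s =>
        rw [hx] at hcode
        simp only [] at hcode ⊢
        have h0 : rankOf (codeAt T hn g) = 0 := by rw [hcode, rankOf, if_pos (by omega)]
        rw [h0, ← ih]
        have hlen := hQ g (by omega)
        have : moveToFront (mtfIter (List.range Q) (fun g => rankOf (codeAt T hn g)) g) 0 =
            mtfIter (List.range Q) (fun g => rankOf (codeAt T hn g)) g ∨ N = 0 := by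
          rcases Nat.eq_zero_or_pos N with h | h
          · exact .inr h
          · left
            cases hl : mtfIter (List.range Q) (fun g => rankOf (codeAt T hn g)) g with
            | nil =>
              rw [hl] at ih
              have := congrArg List.length ih
              simp [hlenF] at this
              omega
            | cons x l => simp [moveToFront]
        rcases this with h | h
        · rw [h]
        · rw [h]; simp
      | inr p =>
        obtain ⟨h1, h2⟩ := hr p hx
        simp only []
        rw [h1, take_moveToFront h2, ih, ← take_moveToFront h2]
        congr 1
        have h3 : (firsts (T.rotate (pos T.length g + 1))).idxOf p <
            (firsts (T.rotate (pos T.length g + 1))).length := by rw [hlenF]; omega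
        simp only [moveToFront, List.map_cons, List.cons.injEq]
        refine ⟨?_, ?_⟩
        · rw [List.getD_eq_getElem _ _ (by simpa using h3)]
          simp
        · rw [List.eraseIdx_map, List.erase_eq_eraseIdx_of_idxOf rfl]
  refine ⟨f, fun g hg => ?_⟩
  have hcode := codeAt_eq T hT hn g hg
  have hr := hrank g hg
  cases hx : T[pos T.length g]'(pos_lt hn) with
  | inl s =>
    rw [hx] at hcode
    simp only [] at hcode
    rw [hcode, if_pos (by omega)]
    rfl
  | inr p =>
    rw [hx] at hcode
    obtain ⟨h1, h2⟩ := hr p hx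
    simp only [] at hcode
    rw [if_neg (by omega), h1]
    have h3 : (firsts (T.rotate (pos T.length g + 1))).idxOf p <
        (firsts (T.rotate (pos T.length g + 1))).length := by rw [hlenF]; omega
    have h4 : (mtfIter (List.range Q) (fun g => rankOf (codeAt T hn g)) g).getD
        ((firsts (T.rotate (pos T.length g + 1))).idxOf p) 0 = (f p).val := by
      have := congrArg (fun l => l.getD ((firsts (T.rotate (pos T.length g + 1))).idxOf p) 0)
        (key g hg)
      simp only [List.getD, List.getElem?_take, h2, if_true] at this
      rw [List.getD, this]
      simp [h3]
    rw [h4]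
    rfl

end

/-! ### Counting sort -/

/-- Stable sorting of the `q` entries of `inp` by `key`, with keys below `u`. -/
def sortBy (key inp out : Arr) : Stmt :=
  .count .i (.cst 0) .u (.put .cN (.vr .i) (.cst 0)) ;;
  .count .i (.cst 0) .q (.set .k (.ld key (.ld inp (.vr .i))) ;;
    .put .cN (.vr .k) (.ld .cN (.vr .k) + .cst 1)) ;;
  .set .acc (.cst 0) ;;
  .count .i (.cst 0) .u (.set .k (.ld .cN (.vr .i)) ;; .put .cN (.vr .i) (.vr .acc) ;;
    .set .acc (.vr .acc + .vr .k)) ;;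
  .count .i (.cst 0) .q (.set .t (.ld inp (.vr .i)) ;; .set .k (.ld .cN (.ld key (.vr .t))) ;;
    .put out (.vr .k) (.vr .t) ;; .put .cN (.ld key (.vr .t)) (.vr .k + .cst 1))

/-- The list `l` sorted stably by the key `κ`; entries with keys from `U` on are dropped. -/
def bucketSort (κ : ℕ → ℕ) (U : ℕ) (l : List ℕ) : List ℕ :=
  (List.range U).flatMap fun u => l.filter (κ · = u)

theorem countP_lt_succ (κ : ℕ → ℕ) (l : List ℕ) (u : ℕ) :
    l.countP (κ · < u + 1) = l.countP (κ · < u) + l.countP (κ · = u) := by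
  induction l with
  | nil => simp
  | cons x l ih =>
    simp only [List.countP_cons, ih, decide_eq_true_eq]
    split_ifs <;> omega

theorem bucketSort_succ (κ : ℕ → ℕ) (U : ℕ) (l : List ℕ) :
    bucketSort κ (U + 1) l = bucketSort κ U l ++ l.filter (κ · = U) := by
  simp [bucketSort, List.range_succ]

theorem length_bucketSort (κ : ℕ → ℕ) (U : ℕ) (l : List ℕ) :
    (bucketSort κ U l).length = l.countP (κ · < U) := by
  induction U with
  | zero => simp [bucketSort]
  | succ U ih => rw [bucketSort_succ, List.length_append, ih, countP_lt_succ,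
      List.countP_eq_length_filter (p := (κ · = U))]

theorem bucketSort_perm_filter (κ : ℕ → ℕ) (U : ℕ) (l : List ℕ) :
    (bucketSort κ U l).Perm (l.filter (κ · < U)) := by
  rw [List.perm_iff_count]
  intro a
  induction U with
  | zero => simp [bucketSort]
  | succ U ih =>
    rw [bucketSort_succ, List.count_append, ih]
    simp only [List.count_eq_countP, List.countP_filter]
    clear ih
    induction l with
    | nil => simp
    | cons x l ih =>
      simp only [List.countP_cons, Bool.and_eq_true, decide_eq_true_eq, beq_iff_eq]
      by_cases hx : x = a
      · simp only [hx, true_and]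
        split_ifs <;> omega
      · simpa only [hx, false_and, if_false, Nat.add_zero] using ih

theorem bucketSort_perm {κ : ℕ → ℕ} {U : ℕ} {l : List ℕ} (h : ∀ x ∈ l, κ x < U) :
    (bucketSort κ U l).Perm l := by
  have := bucketSort_perm_filter κ U l
  rwa [List.filter_eq_self.2 (by simpa using h)] at this

/-- Stability: entries with the same key stay in the order `R` of `l`. -/
theorem bucketSort_pairwise {κ : ℕ → ℕ} (U : ℕ) {l : List ℕ} {R : ℕ → ℕ → Prop}
    (h : l.Pairwise R) :
    (bucketSort κ U l).Pairwise fun x y => κ x < κ y ∨ κ x = κ y ∧ R x y := by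
  induction U with
  | zero => simp [bucketSort]
  | succ U ih =>
    rw [bucketSort_succ, List.pairwise_append]
    refine ⟨ih, ?_, ?_⟩
    · refine (List.Pairwise.filter _ h).imp_of_mem ?_
      intro x y hx hy hxy
      simp at hx hy
      exact .inr ⟨by omega, hxy⟩
    · intro x hx y hy
      have hx := ((bucketSort_perm_filter κ U l).mem_iff.1 hx)
      simp at hx hy
      left; omega

theorem countP_le_take (p : ℕ → Bool) (l : List ℕ) (i : ℕ) : (l.take i).countP p ≤ l.countP p :=
  (List.take_sublist i l).countP_le

theorem countP_disjoint (κ : ℕ → ℕ) (l : List ℕ) {u v : ℕ} (h : u < v) :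
    l.countP (κ · < u) + l.countP (κ · = u) ≤ l.countP (κ · < v) := by
  rw [← countP_lt_succ]
  apply List.countP_mono_left
  intro x _ hx
  simp at hx ⊢
  omega

/-- The running time of `sortBy`. -/
def sortTime (Q U : ℕ) : ℕ := 93 * Q + 47 * U + 30

/-- Counting sort computes the bucket sort, in time linear in the number of entries and of keys. -/
theorem wp_sortBy {E : Env} {key inp out : Arr} {σ : St} (h1 : key ≠ .cN) (h2 : inp ≠ .cN)
    (h3 : out ≠ .cN) (h4 : key ≠ out) (h5 : inp ≠ out) (l : List ℕ) (U : ℕ)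
    (hl : ∀ i (h : i < l.length), σ.arr inp i = l[i]) (hq : σ.var .q = l.length)
    (hu : σ.var .u = U) (hκ : ∀ x ∈ l, σ.arr key x < U) (hls : ∀ x ∈ l, x < E.stride)
    (hQ : l.length < E.stride) (hU : U ≤ E.stride) (hw : E.stride + 1 < 2 ^ E.w) :
    wp E (sortBy key inp out) (fun τ =>
      (∀ i (h : i < (bucketSort (σ.arr key) U l).length),
        τ.arr out i = (bucketSort (σ.arr key) U l)[i]) ∧
      (∀ i, l.length ≤ i → τ.arr out i = σ.arr out i) ∧
      τ.time ≤ σ.time + sortTime l.length U) σ := by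
  set κ := σ.arr key with hκdef
  set st : ℕ → ℕ := fun u => l.countP (κ · < u) with hst
  have hdis : ∀ {u v}, u < v → st u + l.countP (κ · = u) ≤ st v := countP_disjoint κ l
  have hκ' : ∀ i (h : i < l.length), κ l[i] < U := fun i h => hκ _ (List.getElem_mem _)
  have hcount : ∀ p : ℕ → Bool, l.countP p ≤ l.length := fun p => List.countP_le_length
  unfold sortBy
  rw [wp_seq]
  -- clearing the counters
  refine wp_frame _ (wp_count (x := .i) (hi := .u)
    (fun i τ => (∀ v < i, τ.arr .cN v = 0) ∧ τ.time ≤ σ.time + 2 + 17 * i) 0 U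
    (by simp) (by simp) (by simp) (by simp) (by simp) (by simp) hu (by omega)
    ⟨by simp, by simp⟩ ?_ (Φ := fun τ => (∀ v < U, τ.arr .cN v = 0) ∧
      τ.time ≤ σ.time + 6 + 17 * U) ?_) ?_
  · rintro i τ - hi ⟨hI, ht⟩ hx hhi - -
    simp only [wp_put, Expr.safe_vr, Expr.safe_cst, Expr.val_vr, Expr.val_cst, St.var_tick, hx,
      Expr.cost_vr, Expr.cost_cst]
    refine ⟨trivial, by omega, by omega, ?_, ?_⟩
    · intro v hv
      simp only [St.arr_tick, St.arr_setVar, St.arr_setArr, if_true, Function.update_apply]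
      split_ifs with hvi
      · rfl
      · exact hI v (by omega)
    · simp only [St.time_tick, St.time_setVar, St.time_setArr]; omega
  · rintro τ ⟨hI, ht⟩ -
    exact ⟨hI, by simp only [St.time_tick]; omega⟩
  rintro τ₁ hf₁ ⟨hz₁, ht₁⟩
  have a1 : ∀ a, a ≠ .cN → τ₁.arr a = σ.arr a := fun a ha => hf₁.2 a (by simpa using ha)
  have v1 : ∀ x, x ≠ .i → τ₁.var x = σ.var x := fun x hx => hf₁.1 x (by simpa using hx)
  rw [wp_seq]
  -- counting
  refine wp_frame _ (wp_count (x := .i) (hi := .q)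
    (fun i τ => (∀ v < U, τ.arr .cN v = (l.take i).countP (κ · = v)) ∧
      (∀ a, a ≠ .cN → τ.arr a = σ.arr a) ∧
      τ.time ≤ σ.time + 8 + 17 * U + 33 * i) 0 l.length
    (by simp) (by simp) (by simp) (by simp) (by simp) (by simp)
    ((v1 .q (by simp)).trans hq) (by omega)
    ⟨by simpa using hz₁, by simpa using a1, by simp; omega⟩ ?_
    (Φ := fun τ => (∀ v < U, τ.arr .cN v = l.countP (κ · = v)) ∧
      τ.time ≤ σ.time + 12 + 17 * U + 33 * l.length) ?_) ?_
  · rintro i τ - hi ⟨hI, ha, ht⟩ hx hhi - -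
    have e1 : τ.arr inp i = l[i] := by rw [ha _ h2, hl i hi]
    have e2 : τ.arr key l[i] = κ l[i] := by rw [ha _ h1]
    have e3 := hI _ (hκ' i hi)
    have e4 := countP_le_take (κ · = κ l[i]) l i
    have e5 := hcount (κ · = κ l[i])
    have e6 := hκ' i hi
    have e7 := hls _ (List.getElem_mem hi)
    simp only [wp_seq, wp_set, wp_put, Expr.safe_vr, Expr.safe_cst, Expr.val_vr, Expr.val_cst,
      St.var_tick, St.var_setVar, if_true, hx, Expr.cost_vr, Expr.cost_cst, Expr.safe_ld,
      Expr.safe_add, Expr.val_ld, Expr.val_add, Expr.cost_ld, Expr.cost_add, St.arr_tick,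
      St.arr_setVar, e1, e2, e3]
    refine ⟨⟨⟨trivial, by omega⟩, e7⟩, trivial, ⟨⟨trivial, by omega⟩, by omega, by omega⟩,
      by omega, ?_, ?_, ?_⟩
    · intro v hv
      simp only [St.arr_tick, St.arr_setVar, St.arr_setArr, if_true, Function.update_apply]
      rw [List.take_succ_eq_append_getElem hi, List.countP_append]
      split_ifs with hvi
      · subst hvi; simp
      · have : κ l[i] ≠ v := fun hh => hvi hh.symm
        rw [hI v hv]; simp [this]
    · intro a hne
      simp [hne, ha a hne]
    · simp only [St.time_tick, St.time_setVar, St.time_setArr]; omega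
  · rintro τ ⟨hI, ha, ht⟩ -
    exact ⟨by simpa using hI, by simp only [St.time_tick]; omega⟩
  rintro τ₂ hf₂ ⟨hz₂, ht₂⟩
  have a2 : ∀ a, a ≠ .cN → τ₂.arr a = σ.arr a := fun a ha =>
    (hf₂.2 a (by simpa using ha)).trans (a1 a ha)
  have v2 : ∀ x, x ≠ .i → x ≠ .k → τ₂.var x = σ.var x := fun x hx hx' =>
    (hf₂.1 x (by simp [hx, hx'])).trans (v1 x hx)
  rw [wp_seq, wp_set]
  refine ⟨by simp, ?_⟩
  rw [wp_seq]
  -- prefix sums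
  refine wp_frame _ (wp_count (x := .i) (hi := .u)
    (fun i τ => (∀ v < i, τ.arr .cN v = st v) ∧
      (∀ v, i ≤ v → v < U → τ.arr .cN v = l.countP (κ · = v)) ∧ τ.var .acc = st i ∧
      τ.time ≤ σ.time + 16 + 17 * U + 33 * l.length + 30 * i) 0 U
    (by simp) (by simp) (by simp) (by simp) (by simp) (by simp)
    (by simpa using (v2 .u (by simp) (by simp)).trans hu) (by omega)
    ⟨by simp, by simpa using hz₂, by simp [hst], by simp; omega⟩ ?_
    (Φ := fun τ => (∀ v < U, τ.arr .cN v = st v) ∧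
      τ.time ≤ σ.time + 20 + 47 * U + 33 * l.length) ?_) ?_
  · rintro i τ - hi ⟨hI, hI', hacc, ht⟩ hx hhi - -
    have e3 := hI' i le_rfl hi
    have e4 : st (i + 1) = st i + l.countP (κ · = i) := countP_lt_succ κ l i
    have e5 : st (i + 1) ≤ l.length := hcount _
    simp only [wp_seq, wp_set, wp_put, Expr.safe_vr, Expr.val_vr,
      St.var_tick, St.var_setVar, if_true, hx, Expr.cost_vr, Expr.safe_ld,
      Expr.safe_add, Expr.val_ld, Expr.val_add, Expr.cost_ld, Expr.cost_add, St.arr_tick,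
      St.arr_setVar, St.arr_setArr, St.var_setArr, e3, hacc, reduceCtorEq, if_false]
    refine ⟨⟨trivial, by omega⟩, trivial, trivial, by omega, ⟨trivial, trivial, by omega⟩,
      ?_, ?_, ?_, ?_⟩
    · intro v hv
      simp only [Function.update_apply]
      split_ifs with hvi
      · rw [hvi]
      · exact hI v (by omega)
    · intro v hv hv'
      simp only [Function.update_apply]
      rw [if_neg (by omega)]
      exact hI' v (by omega) hv'
    · omega
    · simp only [St.time_tick, St.time_setVar, St.time_setArr]; omega
  · rintro τ ⟨hI, -, -, ht⟩ -
    exact ⟨by simpa using hI, by simp only [St.time_tick]; omega⟩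
  rintro τ₃ hf₃ ⟨hz₃, ht₃⟩
  have a3 : ∀ a, a ≠ .cN → τ₃.arr a = σ.arr a := fun a ha =>
    (hf₃.2 a (by simpa using ha)).trans (by simpa using a2 a ha)
  have v3 : ∀ x, x ≠ .i → x ≠ .k → x ≠ .acc → τ₃.var x = σ.var x := fun x hx hx' hx'' =>
    (hf₃.1 x (by simp [hx, hx', hx''])).trans (by simpa [hx''] using v2 x hx hx')
  -- placing
  refine wp_count (x := .i) (hi := .q)
    (fun i τ => (∀ v < U, τ.arr .cN v = st v + (l.take i).countP (κ · = v)) ∧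
      (∀ v < U, ∀ r x, ((l.take i).filter (κ · = v))[r]? = some x → τ.arr out (st v + r) = x) ∧
      (∀ j, l.length ≤ j → τ.arr out j = σ.arr out j) ∧
      (∀ a, a ≠ .cN → a ≠ out → τ.arr a = σ.arr a) ∧
      τ.time ≤ σ.time + 22 + 47 * U + 33 * l.length + 60 * i) 0 l.length
    (by simp) (by simp) (by simp) (by simp) (by simp) (by simp)
    ((v3 .q (by simp) (by simp) (by simp)).trans hq) (by omega)
    ⟨by simpa using hz₃, by simp, by simp [a3 _ h3], fun a ha _ => by simpa using a3 a ha,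
      by simp; omega⟩ ?_ ?_
  · rintro i τ - hi ⟨hI, hO, hO', ha, ht⟩ hx hhi - -
    have e1 : τ.arr inp i = l[i] := by rw [ha _ h2 h5, hl i hi]
    have e2 : τ.arr key l[i] = κ l[i] := by rw [ha _ h1 h4]
    have e3 := hI _ (hκ' i hi)
    have e4 : (l.take i).countP (κ · = κ l[i]) + 1 ≤ l.countP (κ · = κ l[i]) := by
      have := countP_le_take (κ · = κ l[i]) l (i + 1)
      rw [List.take_succ_eq_append_getElem hi, List.countP_append] at this
      simpa using this
    have e5 : st (κ l[i]) + l.countP (κ · = κ l[i]) ≤ l.length :=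
      le_trans (countP_disjoint κ l (Nat.lt_succ_self _)) (hcount _)
    have e6 := hκ' i hi
    have e7 := hls _ (List.getElem_mem hi)
    simp only [wp_seq, wp_set, wp_put, Expr.safe_vr, Expr.safe_cst, Expr.val_vr, Expr.val_cst,
      St.var_tick, St.var_setVar, if_true, hx, Expr.cost_vr, Expr.cost_cst, Expr.safe_ld,
      Expr.safe_add, Expr.val_ld, Expr.val_add, Expr.cost_ld, Expr.cost_add, St.arr_tick,
      St.arr_setVar, St.arr_setArr, St.var_setArr, e1, e2, e3, reduceCtorEq, if_false,
      if_neg h4, if_neg h3.symm]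
    refine ⟨⟨trivial, by omega⟩, ⟨⟨trivial, e7⟩, by omega⟩, trivial, trivial, by omega,
      ⟨trivial, e7⟩, ⟨trivial, by omega, by omega⟩, by omega, ?_, ?_, ?_, ?_, ?_⟩
    · intro v hv
      simp only [Function.update_apply]
      rw [List.take_succ_eq_append_getElem hi, List.countP_append]
      split_ifs with hvi
      · subst hvi; simp; omega
      · have : κ l[i] ≠ v := fun hh => hvi hh.symm
        rw [hI v hv]; simp [this]
    · intro v hv r x hr
      rw [if_neg h3]
      rw [List.take_succ_eq_append_getElem hi, List.filter_append] at hr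
      rw [Function.update_apply]
      have hlen : ((l.take i).filter (κ · = v)).length = (l.take i).countP (κ · = v) :=
        List.countP_eq_length_filter.symm
      rcases Nat.lt_or_ge r ((l.take i).countP (κ · = v)) with hlt | hge
      · rw [List.getElem?_append_left (by omega)] at hr
        rw [if_neg, hO v hv r x hr]
        intro heq
        rcases lt_trichotomy v (κ l[i]) with h | h | h
        · have := hdis h
          have := countP_le_take (κ · = v) l i
          omega
        · subst h; omega
        · have := hdis h
          omega
      · rw [List.getElem?_append_right (by omega)] at hr
        by_cases hv' : κ l[i] = v
        · simp only [hv', decide_true, List.filter_cons_of_pos, List.filter_nil,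
            List.getElem?_singleton] at hr
          split_ifs at hr with h0
          rw [Option.some.injEq] at hr
          rw [if_pos (by rw [hv']; omega), hr]
        · simp [hv'] at hr
    · intro j hj
      rw [if_neg h3, Function.update_apply, if_neg (by omega), hO' j hj]
    · intro a hne hne'
      simp [hne, hne', ha a hne hne']
    · simp only [St.time_tick, St.time_setVar, St.time_setArr]; omega
  · rintro τ ⟨-, hO, hO', -, ht⟩ -
    refine ⟨?_, by simpa using hO', by simp only [St.time_tick, sortTime]; omega⟩
    rw [List.take_length] at hO
    simp only [St.arr_tick]
    have key : ∀ V, V ≤ U → ∀ i (h : i < (bucketSort κ V l).length),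
        τ.arr out i = (bucketSort κ V l)[i] := by
      intro V
      induction V with
      | zero => intro _ i h; simp [bucketSort] at h
      | succ V ih =>
        intro hV i h
        have hlen := length_bucketSort κ V l
        rcases Nat.lt_or_ge i (bucketSort κ V l).length with hi | hi
        · rw [ih (by omega) i hi]
          simp only [bucketSort_succ]
          rw [List.getElem_append_left hi]
        · simp only [bucketSort_succ]
          rw [List.getElem_append_right hi]
          have := hO V hV (i - (bucketSort κ V l).length) _ (List.getElem?_eq_getElem (by
            rw [bucketSort_succ, List.length_append] at h; omega))
          rw [← this]
          congr 1
          simp only [hst]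
          omega
    exact key U le_rfl

/-! ### Counting live slots -/

/-- The number of elements of `[a, b)` that are not in the set `D` of deleted slots. -/
def live (D : Finset ℕ) (a b : ℕ) : ℕ := ((Finset.Ico a b).filter (· ∉ D)).card

section
variable {D D' : Finset ℕ} {a b c x y : ℕ}

theorem live_add (h₁ : a ≤ b) (h₂ : b ≤ c) : live D a b + live D b c = live D a c := by
  unfold live
  rw [← Finset.card_union_of_disjoint, ← Finset.filter_union, Finset.Ico_union_Ico_eq_Ico h₁ h₂]
  exact Finset.disjoint_filter_filter (Finset.Ico_disjoint_Ico_consecutive a b c)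

theorem live_le : live D a b ≤ b - a :=
  (Finset.card_filter_le _ _).trans (by simp)

theorem live_self : live D a a = 0 := by simp [live]

theorem live_empty : live ∅ a b = b - a := by simp [live]

theorem live_congr (h : ∀ x, a ≤ x → x < b → (x ∈ D ↔ x ∈ D')) : live D a b = live D' a b := by
  unfold live
  congr 1
  apply Finset.filter_congr
  intro x hx
  rw [Finset.mem_Ico] at hx
  rw [h x hx.1 hx.2]

theorem live_anti (h : D ⊆ D') (a b : ℕ) : live D' a b ≤ live D a b :=
  Finset.card_le_card fun x hx => by
    rw [Finset.mem_filter] at hx ⊢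
    exact ⟨hx.1, fun h' => hx.2 (h h')⟩

theorem live_insert (hx : x ∉ D) :
    live (insert x D) a b + (if a ≤ x ∧ x < b then 1 else 0) = live D a b := by
  unfold live
  have : (Finset.Ico a b).filter (· ∉ insert x D) = ((Finset.Ico a b).filter (· ∉ D)).erase x := by
    ext z; simp; tauto
  rw [this]
  split_ifs with h
  · exact Finset.card_erase_add_one (by simp [h, hx])
  · rw [Finset.erase_eq_of_notMem (by simp; tauto), Nat.add_zero]

theorem live_pos (hx : x ∉ D) (h₁ : a ≤ x) (h₂ : x < b) : 0 < live D a b :=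
  Finset.card_pos.2 ⟨x, by simp [h₁, h₂, hx]⟩

/-- A live slot `x` is on the right of the boundary `y` if and only if its rank is at least the rank
of the boundary. -/
theorem live_le_live_iff (hx : x ∉ D) (h₁ : a ≤ x) (h₂ : a ≤ y) :
    live D a y ≤ live D a x ↔ y ≤ x := by
  rcases Nat.lt_or_ge x y with h | h
  · have e1 := live_add (D := D) h₁ h.le
    have e2 := live_pos (D := D) hx le_rfl h
    omega
  · have e1 := live_add (D := D) h₂ h
    omega

end

/-- The slots that are deleted before time `t`. -/
def deleted (slot : ℕ → ℕ) (t : ℕ) : Finset ℕ := (Finset.range t).image slot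

theorem deleted_succ (slot : ℕ → ℕ) (t : ℕ) :
    deleted slot (t + 1) = insert (slot t) (deleted slot t) := by
  simp [deleted, Finset.range_add_one]

theorem not_mem_deleted {slot : ℕ → ℕ} {Q t : ℕ} (ht : t < Q) (h : Set.InjOn slot (Set.Iio Q)) :
    slot t ∉ deleted slot t := by
  simp only [deleted, Finset.mem_image, Finset.mem_range, not_exists, not_and]
  intro u hu hut
  have := h (show u < Q by omega) ht hut
  omega

/-- The operations in an order `A` that groups them by blocks of `2 ^ s` slots and, inside a block,
by time. -/
structure Grouped (slot A : ℕ → ℕ) (s Q : ℕ) : Prop where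
  lt : ∀ p < Q, A p < Q
  surj : ∀ t < Q, ∃ p < Q, A p = t
  mono : ∀ p q, p < q → q < Q → slot (A p) / 2 ^ s < slot (A q) / 2 ^ s ∨
    slot (A p) / 2 ^ s = slot (A q) / 2 ^ s ∧ A p < A q

section
variable {slot A : ℕ → ℕ} {s Q : ℕ}

theorem Grouped.injOn (h : Grouped slot A s Q) : Set.InjOn A (Set.Iio Q) := by
  intro p hp q hq hpq
  rcases lt_trichotomy p q with hlt | heq | hlt
  · rcases h.mono p q hlt hq with h' | h' <;> rw [hpq] at h' <;> omega
  · exact heq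
  · rcases h.mono q p hlt hp with h' | h' <;> rw [hpq] at h' <;> omega

theorem Grouped.slot_injOn (h : Grouped slot A s Q) (hs : Set.InjOn slot (Set.Iio Q)) :
    Set.InjOn (slot ∘ A) (Set.Iio Q) :=
  hs.comp h.injOn fun _ hp => h.lt _ hp

/-- Inside its own block, an operation sees the same deletions in the order `A` as in the order of
time. -/
theorem Grouped.live_eq (h : Grouped slot A s Q) {p x y : ℕ}
    (hp : p < Q) (hx : slot (A p) / 2 ^ s * 2 ^ s ≤ x)
    (hy : y ≤ (slot (A p) / 2 ^ s + 1) * 2 ^ s) :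
    live (deleted (slot ∘ A) p) x y = live (deleted slot (A p)) x y := by
  apply live_congr
  intro z hz₁ hz₂
  have hz : z / 2 ^ s = slot (A p) / 2 ^ s := by
    apply Nat.div_eq_of_lt_le <;> omega
  simp only [deleted, Finset.mem_image, Finset.mem_range, Function.comp]
  constructor
  · rintro ⟨q, hq, rfl⟩
    refine ⟨A q, ?_, rfl⟩
    rcases h.mono q p hq hp with h' | h' <;> omega
  · rintro ⟨u, hu, rfl⟩
    obtain ⟨q, hq, rfl⟩ := h.surj u (by have := h.lt p hp; omega)
    refine ⟨q, ?_, rfl⟩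
    by_contra hpq
    rcases Nat.lt_or_ge p q with hlt | hge
    · rcases h.mono p q hlt hq with h' | h' <;> omega
    · obtain rfl : p = q := by omega
      omega

end

/-! ### Chunks -/

/-- The start of the chunk of position `p`: the positions are cut where `κ` changes and so that no
chunk has more than `M` positions. -/
def chunkStart (κ : ℕ → ℕ) (M : ℕ) : ℕ → ℕ
  | 0 => 0
  | p + 1 => if κ (p + 1) = κ p ∧ p + 1 - chunkStart κ M p ≠ M then chunkStart κ M p else p + 1

/-- The number of chunks that start before position `p`. -/
def chunks (κ : ℕ → ℕ) (M : ℕ) : ℕ → ℕ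
  | 0 => 0
  | p + 1 => chunks κ M p + if chunkStart κ M p = p then 1 else 0

section
variable {κ : ℕ → ℕ} {M : ℕ}

theorem chunkStart_le (p : ℕ) : chunkStart κ M p ≤ p := by
  induction p with
  | zero => simp [chunkStart]
  | succ p ih => rw [chunkStart]; split_ifs <;> omega

theorem sub_chunkStart_lt (hM : 0 < M) (p : ℕ) : p - chunkStart κ M p < M := by
  induction p with
  | zero => simpa [chunkStart]
  | succ p ih => rw [chunkStart]; split_ifs <;> omega

theorem chunkStart_mono : Monotone (chunkStart κ M) := by
  refine monotone_nat_of_le_succ fun p => ?_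
  have := chunkStart_le (κ := κ) (M := M) p
  rw [chunkStart]
  split_ifs <;> omega

theorem chunkStart_succ_of_ne {p : ℕ} (h : chunkStart κ M (p + 1) ≠ p + 1) :
    chunkStart κ M (p + 1) = chunkStart κ M p ∧ κ (p + 1) = κ p := by
  rw [chunkStart] at h ⊢
  split_ifs at h ⊢ with h'
  · exact ⟨rfl, h'.1⟩
  · exact absurd rfl h

theorem key_chunkStart (p : ℕ) : κ (chunkStart κ M p) = κ p := by
  induction p with
  | zero => simp [chunkStart]
  | succ p ih =>
    by_cases h : chunkStart κ M (p + 1) = p + 1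
    · rw [h]
    · obtain ⟨h1, h2⟩ := chunkStart_succ_of_ne h
      rw [h1, h2, ih]

/-- A new chunk starts for a new value of `κ` or after `M` positions. -/
theorem chunks_le (hM : 0 < M) {Q : ℕ} (hκ : ∀ p, p + 1 < Q → κ p ≤ κ (p + 1)) (p : ℕ)
    (hp : p < Q) : chunks κ M (p + 1) ≤ chunkStart κ M p / M + κ p + 1 := by
  induction p with
  | zero => simp [chunks, chunkStart]
  | succ p ih =>
    have ih := ih (by omega)
    have hk := hκ p hp
    have hle := chunkStart_le (κ := κ) (M := M) p
    rw [chunks]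
    by_cases h : chunkStart κ M (p + 1) = p + 1
    · rw [if_pos h, h]
      rw [chunkStart] at h
      split_ifs at h with h'
      · have := chunkStart_le (κ := κ) (M := M) p; omega
      · by_cases hκ' : κ (p + 1) = κ p
        · have e : p + 1 = chunkStart κ M p + M := by
            have : p + 1 - chunkStart κ M p = M := by by_contra h''; exact h' ⟨hκ', h''⟩
            omega
          have : (p + 1) / M = chunkStart κ M p / M + 1 := by
            conv_lhs => rw [e]
            exact Nat.add_div_right _ hM
          omega
        · have : chunkStart κ M p / M ≤ (p + 1) / M := Nat.div_le_div_right (by omega)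
          omega
    · obtain ⟨h1, h2⟩ := chunkStart_succ_of_ne h
      rw [if_neg h, h1, h2]
      omega

/-- There are few chunks: `M` times their number is at most the number of positions, plus `M` for
each value of `κ`. -/
theorem mul_chunks_le (hM : 0 < M) {Q V : ℕ} (hκ : ∀ p, p + 1 < Q → κ p ≤ κ (p + 1))
    (hV : ∀ p < Q, κ p < V) : M * chunks κ M Q ≤ Q + M * V := by
  cases Q with
  | zero => simp [chunks]
  | succ p =>
    have h1 := chunks_le hM hκ p (Nat.lt_succ_self p)
    have h2 := hV p (Nat.lt_succ_self p)
    have h3 := chunkStart_le (κ := κ) (M := M) p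
    have h4 := Nat.mul_div_le (chunkStart κ M p) M
    calc M * chunks κ M (p + 1) ≤ M * (chunkStart κ M p / M + κ p + 1) := Nat.mul_le_mul_left _ h1
      _ = M * (chunkStart κ M p / M) + M * (κ p + 1) := by ring
      _ ≤ (p + 1) + M * V := by
        have := Nat.mul_le_mul_left M (Nat.succ_le_of_lt h2)
        have e : M * (κ p + 1) = M * (κ p).succ := rfl
        omega

end

/-! ### Small coordinates for a chunk -/

/-- Move the current coordinate `x` from the value `y` on to the value `u`, by at most `cap`. -/
def advance (u : Var) : Stmt :=
  .set .w (.vr u - .vr .y) ;;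
  .ite (.op .lt (.vr .cap) (.vr .w)) (.set .w (.vr .cap)) .skip ;;
  .set .x (.vr .x + .vr .w) ;;
  .set .y (.vr u)

theorem wp_advance {E : Env} {u : Var} {σ : St} {Φ : St → Prop} (hw : u ≠ .w) (hx : u ≠ .x)
    (hu : σ.var .y ≤ σ.var u)
    (hs : σ.var .x + min (σ.var u - σ.var .y) (σ.var .cap) < 2 ^ E.w)
    (h : ∀ τ : St, τ.arr = σ.arr →
      τ.var .x = σ.var .x + min (σ.var u - σ.var .y) (σ.var .cap) → τ.var .y = σ.var u →
      (∀ z, z ≠ .w → z ≠ .x → z ≠ .y → τ.var z = σ.var z) → τ.time ≤ σ.time + 17 → Φ τ) :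
    wp E (advance u) Φ σ := by
  have hc : (Var.cap = Var.w) = False := by simp
  simp only [advance, wp_seq, wp_set, wp_ite, wp_skip, Expr.safe_sub, Expr.safe_vr, Expr.val_vr,
    Expr.val_sub, Expr.safe_lt, Expr.val_lt, St.var_tick, St.var_setVar, if_true, hw, if_false,
    reduceCtorEq, Expr.safe_add, Expr.val_add, true_and, hx, Expr.cost_sub, Expr.cost_vr,
    Expr.cost_op, Expr.cost_add]
  refine ⟨hu, ?_⟩
  by_cases h1 : σ.var .cap < σ.var u - σ.var .y
  · rw [min_eq_right (by omega)] at hs h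
    simp only [h1, hc, if_true, if_false, one_ne_zero, St.var_tick, St.var_setVar, hw, hx,
      reduceCtorEq]
    refine ⟨hs, h _ rfl (by simp) (by simp) (fun z h1 h2 h3 => by simp [h1, h2, h3])
      (by simp)⟩
  · rw [min_eq_left (by omega)] at hs h
    simp only [h1, hc, if_true, if_false, St.var_tick, St.var_setVar, hw, hx, reduceCtorEq]
    refine ⟨hs, h _ rfl (by simp) (by simp) (fun z h1 h2 h3 => by simp [h1, h2, h3])
      (by simp)⟩

/-- The state of the merging of thresholds `P 0 ≤ P 1 ≤ …` with keys, after `i` thresholds and the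
keys at the positions from `p` to `ptr`, the last value being `y` with coordinate `x`.  The
coordinates are `ζ` and `kc`.  Coordinates decide every comparison of a threshold with a key in the
same way as the values do, even when the key is increased by some `δ < cap`. -/
structure Merged (cap p : ℕ) (key kc P ζ : ℕ → ℕ) (i ptr x y : ℕ) : Prop where
  thr : ∀ j < i, P j ≤ y ∧ ζ j ≤ x
  ops : ∀ q, p ≤ q → q < ptr → key q ≤ y ∧ kc q ≤ x ∧ min (y - key q) cap ≤ x - kc q ∧
    x - kc q ≤ y - key q
  cmp : ∀ j < i, ∀ q, p ≤ q → q < ptr → ∀ δ < cap, (P j ≤ key q + δ ↔ ζ j ≤ kc q + δ)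

/-- A gap before a threshold may be cut down to `cap`: a comparison with a threshold farther than
`cap` from a key has the same outcome for all admissible `δ`. -/
theorem Merged.threshold {cap p i ptr x y : ℕ} {key kc P ζ ζ' : ℕ → ℕ}
    (h : Merged cap p key kc P ζ i ptr x y) (hy : y ≤ P i)
    (h₁ : ζ' i = x + min (P i - y) cap) (h₂ : ∀ j < i, ζ' j = ζ j) :
    Merged cap p key kc P ζ' (i + 1) ptr (x + min (P i - y) cap) (P i) := by
  refine ⟨fun j hj => ?_, fun q hq hq' => ?_, fun j hj q hq hq' δ hδ => ?_⟩
  · rcases Nat.lt_or_ge j i with hji | hji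
    · have := h.thr j hji
      rw [h₂ j hji]; omega
    · obtain rfl : j = i := by omega
      rw [h₁]; omega
  · have := h.ops q hq hq'
    omega
  · rcases Nat.lt_or_ge j i with hji | hji
    · rw [h₂ j hji]; exact h.cmp j hji q hq hq' δ hδ
    · obtain rfl : j = i := by omega
      have := h.ops q hq hq'
      rw [h₁]; omega

/-- A gap before a key may be cut down to `cap` as well: a smaller threshold remains smaller. -/
theorem Merged.op {cap p i ptr x y : ℕ} {key kc kc' P ζ : ℕ → ℕ}
    (h : Merged cap p key kc P ζ i ptr x y) (hy : y ≤ key ptr)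
    (h₁ : kc' ptr = x + min (key ptr - y) cap) (h₂ : ∀ q, p ≤ q → q < ptr → kc' q = kc q) :
    Merged cap p key kc' P ζ i (ptr + 1) (x + min (key ptr - y) cap) (key ptr) := by
  refine ⟨fun j hj => ?_, fun q hq hq' => ?_, fun j hj q hq hq' δ hδ => ?_⟩
  · have := h.thr j hj
    omega
  · rcases Nat.lt_or_ge q ptr with hlt | hge
    · have := h.ops q hq hlt
      rw [h₂ q hq hlt]; omega
    · obtain rfl : q = ptr := by omega
      rw [h₁]; omega
  · rcases Nat.lt_or_ge q ptr with hlt | hge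
    · rw [h₂ q hq hlt]; exact h.cmp j hj q hq hlt δ hδ
    · obtain rfl : q = ptr := by omega
      have := h.thr j hj
      rw [h₁]; omega

/-- Preparation of the chunk that starts at position `p`, in the block `v`: the thresholds, which
are the prefix sums of the live slots of the children of `v`, are stored in `parr` and, in small
coordinates and packed, in `z`; the coordinates of the keys are stored in `kc`. -/
def setup : Stmt :=
  .set .ptr (.vr .p) ;; .set .x (.cst 0) ;; .set .y (.cst 0) ;; .set .z (.cst 0) ;;
  .set .dd (.cst 0) ;; .set .pp (.cst 0) ;;
  .count .i (.cst 0) .bb (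
    advance .pp ;;
    .put .parr (.vr .i) (.vr .pp) ;;
    .set .z (.vr .z + .op .shl (.vr .h - .vr .x) (.vr .f * .vr .i)) ;;
    .set .pp (.vr .pp + .ld .cnt (.vr .v * .vr .bb + .vr .i)) ;;
    .loop (.op .lt (.vr .ptr) (.vr .q))
      (.op .and (.op .eq (.ld .cid (.ld .oC (.vr .ptr))) (.vr .p))
        (.op .lt (.ld .key (.ld .oC (.vr .ptr))) (.vr .pp)))
      (.set .e (.ld .oC (.vr .ptr)) ;; .set .kv (.ld .key (.vr .e)) ;; advance .kv ;;
        .put .kc (.vr .e) (.vr .x) ;; .set .ptr (.vr .ptr + .cst 1)))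

/-- The thresholds `P i` and the sorted keys of the chunk, listed by `c`, are merged in time linear
in the number `M` of children.  Each of the at most `2 M` gaps adds at most `M + 1` to the
coordinates, which therefore fit into a field. -/
theorem wp_setup {E : Env} {σ : St} {Q M p v F : ℕ} {κ c P : ℕ → ℕ}
    (hq : σ.var .q = Q) (hbb : σ.var .bb = M) (hcap : σ.var .cap = M + 1) (hf : σ.var .f = F)
    (hh : σ.var .h = 2 ^ (F - 1)) (hp : σ.var .p = p) (hv : σ.var .v = v) (hM : 0 < M)
    (hpQ : p < Q) (hQS : Q < E.stride) (hMS : M ≤ E.stride) (hF : 0 < F)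
    (hbig : 2 ^ (F * M) < 2 ^ E.w) (hsmall : (M + 1) * (2 * M) < 2 ^ (F - 1))
    (hSw : 4 * E.stride + 4 < 2 ^ E.w)
    (hc : ∀ q < Q, σ.arr .oC q = c q) (hcs : ∀ q < Q, c q < E.stride)
    (hcinj : Set.InjOn c (Set.Iio Q))
    (hcid : ∀ q < Q, σ.arr .cid (c q) = chunkStart κ M q) (hp0 : chunkStart κ M p = p)
    (hkey : ∀ q q', p ≤ q → q < q' → q' < Q → chunkStart κ M q' = p →
      σ.arr .key (c q) ≤ σ.arr .key (c q'))
    (hP0 : P 0 = 0) (hP : ∀ i < M, P (i + 1) = P i + σ.arr .cnt (v * M + i))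
    (hPS : P M ≤ E.stride) (hvS : (v + 1) * M ≤ E.stride)
    (hlast : ∀ q < Q, chunkStart κ M q = p → σ.arr .key (c q) < P M) :
    wp E setup (fun τ => τ.var .dd = 0 ∧ ∃ ζ : ℕ → ℕ,
      τ.var .z = pack F (fun i => 2 ^ (F - 1) - ζ i) M ∧
      (∀ i < M, τ.arr .parr i = P i ∧ ζ i ≤ (M + 1) * (2 * M)) ∧
      (∀ q < Q, chunkStart κ M q = p → τ.arr .kc (c q) ≤ (M + 1) * (2 * M) ∧
        ∀ i < M, ∀ δ < M + 1, (P i ≤ σ.arr .key (c q) + δ ↔ ζ i ≤ τ.arr .kc (c q) + δ)) ∧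
      τ.time ≤ σ.time + 180 * M + 40) σ := by
  have hPmono : ∀ i j, i ≤ j → j ≤ M → P i ≤ P j := by
    intro i j hij
    induction j, hij using Nat.le_induction with
    | base => intro _; rfl
    | succ j hij ih => intro hj; rw [hP j (by omega)]; have := ih (by omega); omega
  -- the positions of the chunk form an interval of at most `M` positions
  have hchunk : ∀ q, chunkStart κ M q = p → p ≤ q ∧ q < p + M := by
    intro q h
    have h1 := chunkStart_le (κ := κ) (M := M) q
    have h2 := sub_chunkStart_lt (κ := κ) hM q
    omega
  have hsandwich : ∀ q q', p ≤ q → q ≤ q' → chunkStart κ M q' = p → chunkStart κ M q = p := by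
    intro q q' h1 h2 h3
    have h4 := chunkStart_mono (κ := κ) (M := M) h1
    have h5 := chunkStart_mono (κ := κ) (M := M) h2
    omega
  have hFM : F * M < 2 ^ E.w := by
    have : F * M < 2 ^ (F * M) := Nat.lt_two_pow_self
    omega
  have hFi : ∀ i, i < M → F * i ≤ F * M := fun i hi => Nat.mul_le_mul_left _ hi.le
  have hH : 2 ^ F = 2 * 2 ^ (F - 1) := by rw [← pow_succ']; congr 1; omega
  have hfield : ∀ k : ℕ, 2 ^ (F - 1) - k < 2 ^ F := fun k => by
    have : 0 < 2 ^ (F - 1) := by positivity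
    omega
  have hlist : (M + 1) * (2 * M) < 2 ^ E.w := by
    have h1 : 2 ^ (F - 1) ≤ 2 ^ (F * M) :=
      Nat.pow_le_pow_right two_pos (by have := Nat.le_mul_of_pos_right F hM; omega)
    omega
  have hcapmul : ∀ k, k ≤ 2 * M → (M + 1) * k ≤ (M + 1) * (2 * M) := fun k hk =>
    Nat.mul_le_mul_left _ hk
  have hMw : M < 2 ^ E.w := by omega
  simp only [setup, wp_seq, wp_set, Expr.safe_vr, Expr.safe_cst, Expr.val_vr, Expr.val_cst,
    Expr.cost_vr, Expr.cost_cst, true_and]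
  have hpos : 0 < 2 ^ E.w := by positivity
  refine ⟨hpos, hpos, hpos, hpos, hpos, ?_⟩
  refine wp_count (x := .i) (hi := .bb)
    (fun i τ => ∃ ζ : ℕ → ℕ, τ.var .pp = P i ∧ τ.var .y ≤ P i ∧
      τ.var .z = pack F (fun i => 2 ^ (F - 1) - ζ i) i ∧ p ≤ τ.var .ptr ∧ τ.var .ptr ≤ Q ∧
      (∀ q, p ≤ q → q < τ.var .ptr → chunkStart κ M q = p) ∧
      τ.var .x ≤ (M + 1) * (i + (τ.var .ptr - p)) ∧
      (∀ q, τ.var .ptr ≤ q → q < Q → chunkStart κ M q = p → P i ≤ σ.arr .key (c q)) ∧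
      (∀ j < i, τ.arr .parr j = P j ∧ ζ j ≤ (M + 1) * (2 * M)) ∧
      Merged (M + 1) p (fun q => σ.arr .key (c q)) (fun q => τ.arr .kc (c q)) P ζ i (τ.var .ptr)
        (τ.var .x) (τ.var .y) ∧
      τ.var .dd = 0 ∧
      τ.time ≤ σ.time + 20 + 110 * i + 70 * (τ.var .ptr - p)) 0 M
    (by simp [advance]) (by simp [advance]) (by simp) (by simp) (by simp) (by simp)
    (by simp [hbb]) hMw ?_ ?_ ?_
  · refine ⟨fun _ => 0, by simp [hP0], by simp, by simp [pack], by simp [hp], by simp [hp]; omega,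
      ?_, by simp, by simp [hP0], by simp, ?_, by simp, by simp; omega⟩
    · simp [hp]; intro q h1 h2; omega
    · refine ⟨by simp, ?_, by simp⟩
      simp [hp]; intro q h1 h2; omega
  · rintro i τ - hi ⟨ζ, hpp, hy, hz, hp1, hp2, hcs1, hx, hnext, hthr, hmer, hdd, ht⟩ hvi hvbb
      hfv hfa
    have fv : ∀ y, y = .v ∨ y = .q ∨ y = .h ∨ y = .f ∨ y = .cap ∨ y = .p → τ.var y = σ.var y := by
      intro y hy
      rw [hfv y (by rintro rfl; simp at hy)
        (by simp [advance]; rcases hy with rfl | rfl | rfl | rfl | rfl | rfl <;> simp)]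
      rcases hy with rfl | rfl | rfl | rfl | rfl | rfl <;> simp
    have fa : ∀ a, a ≠ .parr → a ≠ .kc → τ.arr a = σ.arr a := by
      intro a h1 h2
      rw [hfa a (by simp [advance, h1, h2])]
      rfl
    have hPi : P i ≤ E.stride := (hPmono i M hi.le le_rfl).trans hPS
    have hPi1 : P (i + 1) ≤ E.stride := (hPmono (i + 1) M hi le_rfl).trans hPS
    have hptr : τ.var .ptr ≤ p + M := by
      by_contra h
      have := hchunk (τ.var .ptr - 1) (hcs1 _ (by omega) (by omega))
      omega
    have hx0 := hcapmul (i + 1 + (τ.var .ptr - p)) (by omega)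
    have hx1 : τ.var .x + min (P i - τ.var .y) (M + 1) ≤
        (M + 1) * (i + 1 + (τ.var .ptr - p)) := by
      have : (M + 1) * (i + 1 + (τ.var .ptr - p)) =
          (M + 1) * (i + (τ.var .ptr - p)) + (M + 1) := by ring
      omega
    simp only [wp_seq]
    refine wp_advance (by simp) (by simp) (by simpa [hpp] using hy) ?_ ?_
    · simp only [St.var_tick, hpp, fv .cap (by simp), hcap]
      omega
    intro τ₁ ha₁ hx₁ hy₁ hv₁ ht₁
    simp only [St.arr_tick, St.var_tick, St.time_tick, hpp, fv .cap (by simp), hcap]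
      at ha₁ hx₁ hy₁ hv₁ ht₁
    set ζ' : ℕ → ℕ := Function.update ζ i (τ₁.var .x) with hζ'
    have hmer₁ : Merged (M + 1) p (fun q => σ.arr .key (c q)) (fun q => τ₁.arr .kc (c q)) P ζ'
        (i + 1) (τ₁.var .ptr) (τ₁.var .x) (τ₁.var .y) := by
      rw [ha₁, hx₁, hy₁, hv₁ .ptr (by simp) (by simp) (by simp)]
      exact hmer.threshold hy (by simp [hζ', hx₁]) (fun j hj => by
        rw [hζ', Function.update_of_ne (by omega)])
    have gv : ∀ y, y = .v ∨ y = .q ∨ y = .h ∨ y = .f ∨ y = .cap ∨ y = .p → τ₁.var y = σ.var y := by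
      intro y hy
      rw [← fv y hy]
      rcases hy with rfl | rfl | rfl | rfl | rfl | rfl <;> exact hv₁ _ (by simp) (by simp) (by simp)
    have gi : τ₁.var .i = i := (hv₁ _ (by simp) (by simp) (by simp)).trans hvi
    have gpp : τ₁.var .pp = P i := (hv₁ _ (by simp) (by simp) (by simp)).trans hpp
    have gz : τ₁.var .z = pack F (fun i => 2 ^ (F - 1) - ζ i) i :=
      (hv₁ _ (by simp) (by simp) (by simp)).trans hz
    have gptr : τ₁.var .ptr = τ.var .ptr := hv₁ _ (by simp) (by simp) (by simp)
    have gbb : τ₁.var .bb = M := (hv₁ _ (by simp) (by simp) (by simp)).trans hvbb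
    have gcnt : τ₁.arr .cnt = σ.arr .cnt := by rw [ha₁]; exact fa _ (by simp) (by simp)
    have hxh : τ₁.var .x < 2 ^ (F - 1) := by omega
    have hzz : pack F (fun i => 2 ^ (F - 1) - ζ i) i + (2 ^ (F - 1) - τ₁.var .x) * 2 ^ (F * i) =
        pack F (fun i => 2 ^ (F - 1) - ζ' i) (i + 1) := by
      rw [pack_succ]
      congr 1
      · exact pack_congr fun j hj => by rw [hζ', Function.update_of_ne (by omega)]
      · simp [hζ']
    have hzlt : pack F (fun i => 2 ^ (F - 1) - ζ' i) (i + 1) < 2 ^ E.w := by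
      refine lt_of_lt_of_le (pack_lt fun j _ => hfield _) (le_trans ?_ hbig.le)
      exact Nat.pow_le_pow_right two_pos (Nat.mul_le_mul_left _ hi)
    have hvM : v * M + i < E.stride := by
      have : (v + 1) * M = v * M + M := by ring
      omega
    have hFi' := hFi i hi
    simp only [wp_seq, wp_set, wp_put, Expr.safe_vr, Expr.val_vr, Expr.cost_vr, Expr.safe_add,
      Expr.safe_shl, Expr.safe_sub, Expr.safe_mul, Expr.val_shl, Expr.val_sub, Expr.val_mul,
      Expr.val_add, Expr.cost_add, Expr.cost_op, Expr.cost_sub, Expr.cost_mul, Expr.safe_ld,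
      Expr.val_ld, Expr.cost_ld, true_and, St.var_tick, St.var_setVar, St.var_setArr, St.arr_tick,
      St.arr_setVar, St.arr_setArr, reduceCtorEq, if_false, if_true, gi, gpp, gz, gbb, gcnt,
      gv .v (by simp), gv .f (by simp), gv .h (by simp), hv, hf, hh]
    refine ⟨by omega, ⟨⟨hxh.le, by omega, by omega⟩, by omega⟩,
      ⟨⟨⟨by omega, by omega⟩, hvM⟩, by rw [← hP i hi]; omega⟩, ?_⟩
    refine wp_loop (fun υ => υ.var .y ≤ P (i + 1) ∧ τ.var .ptr ≤ υ.var .ptr ∧ υ.var .ptr ≤ Q ∧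
      (∀ q, p ≤ q → q < υ.var .ptr → chunkStart κ M q = p) ∧
      υ.var .x ≤ (M + 1) * (i + 1 + (υ.var .ptr - p)) ∧
      (∀ q, υ.var .ptr ≤ q → q < Q → chunkStart κ M q = p → υ.var .y ≤ σ.arr .key (c q)) ∧
      Merged (M + 1) p (fun q => σ.arr .key (c q)) (fun q => υ.arr .kc (c q)) P ζ' (i + 1)
        (υ.var .ptr) (υ.var .x) (υ.var .y) ∧
      υ.time ≤ σ.time + 20 + 110 * i + 66 + 70 * (υ.var .ptr - p)) (fun υ => Q - υ.var .ptr) ?_ ?_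
    · rintro υ hυ ⟨iy, iptr, iQ, ics, ix, inext, imer, it⟩
      have wv : ∀ y, y ∉ [Var.e, .kv, .w, .x, .y, .ptr, .pp, .z] → υ.var y = τ₁.var y := by
        intro y hy
        simp only [List.mem_cons, not_or, List.not_mem_nil] at hy
        rw [hυ.1 y (by simp [advance, hy])]
        simp [hy]
      have wpp : υ.var .pp = P (i + 1) := by
        rw [hυ.1 .pp (by simp [advance])]
        simp only [St.var_tick, St.var_setVar, if_true]
        exact (hP i hi).symm
      have wz : υ.var .z = pack F (fun i => 2 ^ (F - 1) - ζ' i) (i + 1) := by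
        rw [hυ.1 .z (by simp [advance]), ← hzz]
        simp
      have wa : ∀ a, a ≠ .kc → a ≠ .parr → υ.arr a = σ.arr a := by
        intro a h1 h2
        rw [hυ.2 a (by simp [advance, h1])]
        simp only [St.arr_tick, St.arr_setVar, St.arr_setArr, h2, if_false]
        rw [ha₁, fa a h2 h1]
      have wparr : ∀ j < i + 1, υ.arr .parr j = P j := by
        intro j hj
        rw [hυ.2 .parr (by simp [advance])]
        simp only [St.arr_tick, St.arr_setVar, St.arr_setArr, if_true, Function.update_apply]
        split_ifs with hji
        · rw [hji]
        · rw [ha₁]; exact (hthr j (by omega)).1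
      have wq : υ.var .q = Q := (wv .q (by simp)).trans ((gv .q (by simp)).trans hq)
      have wp' : υ.var .p = p := (wv .p (by simp)).trans ((gv .p (by simp)).trans hp)
      have wcap : υ.var .cap = M + 1 := (wv .cap (by simp)).trans ((gv .cap (by simp)).trans hcap)
      have whi : υ.var .i = i := (wv .i (by simp)).trans gi
      have wbb : υ.var .bb = M := (wv .bb (by simp)).trans gbb
      have wdd : υ.var .dd = 0 := by
        rw [wv .dd (by simp), hv₁ _ (by simp) (by simp) (by simp), hdd]
      have hptr' : υ.var .ptr ≤ p + M := by
        by_contra h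
        have := hchunk (υ.var .ptr - 1) (ics _ (by omega) (by omega))
        omega
      have hζ'le : ∀ j < i + 1, ζ' j ≤ (M + 1) * (2 * M) := by
        intro j hj
        rcases Nat.lt_or_ge j i with h | h
        · rw [hζ', Function.update_of_ne (by omega)]; exact (hthr j h).2
        · obtain rfl : j = i := by omega
          rw [hζ', Function.update_self]; omega
      simp only [Expr.safe_lt, Expr.safe_vr, true_and, Expr.val_lt, Expr.val_vr, wq, Expr.cost_op,
        Expr.cost_vr, Expr.safe_and, Expr.safe_eq, Expr.safe_ld, Expr.val_ld, wp', wpp, and_true,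
        Expr.val_and, Expr.val_eq, Expr.cost_ld]
      by_cases hlt : υ.var .ptr < Q
      swap
      · -- all positions are used up
        simp only [hlt, if_false, if_true]
        refine ⟨ζ', wpp, iy, wz, by simp; omega, by simpa using iQ, by simpa using ics,
          by simpa using ix, ?_, ?_, by simpa using imer, wdd, by simp; omega⟩
        · simp; intro q h1 h2; omega
        · intro j hj
          exact ⟨wparr j hj, hζ'le j hj⟩
      simp only [hlt, if_true, one_ne_zero, if_false]
      rw [wa .oC (by simp) (by simp), hc _ hlt, wa .cid (by simp) (by simp), hcid _ hlt,
        wa .key (by simp) (by simp)]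
      refine ⟨⟨⟨by omega, hcs _ hlt⟩, by omega, hcs _ hlt⟩, ?_⟩
      by_cases hcond : chunkStart κ M (υ.var .ptr) = p ∧ σ.arr .key (c (υ.var .ptr)) < P (i + 1)
      swap
      · have hzero : ((if chunkStart κ M (υ.var .ptr) = p then 1 else 0) &&&
            (if σ.arr .key (c (υ.var .ptr)) < P (i + 1) then 1 else 0)) = 0 := by
          split_ifs with h1 h2
          · exact absurd ⟨h1, h2⟩ hcond
          all_goals rfl
        simp only [hzero, if_true]
        refine ⟨ζ', wpp, iy, wz, by simp; omega, by simpa using iQ, by simpa using ics,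
          by simpa using ix, ?_, ?_, by simpa using imer, wdd, by simp; omega⟩
        · simp only [St.var_tick, St.var_setVar, reduceCtorEq, if_false]
          intro q h1 h2 h3
          have h4 := hsandwich (υ.var .ptr) q (by omega) h1 h3
          have h5 : P (i + 1) ≤ σ.arr .key (c (υ.var .ptr)) := by
            by_contra h; exact hcond ⟨h4, by omega⟩
          rcases Nat.eq_or_lt_of_le h1 with h | h
          · rwa [← h]
          · exact h5.trans (hkey _ _ (by omega) h h2 h3)
        · intro j hj
          exact ⟨wparr j hj, hζ'le j hj⟩
      have hone : ((if chunkStart κ M (υ.var .ptr) = p then 1 else 0) &&&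
          (if σ.arr .key (c (υ.var .ptr)) < P (i + 1) then 1 else 0)) = 1 := by
        rw [if_pos hcond.1, if_pos hcond.2]; rfl
      simp only [hone, one_ne_zero, if_false]
      have hykey := inext _ le_rfl hlt hcond.1
      have hptr2 : υ.var .ptr < p + M := (hchunk _ hcond.1).2
      have hx2 : υ.var .x + min (σ.arr .key (c (υ.var .ptr)) - υ.var .y) (M + 1) ≤
          (M + 1) * (i + 1 + (υ.var .ptr + 1 - p)) := by
        have : (M + 1) * (i + 1 + (υ.var .ptr + 1 - p)) =
            (M + 1) * (i + 1 + (υ.var .ptr - p)) + (M + 1) := by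
          rw [show i + 1 + (υ.var .ptr + 1 - p) = i + 1 + (υ.var .ptr - p) + 1 by omega]; ring
        omega
      have hx3 := hcapmul (i + 1 + (υ.var .ptr + 1 - p)) (by omega)
      simp only [wp_seq, wp_set, Expr.safe_vr, Expr.val_vr, Expr.cost_vr, Expr.safe_ld,
        Expr.val_ld, Expr.cost_ld, true_and, St.var_tick, St.var_setVar, St.arr_tick,
        St.arr_setVar, reduceCtorEq, if_false, if_true]
      rw [wa .oC (by simp) (by simp), hc _ hlt, wa .key (by simp) (by simp)]
      refine ⟨by omega, hcs _ hlt, ?_⟩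
      refine wp_advance (by simp) (by simp) (by simpa using hykey) ?_ ?_
      · simp [wcap]; omega
      intro υ₁ bA bx bY bv bt
      simp only [St.var_tick, St.var_setVar, St.arr_tick, St.arr_setVar, reduceCtorEq, if_false,
        if_true, St.time_tick, St.time_setVar, wcap] at bA bx bY bv bt
      have be : υ₁.var .e = c (υ.var .ptr) := by
        rw [bv _ (by simp) (by simp) (by simp)]; simp
      have bptr : υ₁.var .ptr = υ.var .ptr := by
        rw [bv _ (by simp) (by simp) (by simp)]; simp
      simp only [wp_seq, wp_put, wp_set, Expr.safe_vr, Expr.val_vr, Expr.cost_vr, true_and,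
        Expr.safe_add, Expr.safe_cst, Expr.val_cst, Expr.val_add, Expr.cost_add, Expr.cost_cst,
        St.var_tick, St.var_setVar, St.var_setArr, St.arr_tick, St.arr_setVar, St.arr_setArr,
        reduceCtorEq, if_false, if_true, be, bptr, St.time_tick, St.time_setVar, St.time_setArr,
        bx, bY, bA]
      refine ⟨hcs _ hlt, ⟨by omega, by omega⟩, ⟨by omega, by omega, by omega, ?_, hx2, ?_, ?_,
        by omega⟩, by omega⟩
      · intro q h1 h2
        rcases Nat.lt_or_ge q (υ.var .ptr) with h | h
        · exact ics q h1 h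
        · rw [show q = υ.var .ptr by omega]; exact hcond.1
      · intro q h1 h2 h3
        exact hkey _ _ (by omega) (by omega) h2 h3
      · refine imer.op hykey (by simp) ?_
        intro q h1 h2
        rw [Function.update_of_ne]
        intro heq
        have := hcinj (show q < Q by omega) hlt heq
        omega
    · simp only [St.var_tick, St.var_setVar, St.var_setArr, St.arr_tick, St.arr_setVar,
        St.arr_setArr, reduceCtorEq, if_false, St.time_tick, St.time_setVar, St.time_setArr, gptr]
      rw [gptr] at hmer₁
      refine ⟨?_, le_rfl, hp2, hcs1, by omega, ?_, hmer₁, by omega⟩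
      · rw [hy₁, hP i hi]; omega
      · intro q h1 h2 h3
        rw [hy₁]
        exact hnext q h1 h2 h3
  · rintro τ ⟨ζ, hpp, hy, hz, hp1, hp2, hcs1, hx, hnext, hthr, hmer, hdd, ht⟩ -
    have hptr : τ.var .ptr ≤ p + M := by
      by_contra h
      have := hchunk (τ.var .ptr - 1) (hcs1 _ (by omega) (by omega))
      omega
    refine ⟨by simpa using hdd, ζ, by simpa using hz, by simpa using hthr, ?_, by simp; omega⟩
    intro q hqQ hqc
    have hqptr : q < τ.var .ptr := by
      by_contra h
      have h1 := hnext q (by omega) hqQ hqc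
      have h2 := hlast q hqQ hqc
      omega
    have hpq := (hchunk q hqc).1
    have h1 := hmer.ops q hpq hqptr
    have h2 := hcapmul (M + (τ.var .ptr - p)) (by omega)
    exact ⟨by simp only [St.arr_tick]; omega, fun i hi δ hδ => hmer.cmp i hi q hpq hqptr δ hδ⟩

/-! ### Moving the operations of a chunk to their children -/

/-- The words `z` and `dd` and the arrays `parr` and `kc` support the processing of position `p`:
for the children `i < 2 ^ d` of the block of `p`, the threshold `parr i` exceeds the number of live
slots on the left of the child by `δ i`, and in small coordinates the thresholds are `ζ i` and the
keys are `kc`.  Here `δ i` counts the deletions since the start of the chunk, so it is less than the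
length `2 ^ d` of a chunk.  A field of `z` holds `2 ^ (F - 1) - ζ i`, so that the leading bit of the
field of `kc + z + dd` is set if and only if `ζ i ≤ kc + δ i`. -/
def Ready (slot A key : ℕ → ℕ) (s d F Q p z dd : ℕ) (parr kc : ℕ → ℕ) : Prop :=
  let κ : ℕ → ℕ := fun p => slot (A p) / 2 ^ (s + d)
  let M := 2 ^ d
  ∃ ζ δ : ℕ → ℕ, z = pack F (fun i => 2 ^ (F - 1) - ζ i) M ∧ dd = pack F δ M ∧
    (∀ i < M, ζ i ≤ (M + 1) * (2 * M) ∧ δ i ≤ p - chunkStart κ M p ∧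
      parr i = live (deleted (slot ∘ A) p) (κ p * 2 ^ (s + d)) ((κ p * M + i) * 2 ^ s) + δ i) ∧
    ∀ p' < Q, p ≤ p' → chunkStart κ M p' = chunkStart κ M p →
      kc (A p') ≤ (M + 1) * (2 * M) ∧
      ∀ i < M, ∀ k < M + 1, (parr i ≤ key (A p') + k ↔ ζ i ≤ kc (A p') + k)

/-- What the word operations for one position compute.  The children `0, …, j` are those whose first
slot is not on the right of the deleted slot, so the parallel comparison `R` has ones in the fields
`0, …, j` exactly; their number determines the child `j`, the threshold of the child gives the new
key, and the deletion of the slot increases `δ` for the children on the right of `j`. -/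
theorem Ready.step {slot A key : ℕ → ℕ} {s d F Q p z dd : ℕ} {parr kc : ℕ → ℕ}
    (h : Ready slot A key s d F Q p z dd parr kc) (hA : Grouped slot A (s + d) Q)
    (hslot : Set.InjOn slot (Set.Iio Q)) (hp : p < Q) (hF : 0 < F)
    (hsmall : (2 ^ d + 1) * (2 * 2 ^ d) + 2 ^ d < 2 ^ (F - 1))
    (hkey : ∀ t < Q, key t =
      live (deleted slot t) (slot t / 2 ^ (s + d) * 2 ^ (s + d)) (slot t)) :
    let M := 2 ^ d
    let X := kc (A p) * pack F (fun _ => 1) M + z + dd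
    let R := (X / 2 ^ (F - 1)) &&& pack F (fun _ => 1) M
    ∃ j < M, slot (A p) / 2 ^ s = slot (A p) / 2 ^ (s + d) * M + j ∧ X < 2 ^ (F * M) ∧
      R ≤ pack F (fun _ => 1) M ∧ R % (2 ^ F - 1) = j + 1 ∧
      dd / 2 ^ (F * j) % 2 ^ F ≤ parr j ∧
      parr j - dd / 2 ^ (F * j) % 2 ^ F ≤ key (A p) ∧
      key (A p) - (parr j - dd / 2 ^ (F * j) % 2 ^ F) =
        live (deleted slot (A p)) (slot (A p) / 2 ^ s * 2 ^ s) (slot (A p)) ∧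
      dd + (pack F (fun _ => 1) M - R) < 2 ^ (F * M) ∧
      (p + 1 < Q → chunkStart (fun p => slot (A p) / 2 ^ (s + d)) M (p + 1) ≠ p + 1 →
        Ready slot A key s d F Q (p + 1) z (dd + (pack F (fun _ => 1) M - R)) parr kc) := by
  intro M X R
  obtain ⟨ζ, δ, hz, hdd, hi, hcmp⟩ := h
  change z = pack F (fun i => 2 ^ (F - 1) - ζ i) M at hz
  change dd = pack F δ M at hdd
  set κ : ℕ → ℕ := fun p => slot (A p) / 2 ^ (s + d) with hκ
  change ∀ i < M, ζ i ≤ (M + 1) * (2 * M) ∧ δ i ≤ p - chunkStart κ M p ∧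
      parr i = live (deleted (slot ∘ A) p) (κ p * 2 ^ (s + d)) ((κ p * M + i) * 2 ^ s) + δ i at hi
  have hM : 0 < M := by positivity
  have hM2 : M ≤ (M + 1) * (2 * M) := by nlinarith
  have hH : 2 ^ F = 2 * 2 ^ (F - 1) := by rw [← pow_succ']; congr 1; omega
  have hst := sub_chunkStart_lt (κ := κ) hM p
  have hpow : 2 ^ (s + d) = M * 2 ^ s := by rw [pow_add, mul_comm]
  have hAp := hA.lt p hp
  set x := slot (A p) with hx
  have hdiv : κ p = x / 2 ^ s / M := by
    simp only [hκ, Nat.div_div_eq_div_mul, ← pow_add, M]; rfl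
  obtain ⟨j, hj, hxj⟩ : ∃ j < M, x / 2 ^ s = κ p * M + j :=
    ⟨x / 2 ^ s % M, Nat.mod_lt _ hM, by rw [hdiv, mul_comm]; exact (Nat.div_add_mod _ _).symm⟩
  have hxD : x ∉ deleted (slot ∘ A) p := not_mem_deleted hp (hA.slot_injOn hslot)
  have hx0 : κ p * 2 ^ (s + d) ≤ x := Nat.div_mul_le_self _ _
  have hx1 : x < (κ p + 1) * 2 ^ (s + d) := by
    have := Nat.lt_div_mul_add (a := x) (show 0 < 2 ^ (s + d) by positivity)
    rw [add_mul, one_mul]; exact this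
  have hbnd : ∀ i, κ p * 2 ^ (s + d) ≤ (κ p * M + i) * 2 ^ s := fun i => by
    rw [hpow, add_mul, ← mul_assoc]; omega
  have hbnd' : ∀ i < M, (κ p * M + i) * 2 ^ s ≤ (κ p + 1) * 2 ^ (s + d) := fun i hi => by
    rw [hpow, ← mul_assoc]; exact Nat.mul_le_mul_right _ (by rw [add_mul]; omega)
  have hkeyp : key (A p) = live (deleted (slot ∘ A) p) (κ p * 2 ^ (s + d)) x := by
    rw [hkey _ hAp, hA.live_eq hp le_rfl hx1.le]
  have hle : ∀ i, ((κ p * M + i) * 2 ^ s ≤ x ↔ i ≤ j) := fun i => by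
    rw [← Nat.le_div_iff_mul_le (by positivity), hxj]; omega
  have hcmpp := hcmp p hp le_rfl rfl
  set K := kc (A p) with hK
  -- the leading bit of field `i` compares the first slot of child `i` with the deleted slot
  have hbig : ∀ i < M, (2 ^ (F - 1) ≤ K + (2 ^ (F - 1) - ζ i) + δ i ↔ i < j + 1) := by
    intro i hiM
    obtain ⟨h1, h2, h3⟩ := hi i hiM
    have h4 := hcmpp.2 i hiM (δ i) (by omega)
    have h5 := live_le_live_iff (D := deleted (slot ∘ A) p) hxD hx0 (hbnd i)
    have h6 := hle i
    rw [← hkeyp] at h5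
    omega
  have hXp : X = pack F (fun i => K + (2 ^ (F - 1) - ζ i) + δ i) M := by
    simp only [X, hz, hdd, mul_pack, pack_add, mul_one]; rfl
  have hfield : ∀ i < M, K + (2 ^ (F - 1) - ζ i) + δ i < 2 ^ F := by
    intro i hiM
    obtain ⟨h1, h2, h3⟩ := hi i hiM
    have := hcmpp.1
    change K ≤ (M + 1) * (2 * M) at this
    omega
  have hR : R = pack F (fun i => if i < j + 1 then 1 else 0) M := by
    simp only [R, hXp]
    rw [pack_and hF hfield]
    exact pack_congr fun i hiM => by rw [if_congr (hbig i hiM) rfl rfl]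
  have hsub : R + pack F (fun i => if i < j + 1 then 0 else 1) M = pack F (fun _ => 1) M := by
    rw [hR, pack_add]
    exact pack_congr fun i _ => by split_ifs <;> rfl
  have hδF : ∀ i < M, δ i < 2 ^ F := fun i hiM => by have := (hi i hiM).2.1; omega
  have hdd' : dd + (pack F (fun _ => 1) M - R) =
      pack F (fun i => δ i + if i < j + 1 then 0 else 1) M := by
    rw [← hsub, Nat.add_sub_cancel_left, hdd, pack_add]
  have hδj : dd / 2 ^ (F * j) % 2 ^ F = δ j := by rw [hdd, pack_div_mod hδF hj]
  have hparr := (hi j hj).2.2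
  have hxj' : x / 2 ^ s * 2 ^ s = (κ p * M + j) * 2 ^ s := by rw [hxj]
  have hsplit := live_add (D := deleted (slot ∘ A) p) (hbnd j) ((hle j).2 le_rfl)
  have hlast : live (deleted slot (A p)) (x / 2 ^ s * 2 ^ s) x =
      live (deleted (slot ∘ A) p) ((κ p * M + j) * 2 ^ s) x := by
    rw [hxj', ← hA.live_eq hp (hbnd j) hx1.le]
  refine ⟨j, hj, hxj, ?_, by omega, ?_, by omega, by omega, by rw [hδj, hlast]; omega, ?_, ?_⟩
  · rw [hXp]; exact pack_lt hfield
  · rw [hR]; exact pack_indicator_mod (by omega) (by omega)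
  · rw [hdd']
    exact pack_lt fun i hiM => by have := (hi i hiM).2.1; split_ifs <;> omega
  intro hp1 hne
  obtain ⟨hc1, hc2⟩ := chunkStart_succ_of_ne hne
  refine ⟨ζ, fun i => δ i + if i < j + 1 then 0 else 1, hz, hdd', fun i hiM => ?_,
    fun p' h1 h2 h3 => ?_⟩
  · obtain ⟨h1, h2, h3⟩ := hi i hiM
    have hcl := chunkStart_le (κ := κ) (M := M) p
    refine ⟨h1, ?_, ?_⟩
    · change _ ≤ p + 1 - chunkStart κ M (p + 1)
      rw [hc1]; dsimp only; split_ifs <;> omega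
    · change parr i = live (deleted (slot ∘ A) (p + 1)) (κ (p + 1) * 2 ^ (s + d))
        ((κ (p + 1) * M + i) * 2 ^ s) + _
      rw [hc2, deleted_succ]
      have h4 := live_insert (a := κ p * 2 ^ (s + d)) (b := (κ p * M + i) * 2 ^ s) hxD
      have h5 := hle i
      change live (insert x (deleted (slot ∘ A) p)) _ _ + _ = _ at h4
      change parr i = live (insert x (deleted (slot ∘ A) p)) (κ p * 2 ^ (s + d))
        ((κ p * M + i) * 2 ^ s) + (δ i + if i < j + 1 then 0 else 1)
      split_ifs at h4 ⊢ <;> omega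
  · exact hcmp p' h1 (by omega) (h3.trans hc1)

/-- One operation, at position `p`, is moved to the child `c` of its block `v`: the packed word `rr`
holds the comparisons of the key with all thresholds. -/
def descendOne : Stmt :=
  .set .rr (.op .and (.op .shr (.ld .kc (.vr .t) * .vr .ones + .vr .z + .vr .dd)
    (.vr .f - .cst 1)) (.vr .ones)) ;;
  .set .j (.vr .rr % .vr .fm - .cst 1) ;;
  .set .c (.vr .v * .vr .bb + .vr .j) ;;
  .put .node (.vr .t) (.vr .c) ;;
  .put .key (.vr .t) (.ld .key (.vr .t) -
    (.ld .parr (.vr .j) - .op .shr (.vr .dd) (.vr .f * .vr .j) % (.vr .fm + .cst 1))) ;;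
  .put .cnt (.vr .c) (.ld .cnt (.vr .c) - .cst 1) ;;
  .set .dd (.vr .dd + (.vr .ones - .vr .rr))

/-- One operation takes constant time once its chunk is prepared. -/
theorem wp_descendOne {E : Env} {σ : St} {slot A key : ℕ → ℕ} {s d F Q p : ℕ}
    (hR : Ready slot A key s d F Q p (σ.var .z) (σ.var .dd) (σ.arr .parr) (σ.arr .kc))
    (hA : Grouped slot A (s + d) Q) (hslot : Set.InjOn slot (Set.Iio Q)) (hp : p < Q)
    (hF : 1 < F) (hsmall : (2 ^ d + 1) * (2 * 2 ^ d) + 2 ^ d < 2 ^ (F - 1))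
    (hbig : 2 ^ (F * 2 ^ d) < 2 ^ E.w)
    (hkey : ∀ t < Q, key t =
      live (deleted slot t) (slot t / 2 ^ (s + d) * 2 ^ (s + d)) (slot t))
    (ht : σ.var .t = A p) (hv : σ.var .v = slot (A p) / 2 ^ (s + d)) (hbb : σ.var .bb = 2 ^ d)
    (hf : σ.var .f = F) (hfm : σ.var .fm = 2 ^ F - 1)
    (hones : σ.var .ones = pack F (fun _ => 1) (2 ^ d))
    (hkeyp : σ.arr .key (A p) = key (A p)) (hQS : Q < E.stride)
    (hcS : slot (A p) / 2 ^ s < E.stride) (hcnt : 0 < σ.arr .cnt (slot (A p) / 2 ^ s))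
    (hSw : E.stride < 2 ^ E.w) :
    wp E descendOne (fun τ =>
      τ.arr .node = Function.update (σ.arr .node) (A p) (slot (A p) / 2 ^ s) ∧
      τ.arr .key = Function.update (σ.arr .key) (A p)
        (live (deleted slot (A p)) (slot (A p) / 2 ^ s * 2 ^ s) (slot (A p))) ∧
      τ.arr .cnt = Function.update (σ.arr .cnt) (slot (A p) / 2 ^ s)
        (σ.arr .cnt (slot (A p) / 2 ^ s) - 1) ∧
      (p + 1 < Q → chunkStart (fun p => slot (A p) / 2 ^ (s + d)) (2 ^ d) (p + 1) ≠ p + 1 →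
        Ready slot A key s d F Q (p + 1) (τ.var .z) (τ.var .dd) (τ.arr .parr) (τ.arr .kc)) ∧
      τ.time ≤ σ.time + 80) σ := by
  obtain ⟨j, hj, hxj, hX, hRle, hRm, hdle, hdk, hnew, hddlt, hnext⟩ :=
    hR.step hA hslot hp (by omega) hsmall hkey
  have hAp := hA.lt p hp
  set M := 2 ^ d with hM
  have hMpos : 0 < M := by positivity
  set ones := pack F (fun _ => 1) M with hones'
  set X := σ.arr .kc (A p) * ones + σ.var .z + σ.var .dd with hXdef
  set R := X / 2 ^ (F - 1) &&& ones with hRdef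
  have hFM : F * M < 2 ^ (F * M) := Nat.lt_two_pow_self
  have hFj : F * j ≤ F * M := Nat.mul_le_mul_left _ hj.le
  have hF2 : 2 ^ F ≤ 2 ^ (F * M) := Nat.pow_le_pow_right two_pos (Nat.le_mul_of_pos_right F hMpos)
  have hF1 : 1 < 2 ^ F := Nat.one_lt_two_pow (by omega)
  have hfm1 : 2 ^ F - 1 + 1 = 2 ^ F := by omega
  simp only [descendOne, wp_seq, wp_set, wp_put, Expr.safe_vr, Expr.val_vr, Expr.cost_vr,
    Expr.safe_add, Expr.safe_sub, Expr.safe_mul, Expr.safe_mod, Expr.safe_and, Expr.safe_shr,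
    Expr.safe_ld, Expr.safe_cst, Expr.val_add, Expr.val_sub, Expr.val_mul, Expr.val_mod,
    Expr.val_and, Expr.val_shr, Expr.val_ld, Expr.val_cst, Expr.cost_add, Expr.cost_sub,
    Expr.cost_mul, Expr.cost_mod, Expr.cost_op, Expr.cost_ld, Expr.cost_cst, St.var_tick,
    St.var_setVar, St.var_setArr, St.arr_tick, St.arr_setVar, St.arr_setArr, reduceCtorEq,
    if_false, if_true, true_and, and_true, St.time_tick, St.time_setVar, St.time_setArr,
    ht, hv, hbb, hf, hfm, hones, hkeyp, hfm1]
  simp only [← hXdef, ← hRdef, hRm, Nat.add_sub_cancel, ← hxj, hnew, true_and]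
  exact ⟨⟨⟨⟨by omega, by omega⟩, by omega⟩, by omega, by omega⟩, ⟨by omega, by omega⟩,
    ⟨by omega, by omega⟩, by omega, ⟨by omega, ⟨by omega, by omega, hdle⟩, hdk⟩,
    by omega, ⟨hcS, by omega, hcnt⟩, hcS, ⟨hRle, by omega⟩, hnext, by omega⟩

/-- All operations, in the order `A` and by chunks, are moved to the children of their blocks. -/
def descend : Stmt :=
  .count .p (.cst 0) .q (
    .set .t (.ld .oA (.vr .p)) ;; .set .v (.ld .node (.vr .t)) ;;
    .ite (.op .eq (.ld .cid (.vr .t)) (.vr .p)) setup .skip ;; descendOne)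

/-- When a chunk starts, `cnt` holds the numbers of live slots of the children at that moment;
operations in other blocks do not matter, so the order `A` may replace the order of time.
Here `c` lists the operations by chunks and, inside a chunk, by their keys. -/
theorem wp_descend {E : Env} {σ : St} {slot A c : ℕ → ℕ} {s d F Q V : ℕ}
    (hq : σ.var .q = Q) (hbb : σ.var .bb = 2 ^ d) (hcap : σ.var .cap = 2 ^ d + 1)
    (hf : σ.var .f = F) (hh : σ.var .h = 2 ^ (F - 1)) (hfm : σ.var .fm = 2 ^ F - 1)
    (hones : σ.var .ones = pack F (fun _ => 1) (2 ^ d))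
    (hQS : Q < E.stride) (hF : 1 < F) (hSw : 4 * E.stride + 4 < 2 ^ E.w)
    (hsmall : (2 ^ d + 1) * (2 * 2 ^ d) + 2 ^ d < 2 ^ (F - 1))
    (hbig : 2 ^ (F * 2 ^ d) < 2 ^ E.w)
    (hA : Grouped slot A (s + d) Q) (hslot : Set.InjOn slot (Set.Iio Q))
    (hV : ∀ t < Q, slot t < V * 2 ^ (s + d)) (hVS : V * 2 ^ (s + d) ≤ E.stride)
    (hoA : ∀ p < Q, σ.arr .oA p = A p) (hoC : ∀ q < Q, σ.arr .oC q = c q)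
    (hcQ : ∀ q < Q, c q < Q) (hcsurj : ∀ t < Q, ∃ q < Q, c q = t)
    (hcinj : Set.InjOn c (Set.Iio Q))
    (hcidA : ∀ p < Q, σ.arr .cid (A p) = chunkStart (fun p => slot (A p) / 2 ^ (s + d)) (2 ^ d) p)
    (hcidc : ∀ q < Q, σ.arr .cid (c q) = chunkStart (fun p => slot (A p) / 2 ^ (s + d)) (2 ^ d) q)
    (hsort : ∀ q q', q < q' → q' < Q → σ.arr .cid (c q) = σ.arr .cid (c q') →
      σ.arr .key (c q) ≤ σ.arr .key (c q'))
    (hnode : ∀ t < Q, σ.arr .node t = slot t / 2 ^ (s + d))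
    (hkey : ∀ t < Q, σ.arr .key t =
      live (deleted slot t) (slot t / 2 ^ (s + d) * 2 ^ (s + d)) (slot t))
    (hcnt : ∀ i < V * 2 ^ d, σ.arr .cnt i = 2 ^ s) :
    wp E descend (fun τ =>
      (∀ t < Q, τ.arr .node t = slot t / 2 ^ s ∧
        τ.arr .key t = live (deleted slot t) (slot t / 2 ^ s * 2 ^ s) (slot t)) ∧
      τ.time ≤ σ.time + 20 + 120 * Q + (180 * 2 ^ d + 40) *
        chunks (fun p => slot (A p) / 2 ^ (s + d)) (2 ^ d) Q) σ := by
  set κ : ℕ → ℕ := fun p => slot (A p) / 2 ^ (s + d) with hκ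
  set M := 2 ^ d with hM
  have hMpos : 0 < M := by positivity
  have hpow : 2 ^ (s + d) = M * 2 ^ s := by rw [pow_add, mul_comm]
  have hVM : V * M ≤ E.stride := by
    refine le_trans ?_ hVS
    rw [hpow]
    exact Nat.mul_le_mul_left _ (Nat.le_mul_of_pos_right _ (by positivity))
  have hκV : ∀ p < Q, κ p < V := fun p hp =>
    Nat.div_lt_of_lt_mul (by rw [mul_comm]; exact hV _ (hA.lt p hp))
  have hVpos : ∀ p < Q, (κ p + 1) * 2 ^ (s + d) ≤ E.stride := fun p hp =>
    (Nat.mul_le_mul_right _ (hκV p hp)).trans hVS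
  refine wp_count (x := .p) (hi := .q)
    (fun p τ =>
      (∀ p' < p, τ.arr .node (A p') = slot (A p') / 2 ^ s ∧
        τ.arr .key (A p') =
          live (deleted slot (A p')) (slot (A p') / 2 ^ s * 2 ^ s) (slot (A p'))) ∧
      (∀ p' < Q, p ≤ p' → τ.arr .node (A p') = slot (A p') / 2 ^ (s + d) ∧
        τ.arr .key (A p') = σ.arr .key (A p')) ∧
      (∀ i < V * M, τ.arr .cnt i =
        live (deleted (slot ∘ A) p) (i * 2 ^ s) ((i + 1) * 2 ^ s)) ∧
      (p < Q → chunkStart κ M p ≠ p →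
        Ready slot A (σ.arr .key) s d F Q p (τ.var .z) (τ.var .dd) (τ.arr .parr) (τ.arr .kc)) ∧
      τ.time ≤ σ.time + 10 + 120 * p + (180 * M + 40) * chunks κ M p) 0 Q
    (by simp [setup, advance, descendOne]) (by simp [setup, advance, descendOne]) (by simp)
    (by simp) (by simp) (by simp) hq (by omega) ?_ ?_ ?_
  · refine ⟨by simp, fun p' h _ => ⟨by simp [hnode _ (hA.lt p' h)], by simp⟩, fun i hi => ?_,
      fun _ h => absurd rfl h, by simp [chunks]⟩
    simp [hcnt i hi, deleted, live_empty, add_mul]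
  · rintro p τ - hp ⟨hdone, htodo, hcn, hready, htime⟩ hvp hvq hfv hfa
    have hAp := hA.lt p hp
    have hxD : slot (A p) ∉ deleted (slot ∘ A) p := not_mem_deleted hp (hA.slot_injOn hslot)
    set x := slot (A p) with hx
    have hκp : κ p = x / 2 ^ (s + d) := rfl
    have hchunks : chunks κ M (p + 1) =
      chunks κ M p + if chunkStart κ M p = p then 1 else 0 := rfl
    have hiV : x / 2 ^ s < V * M := by
      apply Nat.div_lt_of_lt_mul
      have := hV _ hAp
      rw [hpow] at this
      rw [mul_comm]; rwa [mul_assoc]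
    have hx0 : x / 2 ^ s * 2 ^ s ≤ x := Nat.div_mul_le_self _ _
    have hx1 : x < (x / 2 ^ s + 1) * 2 ^ s := by
      have := Nat.lt_div_mul_add (a := x) (show 0 < 2 ^ s by positivity)
      rw [add_mul, one_mul]; exact this
    have hcntpos : 0 < τ.arr .cnt (x / 2 ^ s) := by
      rw [hcn _ hiV]
      exact live_pos hxD hx0 hx1
    have fv : ∀ y, y = .q ∨ y = .bb ∨ y = .cap ∨ y = .f ∨ y = .h ∨ y = .fm ∨ y = .ones →
        τ.var y = σ.var y := by
      intro y hy
      rcases hy with rfl | rfl | rfl | rfl | rfl | rfl | rfl <;>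
        exact hfv _ (by simp) (by simp [setup, advance, descendOne])
    have fa : ∀ a, a = .oA ∨ a = .oC ∨ a = .cid → τ.arr a = σ.arr a := by
      intro a ha
      rcases ha with rfl | rfl | rfl <;> exact hfa _ (by simp [setup, advance, descendOne])
    simp only [wp_seq, wp_set, wp_ite, Expr.safe_ld, Expr.safe_vr, Expr.val_ld, Expr.val_vr,
      Expr.safe_eq, Expr.val_eq, St.var_tick, St.var_setVar, St.arr_tick, St.arr_setVar,
      reduceCtorEq, if_false, if_true, true_and, and_true, Expr.cost_ld, Expr.cost_op,
      Expr.cost_vr, hvp, fa .oA (by simp), hoA p hp, (htodo p hp le_rfl).1,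
      fa .cid (by simp), hcidA p hp, wp_skip]
    refine ⟨by omega, by omega, by omega, ?_⟩
    -- the state before `descendOne`
    have hrest : ∀ υ : St, υ.var .t = A p → υ.var .v = x / 2 ^ (s + d) →
        (∀ y, y = .bb ∨ y = .f ∨ y = .fm ∨ y = .ones → υ.var y = σ.var y) →
        (∀ a, a ≠ .parr → a ≠ .kc → υ.arr a = τ.arr a) →
        Ready slot A (σ.arr .key) s d F Q p (υ.var .z) (υ.var .dd) (υ.arr .parr) (υ.arr .kc) →
        υ.time ≤ σ.time + 10 + 120 * p + (180 * M + 40) * chunks κ M (p + 1) + 35 →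
        wp E descendOne (fun υ =>
          (fun p τ => (∀ p' < p, τ.arr .node (A p') = slot (A p') / 2 ^ s ∧
            τ.arr .key (A p') =
              live (deleted slot (A p')) (slot (A p') / 2 ^ s * 2 ^ s) (slot (A p'))) ∧
          (∀ p' < Q, p ≤ p' → τ.arr .node (A p') = slot (A p') / 2 ^ (s + d) ∧
            τ.arr .key (A p') = σ.arr .key (A p')) ∧
          (∀ i < V * M, τ.arr .cnt i =
            live (deleted (slot ∘ A) p) (i * 2 ^ s) ((i + 1) * 2 ^ s)) ∧
          (p < Q → chunkStart κ M p ≠ p →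
            Ready slot A (σ.arr .key) s d F Q p (τ.var .z) (τ.var .dd) (τ.arr .parr)
              (τ.arr .kc)) ∧
          τ.time ≤ σ.time + 10 + 120 * p + (180 * M + 40) * chunks κ M p) (p + 1)
          ((υ.setVar .p (p + 1)).tick 5)) υ := by
      intro υ ut uv uvars uarrs uR utime
      refine wp_mono (wp_descendOne uR hA hslot hp hF hsmall hbig hkey ut uv
        ((uvars _ (by simp)).trans hbb) ((uvars _ (by simp)).trans hf)
        ((uvars _ (by simp)).trans hfm) ((uvars _ (by simp)).trans hones) ?_ hQS
        (hiV.trans_le hVM) ?_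
        (by omega)) ?_
      · rw [uarrs _ (by simp) (by simp)]; exact (htodo p hp le_rfl).2
      · rw [uarrs _ (by simp) (by simp)]; exact hcntpos
      rintro χ ⟨hχn, hχk, hχc, hχR, hχt⟩
      rw [uarrs _ (by simp) (by simp)] at hχn hχk
      rw [uarrs .cnt (by simp) (by simp)] at hχc
      simp only [St.arr_tick, St.arr_setVar, St.var_tick, St.var_setVar, reduceCtorEq, if_false,
        St.time_tick, St.time_setVar, hχn, hχk, hχc]
      refine ⟨fun p' h => ?_, fun p' h1 h2 => ?_, fun i hi => ?_, hχR, by omega⟩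
      · rcases Nat.lt_or_ge p' p with h' | h'
        · have hne : A p' ≠ A p := fun h =>
            absurd (hA.injOn (show p' < Q by omega) hp h) (by omega)
          rw [Function.update_of_ne hne, Function.update_of_ne hne]
          exact hdone p' h'
        · obtain rfl : p' = p := by omega
          simp [hx]
      · have hne : A p' ≠ A p := fun h => absurd (hA.injOn h1 hp h) (by omega)
        rw [Function.update_of_ne hne, Function.update_of_ne hne]
        exact htodo p' h1 (by omega)
      · rw [deleted_succ, Function.update_apply]
        have h4 := live_insert (a := i * 2 ^ s) (b := (i + 1) * 2 ^ s) hxD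
        change live (insert x (deleted (slot ∘ A) p)) _ _ + _ = _ at h4
        change _ = live (insert x (deleted (slot ∘ A) p)) (i * 2 ^ s) ((i + 1) * 2 ^ s)
        have h5 : i = x / 2 ^ s ↔ (i * 2 ^ s ≤ x ∧ x < (i + 1) * 2 ^ s) := by
          constructor
          · rintro rfl; exact ⟨hx0, hx1⟩
          · rintro ⟨h1, h2⟩; exact (Nat.div_eq_of_lt_le h1 h2).symm
        rw [if_congr h5.symm rfl rfl] at h4
        have h6 := hcn i hi
        split_ifs at h4 ⊢ with h7
        · rw [← h7]; omega
        · omega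
    by_cases hst : chunkStart κ M p = p
    swap
    · simp only [hst, if_false, if_true]
      refine hrest _ (by simp) (by simp [hx]) ?_ (by simp) (by simpa using hready hp hst)
        (by simp [hchunks, hst]; omega)
      rintro y (rfl | rfl | rfl | rfl) <;> simp [fv]
    · simp only [hst, if_true, one_ne_zero, if_false]
      have hmul : (180 * M + 40) * chunks κ M (p + 1) =
          (180 * M + 40) * chunks κ M p + (180 * M + 40) := by
        rw [hchunks, if_pos hst]; ring
      -- a position of the chunk in the order `c` is an unprocessed position
      have hpos : ∀ q < Q, chunkStart κ M q = p →
          ∃ p' < Q, p ≤ p' ∧ A p' = c q ∧ chunkStart κ M p' = p := by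
        intro q hqQ hqc
        obtain ⟨p', h1, h2⟩ := hA.surj _ (hcQ q hqQ)
        have h3 := hcidA p' h1
        rw [h2, hcidc q hqQ, hqc] at h3
        exact ⟨p', h1, by have := chunkStart_le (κ := κ) (M := M) p'; omega, h2, h3.symm⟩
      have hkeyc : ∀ q < Q, chunkStart κ M q = p → τ.arr .key (c q) = σ.arr .key (c q) := by
        intro q hqQ hqc
        obtain ⟨p', h1, h2, h3, h4⟩ := hpos q hqQ hqc
        rw [← h3]; exact (htodo p' h1 h2).2
      set P : ℕ → ℕ := fun i =>
        live (deleted (slot ∘ A) p) (κ p * 2 ^ (s + d)) ((κ p * M + i) * 2 ^ s) with hP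
      have hbase : κ p * 2 ^ (s + d) = (κ p * M) * 2 ^ s := by rw [hpow, mul_assoc]
      have htop : (κ p * M + M) * 2 ^ s = (κ p + 1) * 2 ^ (s + d) := by rw [hpow]; ring
      refine wp_frame _ (wp_setup (Q := Q) (M := M) (p := p) (v := κ p) (F := F) (κ := κ) (c := c)
        (P := P) (by simp [fv, hq]) (by simp [fv, hbb]) (by simp [fv, hcap]) (by simp [fv, hf])
        (by simp [fv, hh]) (by simp [hvp]) (by simp [hκ, hx]) hMpos hp hQS ?_ (by omega) hbig
        (by omega) hSw ?_ (fun q h => (hcQ q h).trans hQS) hcinj ?_ hst ?_ ?_ ?_ ?_ ?_ ?_) ?_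
      · exact (Nat.le_mul_of_pos_left M (Nat.zero_lt_of_lt (hκV p hp))).trans hVM
      · intro q hqQ; simp [fa, hoC q hqQ]
      · intro q hqQ; simp [fa, hcidc q hqQ]
      · intro q q' h1 h2 h3 h4
        have h5 : chunkStart κ M q = p := by
          have a1 := chunkStart_mono (κ := κ) (M := M) h1
          have a2 := chunkStart_mono (κ := κ) (M := M) h2.le
          omega
        simp only [St.arr_tick, St.arr_setVar]
        rw [hkeyc q (by omega) h5, hkeyc q' h3 h4]
        exact hsort q q' h2 h3 (by rw [hcidc q (by omega), hcidc q' h3, h4, h5])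
      · simp only [hP, add_zero, hbase, live_self]
      · intro i hi
        simp only [hP, St.arr_tick, St.arr_setVar]
        have hi' : κ p * M + i < V * M := by
          have := Nat.mul_le_mul_right M (hκV p hp)
          rw [Nat.succ_mul] at this; omega
        rw [hcn _ hi', live_add (by rw [hbase]; exact Nat.mul_le_mul_right _ (by omega))
          (Nat.mul_le_mul_right _ (by omega)), add_assoc]
      · refine (live_le).trans ((Nat.sub_le _ _).trans ?_)
        rw [htop]; exact hVpos p hp
      · exact (Nat.mul_le_mul_right M (hκV p hp)).trans hVM
      · intro q hqQ hqc
        simp only [St.arr_tick, St.arr_setVar]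
        rw [hkeyc q hqQ hqc]
        obtain ⟨p', h1, h2, h3, h4⟩ := hpos q hqQ hqc
        have hκ' : κ p' = κ p := by
          rw [← key_chunkStart (κ := κ) (M := M) p', h4]
        have hlt : slot (A p') < (κ p' + 1) * 2 ^ (s + d) := by
          have := Nat.lt_div_mul_add (a := slot (A p')) (show 0 < 2 ^ (s + d) by positivity)
          rw [add_mul, one_mul]; exact this
        have hge : κ p' * 2 ^ (s + d) ≤ slot (A p') := Nat.div_mul_le_self _ _
        rw [← h3, hkey _ (hA.lt p' h1), ← hA.live_eq h1 le_rfl hlt.le]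
        change live _ (κ p' * 2 ^ (s + d)) _ < _
        have hD : deleted (slot ∘ A) p ⊆ deleted (slot ∘ A) p' :=
          Finset.image_subset_image (Finset.range_mono h2)
        refine lt_of_le_of_lt (live_anti hD _ _) ?_
        simp only [hP, htop]
        rw [← hκ', ← live_add hge hlt.le]
        exact Nat.lt_add_of_pos_right (live_pos
          (fun h => not_mem_deleted h1 (hA.slot_injOn hslot) (hD h)) le_rfl hlt)
      · rintro χ hfr ⟨hdd, ζ, hz, hthr, hops, ht⟩
        refine hrest _ ?_ ?_ ?_ ?_ ?_ ?_
        · simpa [setup, advance] using hfr.1 .t (by simp [setup, advance])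
        · simpa [setup, advance] using hfr.1 .v (by simp [setup, advance])
        · rintro y (rfl | rfl | rfl | rfl) <;>
          · rw [St.var_tick, hfr.1 _ (by simp [setup, advance])]; simp [fv]
        · intro a h1 h2
          rw [St.arr_tick, hfr.2 _ (by simp [setup, advance, h1, h2])]; simp
        · refine ⟨ζ, fun _ => 0, by simpa using hz, by simp [hdd, pack], fun i hi => ?_,
            fun p' h1 h2 h3 => ?_⟩
          · obtain ⟨a1, a2⟩ := hthr i hi
            exact ⟨a2, Nat.zero_le _, by simpa using a1⟩
          · obtain ⟨q, hqQ, hqc⟩ := hcsurj _ (hA.lt p' h1)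
            have hqp : chunkStart κ M q = p := by
              rw [← hcidc q hqQ, hqc, hcidA p' h1]; exact h3.trans hst
            have := hops q hqQ hqp
            simp only [St.arr_tick, St.arr_setVar] at this
            rw [hkeyc q hqQ hqp, hqc] at this
            refine ⟨this.1, fun i hi k hk => ?_⟩
            rw [St.arr_tick, (hthr i hi).1]
            exact this.2 i hi k hk
        · simp only [St.time_tick, St.time_setVar] at ht ⊢
          omega
  · rintro τ ⟨hdone, -, -, -, ht⟩ -
    refine ⟨fun t h => ?_, by simp; omega⟩
    obtain ⟨p, hp, rfl⟩ := hA.surj t h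
    simpa using hdone p hp

/-! ### One level of the descent -/

/-- The chunks of the order `oA` are marked in `cid` by their first positions. -/
def markChunks : Stmt :=
  .set .cs (.cst 0) ;; .set .cv (.ld .node (.ld .oA (.cst 0))) ;;
  .count .p (.cst 0) .q (
    .set .t (.ld .oA (.vr .p)) ;; .set .v (.ld .node (.vr .t)) ;;
    .ite (.op .eq (.vr .v) (.vr .cv))
      (.ite (.op .eq (.vr .p - .vr .cs) (.vr .bb)) (.set .cs (.vr .p)) .skip)
      (.set .cs (.vr .p) ;; .set .cv (.vr .v)) ;;
    .put .cid (.vr .t) (.vr .cs))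

theorem wp_markChunks {E : Env} {σ : St} {A κ : ℕ → ℕ} {M Q : ℕ} (hq : σ.var .q = Q)
    (hbb : σ.var .bb = M) (hM : 0 < M) (hQ : 0 < Q) (hQS : Q < E.stride)
    (hSw : E.stride + 4 < 2 ^ E.w) (hoA : ∀ p < Q, σ.arr .oA p = A p) (hAQ : ∀ p < Q, A p < Q)
    (hinj : Set.InjOn A (Set.Iio Q)) (hnode : ∀ p < Q, σ.arr .node (A p) = κ p) :
    wp E markChunks (fun τ => (∀ p < Q, τ.arr .cid (A p) = chunkStart κ M p) ∧
      τ.time ≤ σ.time + 50 * Q + 30) σ := by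
  simp only [markChunks, wp_seq, wp_set, Expr.safe_cst, Expr.val_cst, Expr.safe_ld, Expr.val_ld,
    St.arr_tick, St.arr_setVar, true_and, hoA 0 hQ, hnode 0 hQ, Expr.cost_ld, Expr.cost_cst]
  refine ⟨by omega, ⟨⟨by omega, by omega⟩, (hAQ 0 hQ).trans hQS⟩, ?_⟩
  refine wp_count (x := .p) (hi := .q) (fun p τ => τ.var .cs = chunkStart κ M (p - 1) ∧
    τ.var .cv = κ (p - 1) ∧ (∀ p' < p, τ.arr .cid (A p') = chunkStart κ M p') ∧
    τ.time ≤ σ.time + 20 + 50 * p) 0 Q (by simp) (by simp) (by simp) (by simp) (by simp)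
    (by simp) (by simpa using hq) (by omega) ?_ ?_ ?_
  · simp [chunkStart]
  · rintro p τ - hp ⟨hcs, hcv, hdone, ht⟩ hvp hvq hfv hfa
    have f1 : τ.arr .oA = σ.arr .oA := by simpa using hfa .oA (by simp)
    have f2 : τ.arr .node = σ.arr .node := by simpa using hfa .node (by simp)
    have f3 : τ.var .bb = M := by rw [hfv .bb (by simp) (by simp)]; simpa using hbb
    have hle : chunkStart κ M (p - 1) ≤ p := (chunkStart_le _).trans (by omega)
    have hAp := hAQ p hp
    simp only [wp_seq, wp_set, wp_put, wp_ite, wp_skip, Expr.safe_ld, Expr.safe_vr, Expr.val_ld,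
      Expr.val_vr, Expr.safe_eq, Expr.val_eq, Expr.safe_sub, Expr.val_sub, St.var_tick,
      St.var_setVar, St.arr_tick, St.arr_setVar, St.arr_setArr, St.var_setArr, reduceCtorEq,
      if_false, if_true, true_and, and_true, Expr.cost_ld, Expr.cost_op, Expr.cost_vr,
      Expr.cost_sub, hvp, f1, f2, f3, hoA p hp, hnode p hp, hcs, hcv, St.time_tick,
      St.time_setVar, St.time_setArr, Nat.add_sub_cancel]
    have hcid : ∀ C, C = chunkStart κ M p → ∀ p' < p + 1,
        Function.update (τ.arr .cid) (A p) C (A p') = chunkStart κ M p' := by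
      intro C hC p' h
      rcases Nat.lt_or_ge p' p with h' | h'
      · rw [Function.update_of_ne fun h => absurd (hinj (show p' < Q by omega) hp h) (by omega)]
        exact hdone p' h'
      · obtain rfl : p' = p := by omega
        rw [Function.update_self, hC]
    refine ⟨by omega, by omega, ?_⟩
    have hzero : p = 0 → chunkStart κ M p = 0 := by rintro rfl; rfl
    have hsucc : p ≠ 0 → chunkStart κ M p = if κ p = κ (p - 1) ∧ p - chunkStart κ M (p - 1) ≠ M
        then chunkStart κ M (p - 1) else p := by
      intro h
      obtain ⟨p, rfl⟩ := Nat.exists_eq_succ_of_ne_zero h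
      rfl
    by_cases h1 : κ p = κ (p - 1)
    · by_cases h2 : p - chunkStart κ M (p - 1) = M
      · simp only [h1, h2, if_true, one_ne_zero, if_false, hvp, true_and]
        have h3 : chunkStart κ M p = p := by
          rw [hsucc (by rintro rfl; omega), if_neg (by tauto)]
        exact ⟨hle, by omega, h3.symm, hcid _ h3.symm, by omega⟩
      · simp only [h1, h2, if_true, one_ne_zero, if_false, hvp, hcs, hcv, true_and]
        have h3 : chunkStart κ M p = chunkStart κ M (p - 1) := by
          by_cases h0 : p = 0
          · rw [h0]
          · rw [hsucc h0, if_pos ⟨h1, h2⟩]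
        exact ⟨hle, by omega, h3.symm, hcid _ h3.symm, by omega⟩
    · simp only [h1, if_true, one_ne_zero, if_false, hvp, true_and]
      have h3 : chunkStart κ M p = p := by
        rw [hsucc (by rintro rfl; exact h1 rfl), if_neg (by tauto)]
      exact ⟨by omega, h3.symm, hcid _ h3.symm, by omega⟩
  · rintro τ ⟨-, -, hdone, ht⟩ -
    exact ⟨by simpa using hdone, by simp; omega⟩

/-! ### Orders computed by counting sort -/

section
variable {Q : ℕ} {l : List ℕ}

theorem lt_of_perm_range (h : l.Perm (List.range Q)) {p : ℕ} (hp : p < Q) : l.getD p 0 < Q := by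
  have hl : l.length = Q := by simpa using h.length_eq
  rw [List.getD_eq_getElem _ _ (by omega)]
  exact List.mem_range.1 (h.mem_iff.1 (List.getElem_mem _))

theorem exists_of_perm_range (h : l.Perm (List.range Q)) {t : ℕ} (ht : t < Q) :
    ∃ p < Q, l.getD p 0 = t := by
  have hl : l.length = Q := by simpa using h.length_eq
  obtain ⟨p, hp, hpt⟩ := List.getElem_of_mem (h.mem_iff.2 (List.mem_range.2 ht))
  exact ⟨p, by omega, by rw [List.getD_eq_getElem _ _ hp, hpt]⟩

theorem injOn_of_perm_range (h : l.Perm (List.range Q)) :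
    Set.InjOn (fun p => l.getD p 0) (Set.Iio Q) := by
  have hl : l.length = Q := by simpa using h.length_eq
  intro p hp q hq hpq
  simp only [Set.mem_Iio] at hp hq
  dsimp only at hpq
  rw [List.getD_eq_getElem _ _ (by omega), List.getD_eq_getElem _ _ (by omega)] at hpq
  exact ((h.nodup_iff.2 List.nodup_range).getElem_inj_iff).1 hpq

theorem rel_of_pairwise {R : ℕ → ℕ → Prop} (h : l.Pairwise R) {p q : ℕ} (hpq : p < q)
    (hq : q < l.length) : R (l.getD p 0) (l.getD q 0) := by
  rw [List.getD_eq_getElem _ _ (by omega), List.getD_eq_getElem _ _ hq]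
  exact List.pairwise_iff_getElem.1 h p q _ hq hpq

/-- Two orders that are sorted with respect to `κ` have the same sequence of values of `κ`. -/
theorem eq_of_perm_of_pairwise {l' : List ℕ} {κ : ℕ → ℕ} (h : l.Perm l')
    (h₁ : l.Pairwise fun x y => κ x ≤ κ y) (h₂ : l'.Pairwise fun x y => κ x ≤ κ y) {p : ℕ} :
    κ (l.getD p 0) = κ (l'.getD p 0) := by
  have : l.map κ = l'.map κ :=
    (h.map κ).eq_of_pairwise (fun _ _ _ _ => le_antisymm) (List.pairwise_map.2 h₁)
      (List.pairwise_map.2 h₂)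
  have h3 := congrArg (fun l : List ℕ => l.getD p (κ 0)) this
  simpa [List.getD_eq_getElem?_getD] using h3

end

/-- Sorting an order of the numbers below `Q`. -/
theorem wp_sortBy_range {E : Env} {key inp out : Arr} {σ : St} {Q U : ℕ} {l : List ℕ}
    (h1 : key ≠ .cN) (h2 : inp ≠ .cN) (h3 : out ≠ .cN) (h4 : key ≠ out) (h5 : inp ≠ out)
    (hperm : l.Perm (List.range Q)) (hl : ∀ p < Q, σ.arr inp p = l.getD p 0) (hq : σ.var .q = Q)
    (hu : σ.var .u = U) (hκ : ∀ x < Q, σ.arr key x < U) (hQ : Q < E.stride) (hU : U ≤ E.stride)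
    (hw : E.stride + 1 < 2 ^ E.w) :
    wp E (sortBy key inp out) (fun τ => (sortBy key inp out).Frame σ τ ∧
      (bucketSort (σ.arr key) U l).Perm (List.range Q) ∧
      (∀ p < Q, τ.arr out p = (bucketSort (σ.arr key) U l).getD p 0) ∧
      τ.time ≤ σ.time + sortTime Q U) σ := by
  have hlen : l.length = Q := by simpa using hperm.length_eq
  have hmem : ∀ x ∈ l, x < Q := fun x hx => List.mem_range.1 (hperm.mem_iff.1 hx)
  have hp : (bucketSort (σ.arr key) U l).Perm (List.range Q) :=
    (bucketSort_perm fun x hx => hκ x (hmem x hx)).trans hperm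
  refine wp_frame _ (wp_sortBy h1 h2 h3 h4 h5 l U (fun i hi => ?_) (by rw [hq, hlen]) hu
    (fun x hx => hκ x (hmem x hx)) (fun x hx => (hmem x hx).trans hQ) (by omega) hU hw) ?_
  · rw [hl i (by omega), List.getD_eq_getElem]
  · rintro τ hf ⟨ho, -, ht⟩
    refine ⟨hf, hp, fun p hpQ => ?_, hlen ▸ ht⟩
    have hlen' : (bucketSort (σ.arr key) U l).length = Q := by simpa using hp.length_eq
    rw [ho p (by omega), List.getD_eq_getElem]

/-- One level of the descent: the operations move from blocks of `2 ^ s` slots to blocks of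
`2 ^ (s - d)` slots, where `d = min bt s`. -/
def level : Stmt :=
  .ite (.op .lt (.vr .bt) (.vr .s)) (.set .d (.vr .bt)) (.set .d (.vr .s)) ;;
  .set .s2 (.vr .s - .vr .d) ;;
  .set .bb (.op .shl (.cst 1) (.vr .d)) ;; .set .cap (.vr .bb + .cst 1) ;;
  .set .ones ((.op .shl (.cst 1) (.vr .f * .vr .bb) - .cst 1) / .vr .fm) ;;
  .set .w (.op .shl (.cst 1) (.vr .s2)) ;;
  .set .u (.op .shr (.vr .nn) (.vr .s2)) ;;
  .count .i (.cst 0) .u (.put .cnt (.vr .i) (.vr .w)) ;;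
  .set .u (.op .shr (.vr .nn) (.vr .s)) ;; sortBy .node .idn .oA ;; markChunks ;;
  .set .u (.vr .nn) ;; sortBy .key .idn .oK ;;
  .set .u (.vr .q) ;; sortBy .cid .oK .oC ;;
  descend ;; .set .s (.vr .s2)

/-- The state before a level: the operation `t` has reached the block of `2 ^ s` slots that
contains `slot t`, and `key` is the number of live slots of this block on the left of `slot t`. -/
structure AtLevel (slot : ℕ → ℕ) (Q β F s : ℕ) (σ : St) : Prop where
  q : σ.var .q = Q
  nn : σ.var .nn = 2 * Q
  bt : σ.var .bt = β
  f : σ.var .f = F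
  h : σ.var .h = 2 ^ (F - 1)
  fm : σ.var .fm = 2 ^ F - 1
  lev : σ.var .s = s
  idn : ∀ t < Q, σ.arr .idn t = t
  node : ∀ t < Q, σ.arr .node t = slot t / 2 ^ s
  key : ∀ t < Q, σ.arr .key t = live (deleted slot t) (slot t / 2 ^ s * 2 ^ s) (slot t)

set_option maxHeartbeats 1000000 in
/-- A level takes time `O(Q)`: three counting sorts, and `O(2 ^ d)` for each chunk, of which there
are at most `Q / 2 ^ d` and one for each block. -/
theorem wp_level {E : Env} {σ : St} {slot : ℕ → ℕ} {Q β F b s : ℕ} (h : AtLevel slot Q β F s σ)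
    (hb : 2 ^ b = 2 * Q) (hs : 0 < s) (hsb : s ≤ b)
    (hQS : 2 * Q ≤ E.stride) (hF : 1 < F) (hSw : 4 * E.stride + 4 < 2 ^ E.w)
    (hsmall : (2 ^ β + 1) * (2 * 2 ^ β) + 2 ^ β < 2 ^ (F - 1)) (hbig : 2 ^ (F * 2 ^ β) < 2 ^ E.w)
    (hslot : Set.InjOn slot (Set.Iio Q)) (hlt : ∀ t < Q, slot t < 2 * Q) :
    wp E level (fun τ => AtLevel slot Q β F (s - min β s) τ ∧
      τ.time ≤ σ.time + 1400 * Q + 400) σ := by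
  have hQ : 0 < Q := by
    have : 0 < 2 ^ b := by positivity
    omega
  obtain ⟨d, hd⟩ : ∃ d, min β s = d := ⟨_, rfl⟩
  obtain ⟨s', hs'⟩ : ∃ s', s - d = s' := ⟨_, rfl⟩
  have hds : d ≤ s := by omega
  have hdβ : d ≤ β := by omega
  have hss : s = s' + d := by omega
  rw [hd, hs']
  subst hss
  set M := 2 ^ d with hM
  have hMpos : 0 < M := by positivity
  have hMβ : M ≤ 2 ^ β := Nat.pow_le_pow_right two_pos hdβ
  obtain ⟨V, hV⟩ : ∃ V, V = 2 ^ (b - (s' + d)) := ⟨_, rfl⟩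
  have hVs : V * 2 ^ (s' + d) = 2 * Q := by rw [hV, ← pow_add, ← hb]; congr 1; omega
  have hVpos : 0 < V := by rw [hV]; positivity
  have hVdiv : 2 * Q / 2 ^ (s' + d) = V := by
    rw [← hVs]; exact Nat.mul_div_cancel _ (by positivity)
  have hpow : 2 ^ (s' + d) = M * 2 ^ s' := by rw [pow_add, mul_comm]
  have hVdiv' : 2 * Q / 2 ^ s' = V * M := by
    rw [← hVs, hpow, ← mul_assoc]; exact Nat.mul_div_cancel _ (by positivity)
  have hVM : V * M ≤ 2 * Q := by rw [← hVdiv']; exact Nat.div_le_self _ _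
  have hVQ : V ≤ 2 * Q := (Nat.le_mul_of_pos_right V hMpos).trans hVM
  have hMQ : M ≤ 2 * Q := (Nat.le_mul_of_pos_left M hVpos).trans hVM
  have hsQ : 2 ^ s' ≤ 2 * Q := by
    rw [← hb]; exact Nat.pow_le_pow_right two_pos (by omega)
  have hFM : 2 ^ (F * M) < 2 ^ E.w :=
    lt_of_le_of_lt (Nat.pow_le_pow_right two_pos (Nat.mul_le_mul_left _ hMβ)) hbig
  have hFM' : F * M < 2 ^ (F * M) := Nat.lt_two_pow_self
  have hsmallM : (M + 1) * (2 * M) + M < 2 ^ (F - 1) :=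
    lt_of_le_of_lt (by gcongr) hsmall
  have hnodeV : ∀ t < Q, slot t / 2 ^ (s' + d) < V := fun t ht =>
    Nat.div_lt_of_lt_mul (by rw [mul_comm, hVs]; exact hlt t ht)
  have hbs : s' + d < 2 ^ E.w := by
    have : b < 2 ^ b := Nat.lt_two_pow_self
    omega
  have hcond : ∀ Φ : St → Prop, (∀ c ≤ 10, Φ ((σ.setVar .d d).tick c)) →
      wp E (.ite (.op .lt (.vr .bt) (.vr .s)) (.set .d (.vr .bt)) (.set .d (.vr .s))) Φ σ := by
    intro Φ hΦ
    simp only [wp_ite, wp_set, Expr.safe_lt, Expr.safe_vr, Expr.val_lt, Expr.val_vr, true_and,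
      h.bt, h.lev, Expr.cost_op, Expr.cost_vr, St.var_tick]
    by_cases hc : β < s' + d
    · simp only [hc, if_true, one_ne_zero, if_false]
      have : β = d := by omega
      rw [this]
      exact hΦ 7 (by omega)
    · simp only [hc, if_true, if_false]
      have : s' + d = d := by omega
      rw [this]
      exact hΦ 6 (by omega)
  simp only [level, wp_seq]
  refine hcond _ fun c hc => ?_
  simp only [wp_seq, wp_set, Expr.safe_vr, Expr.safe_cst, Expr.safe_add, Expr.safe_sub,
    Expr.safe_mul, Expr.safe_shl, Expr.safe_shr, Expr.safe_div, Expr.val_vr, Expr.val_cst,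
    Expr.val_add, Expr.val_sub, Expr.val_mul, Expr.val_shl, Expr.val_shr, Expr.val_div, St.var_tick,
    St.var_setVar, reduceCtorEq, if_false, if_true, true_and, and_true, h.lev, h.f, h.fm, h.nn,
    Expr.cost_vr, Expr.cost_cst, Expr.cost_add, Expr.cost_sub, Expr.cost_op, Expr.cost_mul,
    Expr.cost_div, Nat.add_sub_cancel, one_mul]
  simp only [← hM, hVdiv']
  have h1w : 1 < 2 ^ E.w := by omega
  have hone1 : 1 ≤ 2 ^ (F * M) := Nat.one_le_two_pow
  have hones : (2 ^ (F * M) - 1) / (2 ^ F - 1) = pack F (fun _ => 1) M := by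
    have := pack_one (f := F) (by omega) M
    rwa [one_mul] at this
  simp only [hones]
  refine ⟨by omega, ⟨h1w, by omega⟩, ⟨h1w, by omega⟩, ⟨⟨h1w, by omega, hFM⟩, h1w, hone1⟩,
    ⟨h1w, by omega⟩, ?_⟩
  generalize hσ₁ : St.tick _ _ = σ₁
  have a₁ : σ₁.arr = σ.arr := by rw [← hσ₁]; rfl
  have t₁ : σ₁.time ≤ σ.time + 50 := by rw [← hσ₁]; simp; omega
  set Y : List Var := [.q, .nn, .bt, .f, .h, .fm, .s, .s2, .bb, .cap, .ones] with hY
  have v₁ : σ₁.var .u = V * M ∧ σ₁.var .w = 2 ^ s' ∧ σ₁.var .s2 = s' ∧ σ₁.var .bb = M ∧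
      σ₁.var .cap = M + 1 ∧ σ₁.var .ones = pack F (fun _ => 1) M := by
    rw [← hσ₁]; simp
  have v₁' : ∀ y ∈ [Var.q, .nn, .bt, .f, .h, .fm, .s], σ₁.var y = σ.var y := by
    intro y hy
    simp only [List.mem_cons, List.not_mem_nil, or_false] at hy
    rw [← hσ₁]
    rcases hy with rfl | rfl | rfl | rfl | rfl | rfl | rfl <;> simp
  clear hσ₁
  -- fresh counters
  refine wp_frame _ (wp_count (x := .i) (hi := .u) (fun i τ => (∀ i' < i, τ.arr .cnt i' = 2 ^ s') ∧
    τ.time ≤ σ.time + 52 + 17 * i) 0 (V * M) (by simp) (by simp) (by simp) (by simp)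
    (by simp) (by simp) v₁.1 (by omega) ⟨by simp, by simp; omega⟩ ?_
    (Φ := fun τ => (∀ i' < V * M, τ.arr .cnt i' = 2 ^ s') ∧
      τ.time ≤ σ.time + 56 + 17 * (V * M)) ?_) ?_
  · rintro i τ - hi ⟨hI, ht⟩ hx - hfv -
    have hw : τ.var .w = 2 ^ s' := (hfv .w (by simp) (by simp)).trans v₁.2.1
    simp only [wp_put, Expr.safe_vr, Expr.val_vr, Expr.cost_vr, St.var_tick, hx, hw, true_and,
      St.arr_tick, St.arr_setVar, St.arr_setArr, if_true, St.time_tick, St.time_setVar,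
      St.time_setArr]
    refine ⟨by omega, fun i' hi' => ?_, by omega⟩
    rw [Function.update_apply]
    split_ifs with hne
    · rfl
    · exact hI i' (by omega)
  · rintro τ ⟨hI, ht⟩ -
    exact ⟨by simpa using hI, by simp; omega⟩
  rintro σ₂ hf₂ ⟨hcnt₂, t₂⟩
  have k₂ : ∀ y ∈ Y, σ₂.var y = σ₁.var y := by
    intro y hy
    simp only [hY, List.mem_cons, List.not_mem_nil, or_false] at hy
    rcases hy with rfl | rfl | rfl | rfl | rfl | rfl | rfl | rfl | rfl | rfl | rfl <;>
      exact hf₂.1 _ (by simp)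
  have a₂ : ∀ a, a ≠ .cnt → σ₂.arr a = σ.arr a := fun a ha => by
    rw [hf₂.2 a (by simp [ha]), a₁]
  -- the order by blocks and time
  simp only [wp_seq, wp_set, Expr.safe_shr, Expr.safe_vr, true_and, Expr.val_shr, Expr.val_vr,
    k₂ .nn (by simp [hY]), k₂ .s (by simp [hY]), v₁' .nn (by simp), v₁' .s (by simp), h.nn, h.lev,
    hVdiv, Expr.cost_op, Expr.cost_vr]
  refine wp_mono (wp_sortBy_range (l := List.range Q) (Q := Q) (U := V) (by simp) (by simp)
    (by simp) (by simp) (by simp) (List.Perm.refl _) ?_ ?_ (by simp) ?_ (by omega) (by omega)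
    (by omega)) ?_
  · intro p hp
    simp [a₂, h.idn p hp, List.getD_eq_getElem, hp]
  · simp [k₂ .q (by simp [hY]), v₁' .q (by simp), h.q]
  · intro t ht
    simpa [a₂, h.node t ht] using hnodeV t ht
  rintro σ₃ ⟨hf₃, hperm, hoA, t₃⟩
  simp only [St.arr_tick, St.arr_setVar, St.time_tick, St.time_setVar, a₂ .node (by simp)]
    at hperm hoA t₃
  set A : ℕ → ℕ := fun p => (bucketSort (σ.arr .node) V (List.range Q)).getD p 0 with hAdef
  have hlenA : (bucketSort (σ.arr .node) V (List.range Q)).length = Q := by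
    simpa using hperm.length_eq
  have hpair := bucketSort_pairwise (κ := σ.arr .node) V (List.pairwise_lt_range (n := Q))
  have hAQ : ∀ p < Q, A p < Q := fun p hp => lt_of_perm_range hperm hp
  have hA : Grouped slot A (s' + d) Q := by
    refine ⟨hAQ, fun t ht => exists_of_perm_range hperm ht, fun p q hpq hq => ?_⟩
    rw [← h.node _ (hAQ p (by omega)), ← h.node _ (hAQ q hq)]
    exact rel_of_pairwise hpair hpq (by omega)
  have k₃ : ∀ y ∈ Y, σ₃.var y = σ₁.var y := by
    intro y hy
    rw [← k₂ y hy]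
    simp only [hY, List.mem_cons, List.not_mem_nil, or_false] at hy
    rcases hy with rfl | rfl | rfl | rfl | rfl | rfl | rfl | rfl | rfl | rfl | rfl <;>
      exact (hf₃.1 _ (by simp [sortBy])).trans (by simp)
  have a₃ : ∀ a, a ≠ .cN → a ≠ .oA → σ₃.arr a = σ₂.arr a := fun a h1 h2 => by
    rw [hf₃.2 a (by simp [sortBy, h1, h2])]; rfl
  -- the chunks
  set κ : ℕ → ℕ := fun p => slot (A p) / 2 ^ (s' + d) with hκ
  rw [wp_seq]
  refine wp_frame _ (wp_markChunks (E := E) (A := A) (κ := κ) (M := M) (Q := Q) ?_ ?_ hMpos hQ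
    (by omega)
    (by omega) hoA hAQ (injOn_of_perm_range hperm) ?_) ?_
  · rw [k₃ .q (by simp [hY]), v₁' .q (by simp), h.q]
  · rw [k₃ .bb (by simp [hY]), v₁.2.2.2.1]
  · intro p hp
    rw [a₃ _ (by simp) (by simp), a₂ _ (by simp), h.node _ (hAQ p hp)]
  rintro σ₄ hf₄ ⟨hcid₄, t₄⟩
  have k₄ : ∀ y ∈ Y, σ₄.var y = σ₁.var y := by
    intro y hy
    rw [← k₃ y hy]
    simp only [hY, List.mem_cons, List.not_mem_nil, or_false] at hy
    rcases hy with rfl | rfl | rfl | rfl | rfl | rfl | rfl | rfl | rfl | rfl | rfl <;>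
      exact hf₄.1 _ (by simp [markChunks])
  have a₄ : ∀ a, a ≠ .cid → σ₄.arr a = σ₃.arr a := fun a h1 => hf₄.2 a (by simp [markChunks, h1])
  have hkeylt : ∀ t < Q, σ.arr .key t < 2 * Q := fun t ht => by
    have := live_le (D := deleted slot t) (a := slot t / 2 ^ (s' + d) * 2 ^ (s' + d)) (b := slot t)
    rw [h.key t ht]
    have := hlt t ht
    omega
  -- the order by keys
  simp only [wp_seq, wp_set, Expr.safe_vr, true_and, Expr.val_vr, Expr.cost_vr,
    k₄ .nn (by simp [hY]), v₁' .nn (by simp), h.nn]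
  refine wp_mono (wp_sortBy_range (l := List.range Q) (Q := Q) (U := 2 * Q) (by simp) (by simp)
    (by simp) (by simp) (by simp) (List.Perm.refl _) ?_ ?_ (by simp) ?_ (by omega) (by omega)
    (by omega)) ?_
  · intro p hp
    simp [a₄, a₃, a₂, h.idn p hp, List.getD_eq_getElem, hp]
  · simp [k₄ .q (by simp [hY]), v₁' .q (by simp), h.q]
  · intro t ht
    simpa [a₄, a₃, a₂] using hkeylt t ht
  rintro σ₅ ⟨hf₅, hperm₅, hoK, t₅⟩
  simp only [St.arr_tick, St.arr_setVar, St.time_tick, St.time_setVar, a₄ .key (by simp),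
    a₃ .key (by simp) (by simp), a₂ .key (by simp)] at hperm₅ hoK t₅
  have k₅ : ∀ y ∈ Y, σ₅.var y = σ₁.var y := by
    intro y hy
    rw [← k₄ y hy]
    simp only [hY, List.mem_cons, List.not_mem_nil, or_false] at hy
    rcases hy with rfl | rfl | rfl | rfl | rfl | rfl | rfl | rfl | rfl | rfl | rfl <;>
      exact (hf₅.1 _ (by simp [sortBy])).trans (by simp)
  have a₅ : ∀ a, a ≠ .cN → a ≠ .oK → σ₅.arr a = σ₄.arr a := fun a h1 h2 => by
    rw [hf₅.2 a (by simp [sortBy, h1, h2])]; rfl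
  -- the order by chunks and keys
  have hcidQ : ∀ t < Q, σ₄.arr .cid t < Q := fun t ht => by
    obtain ⟨p, hp, rfl⟩ := hA.surj t ht
    rw [hcid₄ p hp]
    exact (chunkStart_le p).trans_lt hp
  simp only [wp_seq, wp_set, Expr.safe_vr, true_and, Expr.val_vr, Expr.cost_vr,
    k₅ .q (by simp [hY]), v₁' .q (by simp), h.q]
  refine wp_mono (wp_sortBy_range (l := bucketSort (σ.arr .key) (2 * Q) (List.range Q)) (Q := Q)
    (U := Q) (by simp) (by simp) (by simp) (by simp) (by simp) hperm₅ ?_ ?_ (by simp) ?_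
    (by omega) (by omega) (by omega)) ?_
  · intro p hp
    simpa using hoK p hp
  · simp [k₅ .q (by simp [hY]), v₁' .q (by simp), h.q]
  · intro t ht
    simpa [a₅] using hcidQ t ht
  rintro σ₆ ⟨hf₆, hperm₆, hoC, t₆⟩
  simp only [St.arr_tick, St.arr_setVar, St.time_tick, St.time_setVar,
    a₅ .cid (by simp) (by simp)] at hperm₆ hoC t₆
  have k₆ : ∀ y ∈ Y, σ₆.var y = σ₁.var y := by
    intro y hy
    rw [← k₅ y hy]
    simp only [hY, List.mem_cons, List.not_mem_nil, or_false] at hy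
    rcases hy with rfl | rfl | rfl | rfl | rfl | rfl | rfl | rfl | rfl | rfl | rfl <;>
      exact (hf₆.1 _ (by simp [sortBy])).trans (by simp)
  have a₆ : ∀ a, a ≠ .cN → a ≠ .oC → σ₆.arr a = σ₅.arr a := fun a h1 h2 => by
    rw [hf₆.2 a (by simp [sortBy, h1, h2])]; rfl
  set lC := bucketSort (σ₄.arr .cid) Q (bucketSort (σ.arr .key) (2 * Q) (List.range Q)) with hlC
  have hlenC : lC.length = Q := by simpa using hperm₆.length_eq
  have hpairC : lC.Pairwise fun x y => σ₄.arr .cid x < σ₄.arr .cid y ∨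
      σ₄.arr .cid x = σ₄.arr .cid y ∧ σ.arr .key x ≤ σ.arr .key y :=
    bucketSort_pairwise Q ((bucketSort_pairwise (2 * Q) (List.pairwise_lt_range (n := Q))).imp
      fun h => by omega)
  have hcid₆ : σ₆.arr .cid = σ₄.arr .cid := by
    rw [a₆ _ (by simp) (by simp), a₅ _ (by simp) (by simp)]
  have b₆ : ∀ a, a = .node ∨ a = .key ∨ a = .idn → σ₆.arr a = σ.arr a := by
    rintro a (rfl | rfl | rfl) <;>
      rw [a₆ _ (by simp) (by simp), a₅ _ (by simp) (by simp), a₄ _ (by simp),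
        a₃ _ (by simp) (by simp), a₂ _ (by simp)]
  have hcidC : ∀ q < Q, σ₄.arr .cid (lC.getD q 0) = chunkStart κ M q := by
    intro q hq
    rw [← hcid₄ q hq]
    refine eq_of_perm_of_pairwise (hperm₆.trans hperm.symm) (hpairC.imp fun h => by omega) ?_
    refine List.pairwise_iff_getElem.2 fun i j hi hj hij => ?_
    have e1 := hcid₄ i (by omega)
    have e2 := hcid₄ j (by omega)
    simp only [hAdef, List.getD_eq_getElem _ _ hi, List.getD_eq_getElem _ _ hj] at e1 e2
    rw [e1, e2]
    exact chunkStart_mono hij.le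
  have hv : ∀ y (hy : y ∈ [Var.q, .nn, .bt, .f, .h, .fm, .s]), σ₆.var y = σ.var y := fun y hy =>
    (k₆ y (by simp at hy; simp [hY]; tauto)).trans (v₁' y hy)
  rw [wp_seq]
  refine wp_frame _ (wp_descend (E := E) (slot := slot) (A := A) (c := fun q => lC.getD q 0)
    (s := s') (d := d)
    (F := F) (Q := Q) (V := V) ((hv _ (by simp)).trans h.q)
    ((k₆ _ (by simp [hY])).trans v₁.2.2.2.1) ((k₆ _ (by simp [hY])).trans v₁.2.2.2.2.1)
    ((hv _ (by simp)).trans h.f) ((hv _ (by simp)).trans h.h) ((hv _ (by simp)).trans h.fm)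
    ((k₆ _ (by simp [hY])).trans v₁.2.2.2.2.2) (by omega) hF hSw hsmallM hFM hA hslot
    (fun t ht => hVs ▸ hlt t ht) (hVs ▸ hQS) ?_ hoC (fun q hq => lt_of_perm_range hperm₆ hq)
    (fun t ht => exists_of_perm_range hperm₆ ht) (injOn_of_perm_range hperm₆) ?_ ?_ ?_ ?_ ?_ ?_) ?_
  · intro p hp
    rw [a₆ _ (by simp) (by simp), a₅ _ (by simp) (by simp), a₄ _ (by simp), hoA p hp]
  · intro p hp; rw [hcid₆, hcid₄ p hp]
  · intro q hq; rw [hcid₆]; exact hcidC q hq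
  · intro q q' hqq hq' heq
    rw [hcid₆] at heq
    rw [b₆ .key (by simp)]
    rcases rel_of_pairwise hpairC hqq (by omega) with h1 | h1
    · omega
    · exact h1.2
  · intro t ht; rw [b₆ _ (by simp), h.node t ht]
  · intro t ht; rw [b₆ _ (by simp), h.key t ht]
  · intro i hi
    rw [a₆ _ (by simp) (by simp), a₅ _ (by simp) (by simp), a₄ _ (by simp),
      a₃ _ (by simp) (by simp), hcnt₂ i hi]
  rintro σ₇ hf₇ ⟨hnew, t₇⟩
  have v₇ : ∀ y ∈ Y, σ₇.var y = σ₁.var y := by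
    intro y hy
    rw [← k₆ y hy]
    simp only [hY, List.mem_cons, List.not_mem_nil, or_false] at hy
    rcases hy with rfl | rfl | rfl | rfl | rfl | rfl | rfl | rfl | rfl | rfl | rfl <;>
      exact hf₇.1 _ (by simp [descend, setup, advance, descendOne])
  have a₇ : σ₇.arr .idn = σ.arr .idn := by
    rw [hf₇.2 .idn (by simp [descend, setup, advance, descendOne]), b₆ _ (by simp)]
  have hw : ∀ y (hy : y ∈ [Var.q, .nn, .bt, .f, .h, .fm, .s]), σ₇.var y = σ.var y := fun y hy =>
    (v₇ y (by simp at hy; simp [hY]; tauto)).trans (v₁' y hy)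
  have hchunks : M * chunks κ M Q ≤ Q + M * V := by
    refine mul_chunks_le hMpos (fun p hp => ?_) (fun p hp => hnodeV _ (hAQ p hp))
    rcases hA.mono p (p + 1) (by omega) hp with h1 | h1
    · exact h1.le
    · exact h1.1.le
  have hch : (180 * M + 40) * chunks κ M Q ≤ 220 * (M * chunks κ M Q) := by
    rw [← mul_assoc]
    exact Nat.mul_le_mul_right _ (by omega)
  have hMV : M * V = V * M := mul_comm _ _
  simp only [wp_set, Expr.safe_vr, true_and, Expr.val_vr, Expr.cost_vr, v₇ .s2 (by simp [hY]),
    v₁.2.2.1]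
  refine ⟨⟨?_, ?_, ?_, ?_, ?_, ?_, by simp, ?_, ?_, ?_⟩, ?_⟩
  · simpa using (hw .q (by simp)).trans h.q
  · simpa using (hw .nn (by simp)).trans h.nn
  · simpa using (hw .bt (by simp)).trans h.bt
  · simpa using (hw .f (by simp)).trans h.f
  · simpa using (hw .h (by simp)).trans h.h
  · simpa using (hw .fm (by simp)).trans h.fm
  · simpa [a₇] using h.idn
  · simpa using fun t ht => (hnew t ht).1
  · simpa using fun t ht => (hnew t ht).2
  · simp only [sortTime] at t₃ t₅ t₆
    simp only [St.time_tick, St.time_setVar]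
    change _ ≤ _ + _ + _ + (180 * M + 40) * chunks κ M Q at t₇
    omega

/-! ### Move-to-front with slots -/

/-- The live slots after `t` operations, from left to right: at first these are the slots from `Q`
on, and operation `t` deletes the live slot with number `m t` and adds the slot `Q - 1 - t`. -/
def slotList (m : ℕ → ℕ) (Q : ℕ) : ℕ → List ℕ
  | 0 => List.range' Q Q
  | t + 1 => (Q - 1 - t) :: (slotList m Q t).eraseIdx (m t)

/-- The slot that is deleted by operation `t`. -/
def slotAt (m : ℕ → ℕ) (Q t : ℕ) : ℕ := (slotList m Q t).getD (m t) 0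

section
variable {m : ℕ → ℕ} {Q : ℕ}

theorem length_slotList (hm : ∀ t, m t < Q) (t : ℕ) : (slotList m Q t).length = Q := by
  induction t with
  | zero => simp [slotList]
  | succ t ih =>
    have := hm t
    rw [slotList, List.length_cons, List.length_eraseIdx_of_lt (by omega)]
    omega

theorem slotAt_eq (hm : ∀ t, m t < Q) (t : ℕ) :
    slotAt m Q t = (slotList m Q t)[m t]'(by rw [length_slotList hm]; exact hm t) := by
  rw [slotAt, List.getD_eq_getElem]

theorem slotAt_mem (hm : ∀ t, m t < Q) (t : ℕ) : slotAt m Q t ∈ slotList m Q t := by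
  rw [slotAt_eq hm]; exact List.getElem_mem _

theorem mem_eraseIdx_slotList (hm : ∀ t, m t < Q) {t x : ℕ} (hnd : (slotList m Q t).Nodup) :
    x ∈ (slotList m Q t).eraseIdx (m t) ↔ x ∈ slotList m Q t ∧ x ≠ slotAt m Q t := by
  have hl : m t < (slotList m Q t).length := by rw [length_slotList hm]; exact hm t
  rw [slotAt_eq hm, ← hnd.erase_getElem (m t) hl, hnd.mem_erase_iff, and_comm]

/-- The live slots are listed in increasing order; the slots below `Q - t` are unused. -/
theorem slotList_spec (hm : ∀ t, m t < Q) (t : ℕ) (ht : t ≤ Q) :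
    (slotList m Q t).Pairwise (· < ·) ∧
      (∀ x, x ∈ slotList m Q t ↔ Q - t ≤ x ∧ x < 2 * Q ∧ x ∉ deleted (slotAt m Q) t) ∧
      ∀ x ∈ deleted (slotAt m Q) t, Q + 1 - t ≤ x := by
  induction t with
  | zero =>
    refine ⟨List.pairwise_lt_range', fun x => ?_, by simp [deleted]⟩
    simp [slotList, deleted, List.mem_range'_1]
    omega
  | succ t ih =>
    obtain ⟨h1, h2, h3⟩ := ih (by omega)
    have hnd : (slotList m Q t).Nodup := h1.imp fun h => h.ne
    have h4 := (h2 _).1 (slotAt_mem hm t)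
    have h5 : ∀ x ∈ deleted (slotAt m Q) (t + 1), Q + 1 - (t + 1) ≤ x := by
      intro x hx
      rw [deleted_succ, Finset.mem_insert] at hx
      rcases hx with rfl | hx
      · omega
      · have := h3 x hx
        omega
    refine ⟨?_, fun x => ?_, h5⟩
    · rw [slotList, List.pairwise_cons]
      refine ⟨fun x hx => ?_, h1.sublist (List.eraseIdx_sublist _ _)⟩
      have := (h2 x).1 ((mem_eraseIdx_slotList hm hnd).1 hx).1
      omega
    · rw [slotList, List.mem_cons, mem_eraseIdx_slotList hm hnd, h2]
      constructor
      · rintro (rfl | ⟨⟨h6, h7, h8⟩, h9⟩)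
        · refine ⟨by omega, by omega, fun h => ?_⟩
          have := h5 _ h
          omega
        · rw [deleted_succ, Finset.mem_insert, not_or]
          exact ⟨by omega, h7, h9, h8⟩
      · rw [deleted_succ, Finset.mem_insert, not_or]
        rintro ⟨h6, h7, h8, h9⟩
        rcases Nat.lt_or_ge x (Q - t) with h10 | h10
        · left; omega
        · exact Or.inr ⟨⟨h10, h7, h9⟩, h8⟩

theorem slotAt_spec (hm : ∀ t, m t < Q) {t : ℕ} (ht : t < Q) :
    Q - t ≤ slotAt m Q t ∧ slotAt m Q t < 2 * Q ∧ slotAt m Q t ∉ deleted (slotAt m Q) t :=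
  ((slotList_spec hm t ht.le).2.1 _).1 (slotAt_mem hm t)

theorem slotAt_injOn (hm : ∀ t, m t < Q) : Set.InjOn (slotAt m Q) (Set.Iio Q) := by
  have : ∀ t < Q, ∀ u < t, slotAt m Q u ≠ slotAt m Q t := fun t ht u hu h =>
    (slotAt_spec hm ht).2.2 (by rw [← h]; exact Finset.mem_image_of_mem _ (Finset.mem_range.2 hu))
  intro t ht u hu h
  rcases lt_trichotomy t u with hlt | heq | hlt
  · exact absurd h (this u hu t hlt)
  · exact heq
  · exact absurd h.symm (this t ht u hlt)

/-- The number of elements on the left of the element number `k` of a sorted list is `k`. -/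
theorem card_filter_lt_of_pairwise {l : List ℕ} (h : l.Pairwise (· < ·)) {k : ℕ} (hk : k < l.length)
    {S : Finset ℕ} (hS : ∀ x, x ∈ S ↔ x ∈ l ∧ x < l[k]) : S.card = k := by
  have hnd : l.Nodup := h.imp fun h => h.ne
  have : S = (l.take k).toFinset := by
    ext x
    rw [hS, List.mem_toFinset, List.mem_take_iff_getElem]
    constructor
    · rintro ⟨hx, hlt⟩
      obtain ⟨i, hi, rfl⟩ := List.getElem_of_mem hx
      refine ⟨i, ?_, rfl⟩
      by_contra hik
      rcases Nat.lt_or_ge k i with hki | hki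
      · have := List.pairwise_iff_getElem.1 h k i hk hi hki
        omega
      · obtain rfl : i = k := by omega
        omega
    · rintro ⟨i, hi, rfl⟩
      exact ⟨List.getElem_mem _, List.pairwise_iff_getElem.1 h i k _ hk (by omega)⟩
  rw [this, List.toFinset_card_of_nodup (hnd.sublist (List.take_sublist _ _)), List.length_take]
  omega

/-- The initial key of an operation is the number of live slots on the left of its slot: the
`Q - t` unused slots, and the slots of the elements in front of the requested one. -/
theorem live_slotAt (hm : ∀ t, m t < Q) {t : ℕ} (ht : t < Q) :
    live (deleted (slotAt m Q) t) 0 (slotAt m Q t) = Q - t + m t := by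
  obtain ⟨h1, h2, h3⟩ := slotList_spec hm t ht.le
  have h4 := slotAt_spec hm ht
  rw [← live_add (Nat.zero_le _) h4.1]
  congr 1
  · rw [live_congr (D' := ∅) fun x _ hx => ?_, live_empty, Nat.sub_zero]
    simp only [Finset.notMem_empty, iff_false]
    intro h
    have := h3 x h
    omega
  · refine card_filter_lt_of_pairwise h1 (by rw [length_slotList hm]; exact hm t) fun x => ?_
    rw [← slotAt_eq hm, Finset.mem_filter, Finset.mem_Ico, h2]
    constructor
    · rintro ⟨⟨h5, h6⟩, h7⟩; exact ⟨⟨h5, by omega, h7⟩, h6⟩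
    · rintro ⟨⟨h5, h6, h7⟩, h8⟩; exact ⟨⟨h5, h8⟩, h7⟩

/-- Labels follow the elements: the label of a deleted slot passes to the new slot. -/
theorem map_slotList_succ (hm : ∀ t, m t < Q) {t : ℕ} (ht : t < Q) {lab : ℕ → ℕ} {l : List ℕ}
    (h : (slotList m Q t).map lab = l) :
    lab (slotAt m Q t) = l.getD (m t) 0 ∧
    (slotList m Q (t + 1)).map (Function.update (Function.update lab (Q - 1 - t)
      (lab (slotAt m Q t))) (slotAt m Q t) 0) = moveToFront l (m t) := by
  obtain ⟨h1, h2, h3⟩ := slotList_spec hm t ht.le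
  have h4 := slotAt_spec hm ht
  have hnd : (slotList m Q t).Nodup := h1.imp fun h => h.ne
  have hl : m t < (slotList m Q t).length := by rw [length_slotList hm]; exact hm t
  have h5 : lab (slotAt m Q t) = l.getD (m t) 0 := by
    rw [slotAt_eq hm, ← h, List.getD_eq_getElem _ _ (by simpa using hl), List.getElem_map]
  refine ⟨h5, ?_⟩
  rw [slotList, List.map_cons, moveToFront, ← h5, ← h, List.eraseIdx_map]
  congr 1
  · rw [Function.update_of_ne (by omega), Function.update_self]
  · refine List.map_congr_left fun x hx => ?_
    rw [mem_eraseIdx_slotList hm hnd, h2] at hx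
    rw [Function.update_of_ne hx.2, Function.update_of_ne (by omega)]

end

theorem moveToFront_map (f : ℕ → ℕ) {l : List ℕ} {k : ℕ} (hk : k < l.length) :
    moveToFront (l.map f) k = (moveToFront l k).map f := by
  rw [moveToFront, moveToFront, List.map_cons, List.eraseIdx_map,
    List.getD_eq_getElem _ _ (by simpa using hk), List.getD_eq_getElem _ _ hk, List.getElem_map]

theorem mtfIter_congr {l : List ℕ} {m m' : ℕ → ℕ} {g : ℕ} (h : ∀ k < g, m k = m' k) :
    mtfIter l m g = mtfIter l m' g := by
  induction g with
  | zero => rfl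
  | succ g ih => rw [mtfIter, mtfIter, ih fun k hk => h k (by omega), h g (by omega)]

/-! ### One phase -/

/-- All operations of the phase start at the root, with their initial keys. -/
def startPhase : Stmt :=
  .count .t (.cst 0) .q (.put .node (.vr .t) (.cst 0) ;;
    .put .key (.vr .t) (.ld .rank (.vr .base + .vr .t) + (.vr .q - .vr .t))) ;;
  .set .s (.vr .b)

/-- The keys `m t + (Q - t)` are the ranks of the slots to be deleted among all live slots. -/
theorem wp_startPhase {E : Env} {σ : St} {R : ℕ → ℕ} {Q β F b B : ℕ}
    (hq : σ.var .q = Q) (hnn : σ.var .nn = 2 * Q) (hbt : σ.var .bt = β) (hf : σ.var .f = F)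
    (hh : σ.var .h = 2 ^ (F - 1)) (hfm : σ.var .fm = 2 ^ F - 1) (hbv : σ.var .b = b)
    (hbase : σ.var .base = B) (hidn : ∀ t < Q, σ.arr .idn t = t) (hR : ∀ g, σ.arr .rank g = R g)
    (hRQ : ∀ g, R g < Q) (hb : 2 ^ b = 2 * Q) (hQS : 2 * Q ≤ E.stride) (hBS : B + Q ≤ E.stride)
    (hSw : 4 * E.stride + 4 < 2 ^ E.w) :
    wp E startPhase (fun τ => AtLevel (slotAt (fun t => R (B + t)) Q) Q β F b τ ∧
      τ.time ≤ σ.time + 35 * Q + 10) σ := by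
  set m : ℕ → ℕ := fun t => R (B + t) with hm
  have hmQ : ∀ t, m t < Q := fun t => hRQ _
  have hQ : 0 < Q := Nat.zero_lt_of_lt (hRQ 0)
  rw [startPhase, wp_seq]
  refine wp_frame _ (wp_count (x := .t) (hi := .q) (fun t τ => (∀ u < t, τ.arr .node u = 0 ∧
    τ.arr .key u = m u + (Q - u)) ∧ τ.time ≤ σ.time + 2 + 35 * t) 0 Q (by simp) (by simp) (by simp)
    (by simp) (by simp) (by simp) hq (by omega) ⟨by simp, by simp⟩ ?_
    (Φ := fun τ => (∀ u < Q, τ.arr .node u = 0 ∧ τ.arr .key u = m u + (Q - u)) ∧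
      τ.time ≤ σ.time + 6 + 35 * Q) ?_) ?_
  · rintro t τ - ht ⟨hI, htime⟩ hvt hvq hfv hfa
    have h1 : τ.var .base = B := (hfv _ (by simp) (by simp)).trans hbase
    have h2 : τ.arr .rank = σ.arr .rank := hfa _ (by simp)
    have h3 := hmQ t
    simp only [wp_seq, wp_put, Expr.safe_vr, Expr.safe_cst, Expr.safe_ld, Expr.safe_add,
      Expr.safe_sub, Expr.val_vr, Expr.val_cst, Expr.val_ld, Expr.val_add, Expr.val_sub,
      Expr.cost_vr, Expr.cost_cst, Expr.cost_ld, Expr.cost_add, Expr.cost_sub, St.var_tick,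
      St.var_setArr, St.arr_tick, St.arr_setVar, St.arr_setArr, reduceCtorEq, if_false, if_true,
      true_and, hvt, hvq, h1, h2, hR, St.time_tick, St.time_setVar, St.time_setArr]
    refine ⟨by omega, by omega, ⟨⟨by omega, by omega⟩, by omega, ?_⟩, by omega, fun u hu => ?_,
      by omega⟩
    · change m t + (Q - t) < _; omega
    · rcases Nat.lt_or_ge u t with h | h
      · rw [Function.update_of_ne (by omega), Function.update_of_ne (by omega)]
        exact hI u h
      · obtain rfl : u = t := by omega
        simp [hm]
  · rintro τ ⟨hI, ht⟩ -
    exact ⟨by simpa using hI, by simp; omega⟩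
  rintro τ hf' ⟨hI, ht⟩
  have fv : ∀ y, y ≠ .t → τ.var y = σ.var y := fun y hy => hf'.1 y (by simp [hy])
  have hdiv : ∀ t < Q, slotAt m Q t / 2 ^ b = 0 := fun t ht =>
    Nat.div_eq_of_lt (by rw [hb]; exact (slotAt_spec hmQ ht).2.1)
  simp only [wp_set, Expr.safe_vr, Expr.val_vr, Expr.cost_vr, true_and]
  refine ⟨⟨?_, ?_, ?_, ?_, ?_, ?_, ?_, ?_, ?_, ?_⟩, by simp; omega⟩
  · simp [fv, hq]
  · simp [fv, hnn]
  · simp [fv, hbt]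
  · simp [fv, hf]
  · simp [fv, hh]
  · simp [fv, hfm]
  · simp [fv, hbv]
  · intro t ht
    simp only [St.arr_tick, St.arr_setVar, hf'.2 .idn (by simp), hidn t ht]
  · intro t ht
    rw [hdiv t ht]; exact (hI t ht).1
  · intro t ht
    rw [hdiv t ht, zero_mul, live_slotAt hmQ ht]
    have := (hI t ht).2
    simp only [St.arr_tick, St.arr_setVar]
    omega

/-- All levels of the descent. -/
def descent : Stmt := .loop (.vr .s) (.cst 1) level

/-- After all levels the blocks are single slots, and `node` holds the deleted slots. -/
theorem wp_descent {E : Env} {σ : St} {slot : ℕ → ℕ} {Q β F b : ℕ} (h : AtLevel slot Q β F b σ)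
    (hb : 2 ^ b = 2 * Q) (hβ : 0 < β)
    (hQS : 2 * Q ≤ E.stride) (hF : 1 < F) (hSw : 4 * E.stride + 4 < 2 ^ E.w)
    (hsmall : (2 ^ β + 1) * (2 * 2 ^ β) + 2 ^ β < 2 ^ (F - 1)) (hbig : 2 ^ (F * 2 ^ β) < 2 ^ E.w)
    (hslot : Set.InjOn slot (Set.Iio Q)) (hlt : ∀ t < Q, slot t < 2 * Q) :
    wp E descent (fun τ => (∀ t < Q, τ.arr .node t = slot t) ∧
      τ.time ≤ σ.time + (b / β + 1) * (1400 * Q + 410) + 10) σ := by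
  refine wp_loop (fun τ => ∃ k, AtLevel slot Q β F (b - k * β) τ ∧ k * β ≤ b + β ∧
    τ.time ≤ σ.time + k * (1400 * Q + 410)) (fun τ => τ.var .s) ?_ ⟨0, by simpa using h, by omega,
      by simp⟩
  rintro τ - ⟨k, hτ, hk, ht⟩
  have hw : 1 < 2 ^ E.w := by omega
  simp only [Expr.safe_vr, true_and, Expr.val_vr, hτ.lev, Expr.cost_vr, Expr.safe_cst,
    Expr.val_cst, Expr.cost_cst, one_ne_zero, if_false]
  by_cases h0 : b - k * β = 0
  · simp only [h0, if_true]
    refine ⟨fun t ht => ?_, ?_⟩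
    · have := hτ.node t ht
      simpa [h0] using this
    · have h1 : k ≤ b / β + 1 := by
        rw [← Nat.add_div_right b hβ]
        exact (Nat.le_div_iff_mul_le hβ).2 hk
      have := Nat.mul_le_mul_right (1400 * Q + 410) h1
      simp only [St.time_tick]
      omega
  · simp only [h0, if_false]
    refine ⟨hw, wp_mono (wp_level (s := b - k * β) (b := b) ?_ hb (by omega) (by omega) hQS hF hSw
      hsmall hbig hslot hlt) ?_⟩
    · exact ⟨hτ.q, hτ.nn, hτ.bt, hτ.f, hτ.h, hτ.fm, hτ.lev, hτ.idn, hτ.node, hτ.key⟩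
    · rintro υ ⟨h1, h2⟩
      have hkk : (k + 1) * β = k * β + β := by ring
      have hkt : (k + 1) * (1400 * Q + 410) = k * (1400 * Q + 410) + (1400 * Q + 410) := by ring
      have hs : b - k * β - min β (b - k * β) = b - (k + 1) * β := by omega
      rw [hs] at h1
      refine ⟨⟨k + 1, ⟨h1.q, h1.nn, h1.bt, h1.f, h1.h, h1.fm, h1.lev, h1.idn, h1.node, h1.key⟩,
        by omega, ?_⟩, ?_⟩
      · simp only [St.time_tick] at h2 ⊢; omega
      · simp only [St.var_tick, h1.lev]; omega

/-- The position in the text that is visited by step `g`. -/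
def setPos : Stmt :=
  .ite (.op .lt (.vr .g + .cst 1) (.vr .n)) (.set .o (.vr .n - .cst 2 - .vr .g))
    (.set .o (.vr .n - .cst 1))

theorem wp_setPos {E : Env} {σ : St} {Φ : St → Prop} {N g : ℕ} (hn : σ.var .n = N)
    (hg : σ.var .g = g) (hgN : g < N) (hw : N + 2 < 2 ^ E.w)
    (h : ∀ c ≤ 13, Φ ((σ.setVar .o (pos N g)).tick c)) : wp E setPos Φ σ := by
  have h1 : 1 < 2 ^ E.w := by omega
  have h2 : 2 < 2 ^ E.w := by omega
  simp only [setPos, wp_ite, wp_set, Expr.safe_lt, Expr.safe_vr, Expr.safe_cst, Expr.safe_add,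
    Expr.safe_sub, Expr.val_lt, Expr.val_vr, Expr.val_cst, Expr.val_add, Expr.val_sub,
    Expr.cost_vr, Expr.cost_cst, Expr.cost_add, Expr.cost_sub, Expr.cost_op, St.var_tick, true_and,
    and_true, hn, hg, h1, h2]
  refine ⟨by omega, ?_⟩
  by_cases hc : g + 1 < N
  · simp only [hc, if_true, one_ne_zero, if_false]
    rw [pos, if_pos hc] at h
    exact ⟨⟨by omega, by omega⟩, h 13 le_rfl⟩
  · simp only [hc, if_true, if_false]
    rw [pos, if_neg hc] at h
    exact ⟨by omega, h 10 (by omega)⟩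

theorem pos_injOn {N g g' : ℕ} (hg : g < N) (hg' : g' < N) (h : pos N g = pos N g') : g = g' := by
  unfold pos at h
  split_ifs at h <;> omega

theorem lt_of_mem_mtfIter {Q : ℕ} {R : ℕ → ℕ} (hR : ∀ g, R g < Q) (g : ℕ) :
    ∀ x ∈ mtfIter (List.range Q) R g, x < Q := by
  induction g with
  | zero => intro x hx; exact List.mem_range.1 hx
  | succ g ih =>
    intro x hx
    rw [mtfIter, moveToFront, List.mem_cons] at hx
    rcases hx with rfl | hx
    · have hl := length_mtfIter (l := List.range Q) (m := R) (by simpa using hR) g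
      rw [List.length_range] at hl
      rw [List.getD_eq_getElem _ _ (by rw [hl]; exact hR g)]
      exact ih _ (List.getElem_mem _)
    · exact ih x (List.mem_of_mem_eraseIdx hx)

/-- The code of the symbol that is decoded by step `g`, if `c` is the code in the transform. -/
def decoded (R : ℕ → ℕ) (Q g c : ℕ) : ℕ :=
  if c % 2 = 0 then c else 2 * (mtfIter (List.range Q) R g).getD (R g) 0 + 1

/-- The decoded numbers are read off, in the order of time: labels are stored increased by one,
and a deleted slot has the label `0`. -/
def readOff : Stmt :=
  .count .t (.cst 0) .q (
    .set .e (.ld .node (.vr .t)) ;; .set .c (.ld .lab (.vr .e)) ;;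
    .put .lab (.vr .q - .cst 1 - .vr .t) (.vr .c) ;; .put .lab (.vr .e) (.cst 0) ;;
    .set .g (.vr .base + .vr .t) ;;
    .ite (.op .lt (.vr .g) (.vr .n))
      (setPos ;; .ite (.ld .out (.vr .o) % .cst 2)
        (.put .out (.vr .o) (.cst 2 * (.vr .c - .cst 1) + .cst 1)) .skip)
      .skip)

/-- The labels carry the move-to-front list through the phase: the label of the slot that an
operation deletes is the decoded number, and it passes to the slot that the operation adds. -/
theorem wp_readOff {E : Env} {σ : St} {R : ℕ → ℕ} {Q B N : ℕ} (hq : σ.var .q = Q)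
    (hn : σ.var .n = N) (hbase : σ.var .base = B) (hRQ : ∀ g, R g < Q)
    (hnode : ∀ t < Q, σ.arr .node t = slotAt (fun t => R (B + t)) Q t)
    (hlab : ∀ i < Q, σ.arr .lab (Q + i) = (mtfIter (List.range Q) R B).getD i 0 + 1)
    (hQS : 2 * Q ≤ E.stride) (hBS : B + Q ≤ E.stride) (hNS : N ≤ E.stride)
    (hSw : 4 * E.stride + 4 < 2 ^ E.w) :
    wp E readOff (fun τ =>
      ((slotList (fun t => R (B + t)) Q Q).map (τ.arr .lab) =
        (mtfIter (List.range Q) R (B + Q)).map (· + 1)) ∧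
      (∀ x < 2 * Q, x ∉ slotList (fun t => R (B + t)) Q Q → τ.arr .lab x = 0) ∧
      (∀ g < N, τ.arr .out (pos N g) = if B ≤ g ∧ g < B + Q
        then decoded R Q g (σ.arr .out (pos N g)) else σ.arr .out (pos N g)) ∧
      τ.time ≤ σ.time + 90 * Q + 10) σ := by
  set m : ℕ → ℕ := fun t => R (B + t) with hm
  have hmQ : ∀ t, m t < Q := fun t => hRQ _
  have hQ : 0 < Q := Nat.zero_lt_of_lt (hRQ 0)
  have hlen : ∀ g, (mtfIter (List.range Q) R g).length = Q := fun g => by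
    simpa using length_mtfIter (l := List.range Q) (m := R) (by simpa using hRQ) g
  refine wp_count (x := .t) (hi := .q) (fun t τ =>
    (slotList m Q t).map (τ.arr .lab) = (mtfIter (List.range Q) R (B + t)).map (· + 1) ∧
    (∀ x < 2 * Q, Q - t ≤ x → x ∉ slotList m Q t → τ.arr .lab x = 0) ∧
    (∀ g < N, τ.arr .out (pos N g) = if B ≤ g ∧ g < B + t
      then decoded R Q g (σ.arr .out (pos N g)) else σ.arr .out (pos N g)) ∧
    τ.time ≤ σ.time + 2 + 90 * t) 0 Q (by simp [setPos]) (by simp [setPos]) (by simp)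
    (by simp) (by simp) (by simp) hq (by omega) ?_ ?_ ?_
  · refine ⟨?_, fun x h1 h2 h3 => absurd ?_ h3, fun g _ => ?_, by simp⟩
    · refine List.ext_getElem (by simp [slotList, hlen]) fun i h1 h2 => ?_
      simp only [slotList, List.getElem_map, List.getElem_range', St.arr_tick, St.arr_setVar,
        one_mul, add_zero]
      rw [hlab i (by simpa [slotList] using h1), List.getD_eq_getElem]
    · simp [slotList, List.mem_range'_1]; omega
    · rw [if_neg (by omega)]; rfl
  · rintro t τ - ht ⟨hmap, hzero, hout, htime⟩ hvt hvq hfv hfa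
    have f1 : τ.var .base = B := (hfv _ (by simp) (by simp [setPos])).trans hbase
    have f2 : τ.var .n = N := (hfv _ (by simp) (by simp [setPos])).trans hn
    have f3 : τ.arr .node t = slotAt m Q t := by rw [hfa _ (by simp [setPos]), hnode t ht]
    obtain ⟨hslab, hmap'⟩ := map_slotList_succ hmQ ht hmap
    have hs := slotAt_spec hmQ ht
    have hl : m t < (mtfIter (List.range Q) R (B + t)).length := by rw [hlen]; exact hmQ t
    rw [moveToFront_map _ hl] at hmap'
    rw [List.getD_eq_getElem _ _ (by simpa using hl), List.getElem_map] at hslab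
    have hvQ : (mtfIter (List.range Q) R (B + t))[m t] < Q :=
      lt_of_mem_mtfIter hRQ _ _ (List.getElem_mem _)
    set v := (mtfIter (List.range Q) R (B + t))[m t] with hv
    set S := slotAt m Q t with hS
    -- the part of the invariant that concerns the labels
    have hzero' : ∀ x < 2 * Q, Q - (t + 1) ≤ x → x ∉ slotList m Q (t + 1) →
        Function.update (Function.update (τ.arr .lab) (Q - 1 - t) (τ.arr .lab S)) S 0 x = 0 := by
      intro x h1 h2 h3
      have hnd : (slotList m Q t).Nodup := (slotList_spec hmQ t ht.le).1.imp fun h => h.ne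
      rw [slotList, List.mem_cons, mem_eraseIdx_slotList hmQ hnd, not_or, not_and_or,
        not_not] at h3
      rw [Function.update_apply]
      split_ifs with h4
      · rfl
      · rw [Function.update_of_ne h3.1]
        exact hzero x h1 (by omega) (h3.2.resolve_right h4)
    simp only [wp_seq, wp_set, wp_put, Expr.safe_vr, Expr.safe_cst, Expr.safe_ld, Expr.safe_add,
      Expr.safe_sub, Expr.val_vr, Expr.val_cst, Expr.val_ld, Expr.val_add, Expr.val_sub,
      Expr.cost_vr, Expr.cost_cst, Expr.cost_ld, Expr.cost_add, Expr.cost_sub, St.var_tick,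
      St.var_setVar, St.var_setArr, St.arr_tick, St.arr_setVar, St.arr_setArr, reduceCtorEq,
      if_false, if_true, true_and, hvt, hvq, f1, f3]
    refine ⟨by omega, by omega, ⟨⟨by omega, by omega⟩, by omega⟩, by omega, by omega, by omega,
      by omega, ?_⟩
    generalize hυ : St.tick (St.setVar _ .g _) _ = υ
    have ulab : υ.arr .lab =
        Function.update (Function.update (τ.arr .lab) (Q - 1 - t) (τ.arr .lab S)) S 0 := by
      rw [← hυ]; simp
    have uout : υ.arr .out = τ.arr .out := by rw [← hυ]; simp
    have ug : υ.var .g = B + t := by rw [← hυ]; simp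
    have un : υ.var .n = N := by rw [← hυ]; simp [f2]
    have uc : υ.var .c = v + 1 := by rw [← hυ]; simp [hslab]
    have ut : υ.time ≤ σ.time + 2 + 90 * t + 38 := by rw [← hυ]; simp; omega
    clear hυ
    -- the part of the invariant that concerns the output
    have hstep : ∀ g < N, g ≠ B + t → τ.arr .out (pos N g) = if B ≤ g ∧ g < B + (t + 1)
        then decoded R Q g (σ.arr .out (pos N g)) else σ.arr .out (pos N g) := by
      intro g hg hne
      rw [hout g hg]
      exact if_congr (by omega) rfl rfl
    rw [wp_ite]
    simp only [Expr.safe_lt, Expr.safe_vr, true_and, Expr.val_lt, Expr.val_vr, ug, un,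
      Expr.cost_op, Expr.cost_vr]
    by_cases hgN : B + t < N
    · simp only [hgN, if_true, one_ne_zero, if_false, wp_seq]
      refine wp_setPos (E := E) (N := N) (g := B + t) un ug hgN (by omega) fun c hc => ?_
      have hposN : pos N (B + t) < N := pos_lt (by omega)
      have hold : τ.arr .out (pos N (B + t)) = σ.arr .out (pos N (B + t)) := by
        rw [hout _ hgN, if_neg (by omega)]
      simp only [wp_ite, wp_put, wp_skip, Expr.safe_mod, Expr.safe_ld, Expr.safe_vr, Expr.safe_cst,
        Expr.safe_add, Expr.safe_mul, Expr.safe_sub, Expr.val_mod, Expr.val_ld, Expr.val_vr,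
        Expr.val_cst, Expr.val_add, Expr.val_mul, Expr.val_sub, Expr.cost_mod, Expr.cost_ld,
        Expr.cost_vr, Expr.cost_cst, Expr.cost_add, Expr.cost_mul, Expr.cost_sub, St.var_tick,
        St.var_setVar, St.var_setArr, St.arr_tick, St.arr_setVar, St.arr_setArr, reduceCtorEq,
        if_false, if_true, true_and, and_true, uout, uc, hold, ulab, St.time_tick,
        St.time_setVar, St.time_setArr]
      refine ⟨⟨by omega, by omega⟩, ?_⟩
      by_cases hpar : σ.arr .out (pos N (B + t)) % 2 = 0
      · simp only [hpar, if_true]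
        refine ⟨hmap', hzero', fun g hg => ?_, by omega⟩
        by_cases hgt : g = B + t
        · rw [hgt, if_pos (by omega), decoded, if_pos hpar, hold]
        · exact hstep g hg hgt
      · simp only [hpar, if_false]
        refine ⟨⟨⟨by omega, ⟨by omega, by omega⟩, by omega⟩, by omega, by omega⟩, by omega, hmap',
          hzero', fun g hg => ?_, by omega⟩
        by_cases hgt : g = B + t
        · rw [hgt, Function.update_self, if_pos (by omega), decoded, if_neg hpar,
            List.getD_eq_getElem _ _ hl]
          simp [hv, hm]
        · rw [Function.update_of_ne fun h => hgt (pos_injOn hg hgN h)]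
          exact hstep g hg hgt
    · simp only [hgN, if_false, if_true, wp_skip]
      simp only [St.arr_tick, St.arr_setVar, ulab, uout, St.time_tick, St.time_setVar]
      exact ⟨hmap', hzero', fun g hg => hstep g hg (by omega), by omega⟩
  · rintro τ ⟨h1, h2, h3, h4⟩ -
    exact ⟨by simpa using h1, fun x hx h => h2 x hx (by omega) h, by simpa using h3,
      by simp; omega⟩

/-- The labels that are left, from left to right, become the labels of the slots from `Q` on. -/
def compact : Stmt :=
  .set .c (.cst 0) ;;
  .count .i (.cst 0) .nn (.set .e (.ld .lab (.vr .i)) ;;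
    .ite (.vr .e) (.put .tmp (.vr .c) (.vr .e) ;; .set .c (.vr .c + .cst 1)) .skip) ;;
  .count .i (.cst 0) .q (.put .lab (.vr .q + .vr .i) (.ld .tmp (.vr .i)))

/-- The nonzero labels `l`, in their order, become the list for the next phase. -/
theorem wp_compact {E : Env} {σ : St} {Q : ℕ} {l : List ℕ} (hq : σ.var .q = Q)
    (hnn : σ.var .nn = 2 * Q)
    (hl : ((List.range (2 * Q)).map (σ.arr .lab)).filter (· ≠ 0) = l) (hlen : l.length = Q)
    (hQS : 2 * Q ≤ E.stride) (hSw : 4 * E.stride + 4 < 2 ^ E.w) :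
    wp E compact (fun τ => (∀ i < Q, τ.arr .lab (Q + i) = l.getD i 0) ∧
      τ.time ≤ σ.time + 90 * Q + 20) σ := by
  set L : ℕ → List ℕ := fun i => ((List.range i).map (σ.arr .lab)).filter (· ≠ 0) with hL
  have hLs : ∀ i, L (i + 1) = L i ++ if σ.arr .lab i = 0 then [] else [σ.arr .lab i] := by
    intro i
    simp only [hL, List.range_succ, List.map_append, List.filter_append, List.map_cons,
      List.map_nil]
    congr 1
    by_cases h : σ.arr .lab i = 0 <;> simp [h]
  have hLlen : ∀ i, (L i).length ≤ i := fun i =>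
    (List.length_filter_le _ _).trans (by simp)
  have hw : 1 < 2 ^ E.w := by omega
  simp only [compact, wp_seq]
  rw [wp_set]
  refine ⟨by simp, ?_⟩
  rw [wp_seq]
  refine wp_frame _ (wp_count (E := E) (x := .i) (hi := .nn) (fun i τ => τ.var .c = (L i).length ∧
    (∀ k < (L i).length, τ.arr .tmp k = (L i).getD k 0) ∧ τ.time ≤ σ.time + 4 + 31 * i) 0 (2 * Q)
    (by simp) (by simp) (by simp) (by simp) (by simp) (by simp) (by simpa using hnn) (by omega)
    (by simp [hL]) ?_ (Φ := fun τ => (∀ k < Q, τ.arr .tmp k = l.getD k 0) ∧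
      τ.time ≤ σ.time + 8 + 62 * Q) ?_) ?_
  · rintro i τ - hi ⟨hc, htmp, ht⟩ hvi - - hfa
    have f1 : τ.arr .lab = σ.arr .lab := by rw [hfa _ (by simp)]; rfl
    have hi' := hLlen i
    simp only [wp_seq, wp_set, wp_ite, wp_put, wp_skip, Expr.safe_ld, Expr.safe_vr, Expr.safe_cst,
      Expr.safe_add, Expr.val_ld, Expr.val_vr, Expr.val_cst, Expr.val_add, Expr.cost_ld,
      Expr.cost_vr, Expr.cost_cst, Expr.cost_add, St.var_tick, St.var_setVar, St.var_setArr,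
      St.arr_tick, St.arr_setVar, St.arr_setArr, reduceCtorEq, if_false, if_true, true_and,
      hvi, f1, hc, St.time_tick, St.time_setVar, St.time_setArr]
    refine ⟨by omega, ?_⟩
    rw [hLs]
    by_cases h0 : σ.arr .lab i = 0
    · simp only [h0, if_true, List.append_nil]
      exact ⟨trivial, htmp, by omega⟩
    · simp only [h0, if_false, List.length_append, List.length_singleton]
      refine ⟨by omega, ⟨by omega, by omega⟩, trivial, fun k hk => ?_, by omega⟩
      rw [Function.update_apply]
      split_ifs with hk'
      · rw [hk', List.getD_append_right _ _ _ _ le_rfl]; simp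
      · rw [htmp k (by omega), List.getD_append _ _ _ _ (by omega)]
  · rintro τ ⟨-, htmp, ht⟩ -
    change ∀ k < (((List.range (2 * Q)).map (σ.arr .lab)).filter (· ≠ 0)).length, τ.arr .tmp k =
      (((List.range (2 * Q)).map (σ.arr .lab)).filter (· ≠ 0)).getD k 0 at htmp
    rw [hl, hlen] at htmp
    exact ⟨htmp, by simp; omega⟩
  rintro τ hf ⟨htmp, ht⟩
  have fq : τ.var .q = Q := by rw [hf.1 _ (by simp)]; simpa using hq
  refine wp_count (x := .i) (hi := .q) (fun i υ => (∀ k < i, υ.arr .lab (Q + k) = l.getD k 0) ∧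
    υ.time ≤ σ.time + 10 + 62 * Q + 24 * i) 0 Q (by simp) (by simp) (by simp) (by simp)
    (by simp) (by simp) fq (by omega) ⟨by simp, by simp; omega⟩ ?_ ?_
  · rintro i υ - hi ⟨hdone, ht'⟩ hvi hvq - hfa
    have f1 : υ.arr .tmp = τ.arr .tmp := hfa _ (by simp)
    simp only [wp_put, Expr.safe_ld, Expr.safe_vr, Expr.safe_add, Expr.val_ld, Expr.val_vr,
      Expr.val_add, Expr.cost_ld, Expr.cost_vr, Expr.cost_add, St.var_tick, St.arr_tick,
      St.arr_setVar, St.arr_setArr, if_true, true_and, hvi, hvq, f1, htmp i hi, St.time_tick,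
      St.time_setVar, St.time_setArr]
    refine ⟨by omega, by omega, by omega, fun k hk => ?_, by omega⟩
    rw [Function.update_apply]
    split_ifs with h
    · congr 1; omega
    · exact hdone k (by omega)
  · rintro υ ⟨hdone, ht'⟩ -
    exact ⟨by simpa using hdone, by simp; omega⟩

/-- One phase decodes `Q` entries: the whole batch of move-to-front operations is carried out by
moving the operations down the levels of a tree over the slots. -/
def phase : Stmt := startPhase ;; descent ;; readOff ;; compact

/-- A phase turns the list for step `B` into the list for step `B + Q` and decodes the steps in
between, in time `O(Q)` per level. -/
theorem wp_phase {E : Env} {σ : St} {R : ℕ → ℕ} {Q β F b B N : ℕ}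
    (hq : σ.var .q = Q) (hnn : σ.var .nn = 2 * Q) (hbt : σ.var .bt = β) (hf : σ.var .f = F)
    (hh : σ.var .h = 2 ^ (F - 1)) (hfm : σ.var .fm = 2 ^ F - 1) (hbv : σ.var .b = b)
    (hbase : σ.var .base = B) (hn : σ.var .n = N) (hidn : ∀ t < Q, σ.arr .idn t = t)
    (hR : ∀ g, σ.arr .rank g = R g) (hRQ : ∀ g, R g < Q)
    (hlab : ∀ i < Q, σ.arr .lab (Q + i) = (mtfIter (List.range Q) R B).getD i 0 + 1)
    (hb : 2 ^ b = 2 * Q) (hβ : 0 < β)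
    (hQS : 2 * Q ≤ E.stride) (hBS : B + Q ≤ E.stride) (hNS : N ≤ E.stride) (hF : 1 < F)
    (hSw : 4 * E.stride + 4 < 2 ^ E.w)
    (hsmall : (2 ^ β + 1) * (2 * 2 ^ β) + 2 ^ β < 2 ^ (F - 1))
    (hbig : 2 ^ (F * 2 ^ β) < 2 ^ E.w) :
    wp E phase (fun τ =>
      (∀ i < Q, τ.arr .lab (Q + i) = (mtfIter (List.range Q) R (B + Q)).getD i 0 + 1) ∧
      (∀ g < N, τ.arr .out (pos N g) = if B ≤ g ∧ g < B + Q
        then decoded R Q g (σ.arr .out (pos N g)) else σ.arr .out (pos N g)) ∧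
      τ.time ≤ σ.time + (b / β + 1) * (2100 * Q)) σ := by
  set m : ℕ → ℕ := fun t => R (B + t) with hm
  have hmQ : ∀ t, m t < Q := fun t => hRQ _
  have hQ : 0 < Q := Nat.zero_lt_of_lt (hRQ 0)
  have hlen : ∀ g, (mtfIter (List.range Q) R g).length = Q := fun g => by
    simpa using length_mtfIter (l := List.range Q) (m := R) (by simpa using hRQ) g
  simp only [phase, wp_seq]
  refine wp_frame _ (wp_startPhase hq hnn hbt hf hh hfm hbv hbase hidn hR hRQ hb hQS hBS hSw) ?_
  rintro σ₁ hf₁ ⟨hat, t₁⟩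
  rw [wp_seq]
  refine wp_frame _ (wp_descent hat hb hβ hQS hF hSw hsmall hbig (slotAt_injOn hmQ)
    fun t ht => (slotAt_spec hmQ ht).2.1) ?_
  rintro σ₂ hf₂ ⟨hnode, t₂⟩
  have keepv : ∀ y, y = .q ∨ y = .nn ∨ y = .n ∨ y = .base → σ₂.var y = σ.var y := by
    rintro y (rfl | rfl | rfl | rfl) <;>
      rw [hf₂.1 _ (by simp [descent, level, sortBy, markChunks, descend, descendOne, setup,
          advance]),
        hf₁.1 _ (by simp [startPhase])]
  have keepa : ∀ a, a = .lab ∨ a = .out → σ₂.arr a = σ.arr a := by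
    rintro a (rfl | rfl) <;>
      rw [hf₂.2 _ (by simp [descent, level, sortBy, markChunks, descend, descendOne, setup,
          advance]),
        hf₁.2 _ (by simp [startPhase])]
  rw [wp_seq]
  refine wp_frame _ (wp_readOff ((keepv _ (by simp)).trans hq) ((keepv _ (by simp)).trans hn)
    ((keepv _ (by simp)).trans hbase) hRQ hnode (fun i hi => by rw [keepa _ (by simp), hlab i hi])
    hQS hBS hNS hSw) ?_
  rintro σ₃ hf₃ ⟨hmap, hzero, hout, t₃⟩
  obtain ⟨h1, h2, -⟩ := slotList_spec hmQ Q le_rfl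
  have hfilter : ((List.range (2 * Q)).map (σ₃.arr .lab)).filter (· ≠ 0) =
      (mtfIter (List.range Q) R (B + Q)).map (· + 1) := by
    have hpos : ∀ x ∈ slotList m Q Q, σ₃.arr .lab x ≠ 0 := by
      intro x hx
      have : σ₃.arr .lab x ∈ (slotList m Q Q).map (σ₃.arr .lab) := List.mem_map_of_mem hx
      rw [hmap, List.mem_map] at this
      obtain ⟨y, -, hy⟩ := this
      omega
    rw [List.filter_map, ← hmap]
    congr 1
    refine List.Perm.eq_of_pairwise (le := (· < ·)) (fun a b _ _ h h' => by omega)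
      (List.pairwise_lt_range.sublist List.filter_sublist) h1
      ((List.perm_ext_iff_of_nodup (List.nodup_range.sublist List.filter_sublist)
        (h1.imp fun h => h.ne)).2 fun x => ?_)
    simp only [List.mem_filter, List.mem_range, Function.comp, decide_eq_true_eq]
    constructor
    · rintro ⟨hx, hx'⟩
      by_contra hne
      exact hx' (hzero x hx hne)
    · intro hx
      exact ⟨((h2 x).1 hx).2.1, hpos x hx⟩
  refine wp_frame _ (wp_compact (E := E) (Q := Q) ?_ ?_ hfilter (by simp [hlen]) hQS hSw) ?_
  · rw [hf₃.1 _ (by simp [readOff, setPos]), keepv _ (by simp), hq]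
  · rw [hf₃.1 _ (by simp [readOff, setPos]), keepv _ (by simp), hnn]
  rintro σ₄ hf₄ ⟨hlab₄, t₄⟩
  refine ⟨fun i hi => ?_, fun g hg => ?_, ?_⟩
  · rw [hlab₄ i hi, List.getD_eq_getElem _ _ (by simpa [hlen] using hi), List.getElem_map,
      List.getD_eq_getElem]
  · rw [hf₄.2 _ (by simp [compact]), hout g hg, keepa _ (by simp)]
  · have h3 : (b / β + 1) * (2100 * Q) = (b / β + 1) * (1400 * Q + 410) +
        (b / β + 1) * (700 * Q - 410) := by
      rw [← mul_add, ← (show 2100 * Q = (1400 * Q + 410) + (700 * Q - 410) by omega)]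
    have h4 := Nat.le_mul_of_pos_left (700 * Q - 410) (Nat.succ_pos (b / β))
    rw [Nat.succ_eq_add_one] at h4
    omega

/-! ### The program -/

/-- The transform is read in the order in which the text is visited; the codes of the transform are
put at the visited positions, and the ranks of the move-to-front operations are stored. -/
def readInput : Stmt :=
  .count .g (.cst 0) .n (
    .set .c (.rd .bwt (.vr .r)) ;; setPos ;; .put .out (.vr .o) (.vr .c) ;;
    .ite (.vr .c % .cst 2)
      (.set .k (.vr .c / .cst 2) ;;
        .ite (.op .lt (.vr .sg) (.vr .k)) (.set .sg (.vr .k)) .skip ;;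
        .put .rank (.vr .g) (.vr .k - .cst 1)) .skip ;;
    .set .r (.rd .lf (.vr .r)))

theorem wp_readInput {E : Env} {σ : St} {N S : ℕ} {vis code : ℕ → ℕ} (hn : σ.var .n = N)
    (hEn : E.n = N) (hNS : N ≤ E.stride) (hSw : 4 * E.stride + 4 < 2 ^ E.w)
    (hr : σ.var .r = vis 0) (hsg : σ.var .sg = 0) (hrank : ∀ g, σ.arr .rank g = 0)
    (hvis : ∀ g, vis g < N) (hbwt : ∀ g < N, E.inp .bwt (vis g) = code g)
    (hlf : ∀ g < N, E.inp .lf (vis g) = vis (g + 1))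
    (hS : ∀ g < N, code g % 2 = 1 → 1 ≤ code g / 2 ∧ code g / 2 ≤ S) :
    wp E readInput (fun τ => (∀ g < N, τ.arr .out (pos N g) = code g) ∧
      (∀ g, τ.arr .rank g = if g < N then rankOf (code g) else 0) ∧
      (∀ g < N, rankOf (code g) < max (τ.var .sg) 1) ∧ τ.var .sg ≤ S ∧
      τ.time ≤ σ.time + 70 * N + 10) σ := by
  refine wp_count (x := .g) (hi := .n) (fun g τ => (∀ g' < g, τ.arr .out (pos N g') = code g') ∧
    (∀ g', τ.arr .rank g' = if g' < g then rankOf (code g') else 0) ∧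
    (∀ g' < g, rankOf (code g') < max (τ.var .sg) 1) ∧ τ.var .sg ≤ S ∧ τ.var .r = vis g ∧
    τ.time ≤ σ.time + 2 + 70 * g) 0 N (by simp [setPos]) (by simp [setPos]) (by simp)
    (by simp) (by simp) (by simp) hn (by omega) (by simp [hr, hsg, hrank]) ?_ ?_
  · rintro g τ - hg ⟨hout, hrk, hmax, hsS, hrv, ht⟩ hvg hvn - -
    have hv := hvis g
    have hSg := hS g hg
    simp only [wp_seq]
    rw [wp_set]
    refine ⟨by simp [hrv]; omega, wp_setPos (N := N) (g := g) (by simp [hvn]) (by simp [hvg]) hg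
      (by omega) fun c hc => ?_⟩
    have hposN : pos N g < N := pos_lt (by omega)
    have hne : ∀ g' < g, pos N g' ≠ pos N g := fun g' h1 h2 =>
      absurd (pos_injOn (by omega) hg h2) (by omega)
    simp only [wp_ite, wp_seq, wp_set, wp_put, wp_skip, Expr.safe_mod, Expr.safe_div, Expr.safe_vr,
      Expr.safe_cst, Expr.safe_lt, Expr.safe_sub, Expr.safe_rd, Expr.val_mod, Expr.val_div,
      Expr.val_vr, Expr.val_cst, Expr.val_lt, Expr.val_sub, Expr.val_rd, Expr.cost_mod,
      Expr.cost_div, Expr.cost_vr, Expr.cost_cst, Expr.cost_op, Expr.cost_sub, Expr.cost_rd,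
      St.var_tick, St.var_setVar, St.var_setArr, St.arr_tick, St.arr_setVar, St.arr_setArr,
      reduceCtorEq, if_false, if_true, true_and, and_true, hrv, hbwt g hg, hlf g hg, hvg,
      St.time_tick, St.time_setVar, St.time_setArr, hEn]
    have hout' : ∀ g' < g + 1,
        Function.update (τ.arr .out) (pos N g) (code g) (pos N g') = code g' := by
      intro g' h1
      rcases Nat.lt_or_ge g' g with h2 | h2
      · rw [Function.update_of_ne (hne g' h2)]; exact hout g' h2
      · obtain rfl : g' = g := by omega
        rw [Function.update_self]
    refine ⟨by omega, by omega, ?_⟩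
    by_cases hpar : code g % 2 = 0
    · have hro : rankOf (code g) = 0 := by rw [rankOf, if_pos hpar]
      simp only [hpar, if_true]
      refine ⟨hv, hout', fun g' => ?_, fun g' h1 => ?_, hsS, by omega⟩
      · rw [hrk]
        rcases lt_trichotomy g' g with h | h | h
        · rw [if_pos h, if_pos (by omega)]
        · rw [if_neg (by omega), h, if_pos (by omega), hro]
        · rw [if_neg (by omega), if_neg (by omega)]
      · rcases Nat.lt_or_ge g' g with h2 | h2
        · exact hmax g' h2
        · obtain rfl : g' = g := by omega
          rw [hro]; omega
    · have hro : rankOf (code g) = code g / 2 - 1 := by rw [rankOf, if_neg hpar]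
      obtain ⟨h3, h4⟩ := hSg (by omega)
      have hrank' : ∀ g', Function.update (τ.arr .rank) g (code g / 2 - 1) g' =
          if g' < g + 1 then rankOf (code g') else 0 := by
        intro g'
        rw [Function.update_apply, hrk]
        rcases lt_trichotomy g' g with h | h | h
        · rw [if_neg (by omega), if_pos h, if_pos (by omega)]
        · rw [if_pos h, h, if_pos (by omega), hro]
        · rw [if_neg (by omega), if_neg (by omega), if_neg (by omega)]
      simp only [hpar, if_false]
      refine ⟨by omega, ?_⟩
      by_cases hlt : τ.var .sg < code g / 2
      · simp only [hlt, if_true, one_ne_zero, if_false, hrv, hvg, hlf g hg]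
        refine ⟨⟨by omega, h3⟩, by omega, hv, hout', hrank', fun g' h1 => ?_, h4, by omega⟩
        rcases Nat.lt_or_ge g' g with h2 | h2
        · have := hmax g' h2; omega
        · obtain rfl : g' = g := by omega
          rw [hro]; omega
      · simp only [hlt, if_true, if_false, hrv, hvg, hlf g hg]
        refine ⟨⟨by omega, h3⟩, by omega, hv, hout', hrank', fun g' h1 => ?_, hsS, by omega⟩
        rcases Nat.lt_or_ge g' g with h2 | h2
        · exact hmax g' h2
        · obtain rfl : g' = g := by omega
          rw [hro]; omega
  · rintro τ ⟨h1, h2, h3, h4, -, h5⟩ -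
    exact ⟨by simpa using h1, by simpa using h2, by simpa using h3, by simpa using h4,
      by simp; omega⟩

/-- The parameters: `q`, the least power of two that is at least `sg`, with `2 ^ b = 2 * q`; the
number `bt` of bits that are decided by one level, about half the binary logarithm of `b`; and the
width `f` of the fields of packed words. -/
def chooseParams : Stmt :=
  .set .q (.cst 1) ;; .set .b (.cst 1) ;;
  .loop (.op .lt (.vr .q) (.vr .sg)) (.cst 1)
    (.set .q (.vr .q + .vr .q) ;; .set .b (.vr .b + .cst 1)) ;;
  .set .nn (.vr .q + .vr .q) ;; .set .bt (.cst 1) ;; .set .pw (.cst 4) ;;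
  .loop (.op .lt (.cst 4 * .vr .pw) (.vr .b + .cst 1)) (.cst 1)
    (.set .pw (.cst 4 * .vr .pw) ;; .set .bt (.vr .bt + .cst 1)) ;;
  .set .f (.cst 2 * .vr .bt + .cst 4) ;;
  .set .h (.op .shl (.cst 1) (.vr .f - .cst 1)) ;;
  .set .fm (.op .shl (.cst 1) (.vr .f) - .cst 1) ;;
  .count .i (.cst 0) .q (.put .idn (.vr .i) (.vr .i) ;;
    .put .lab (.vr .q + .vr .i) (.vr .i + .cst 1))

/-- The fields of a packed word fit in about `4 ^ β` bits. -/
theorem width_mul_le (β : ℕ) : (2 * β + 4) * 2 ^ β ≤ 4 ^ β + 16 := by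
  rcases Nat.lt_or_ge β 2 with h | h
  · interval_cases β <;> norm_num
  induction β, h using Nat.le_induction with
  | base => norm_num
  | succ β h ih =>
    have h1 : 2 ^ 2 ≤ 2 ^ β := Nat.pow_le_pow_right two_pos h
    have h2 : 4 ^ β = 2 ^ β * 2 ^ β := by rw [← mul_pow]; norm_num
    have h3 : (2 * (β + 1) + 4) * 2 ^ (β + 1) = 2 * ((2 * β + 4) * 2 ^ β) + 4 * 2 ^ β := by ring
    have h4 : 4 ^ (β + 1) = 4 * (2 ^ β * 2 ^ β) := by rw [pow_succ, h2]; ring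
    have h5 : 2 ^ 2 * 2 ^ β ≤ 2 ^ β * 2 ^ β := Nat.mul_le_mul_right _ h1
    rw [h3, h4]
    rw [h2] at ih
    omega

/-- The relations between the parameters: the length `N` of the text, a bound `S` for the numbers in
the transform and their maximum `sg`, the length `Q` of a phase, the number `b` of bits of a slot,
the number `β` of bits decided by one level, and the width `F` of a field.  By `small` the
coordinates and `δ` fit into a field, and by `big` a packed word has few enough bits. -/
structure Params (N S sg Q b β F : ℕ) : Prop where
  pow : 2 ^ b = 2 * Q
  sg_le : sg ≤ Q
  le : Q = 1 ∨ Q < 2 * S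
  pos : 0 < β
  lt : b < 4 ^ (β + 1)
  width : F = 2 * β + 4
  small : (2 ^ β + 1) * (2 * 2 ^ β) + 2 ^ β < 2 ^ (F - 1)
  big : 2 ^ (F * 2 ^ β) ≤ 2 ^ 21 * N

theorem wp_chooseParams {E : Env} {σ : St} {N S sg : ℕ} (hsg : σ.var .sg = sg) (hsS : sg ≤ S)
    (hSN : S ≤ N) (hN : 0 < N) (hstride : E.stride = 8 * N) (hSw : 2 ^ 24 * N ≤ 2 ^ E.w) :
    wp E chooseParams (fun τ => ∃ Q b β F, Params N S sg Q b β F ∧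
      τ.var .q = Q ∧ τ.var .nn = 2 * Q ∧ τ.var .b = b ∧ τ.var .bt = β ∧ τ.var .f = F ∧
      τ.var .h = 2 ^ (F - 1) ∧ τ.var .fm = 2 ^ F - 1 ∧ (∀ t < Q, τ.arr .idn t = t) ∧
      (∀ i < Q, τ.arr .lab (Q + i) = i + 1) ∧ τ.time ≤ σ.time + 500 * N) σ := by
  have h1w : 1 < 2 ^ E.w := by omega
  simp only [chooseParams, wp_seq, wp_set, Expr.safe_cst, Expr.val_cst, Expr.cost_cst, h1w,
    true_and]
  refine wp_loop (fun τ => 2 ^ τ.var .b = 2 * τ.var .q ∧ (τ.var .q = 1 ∨ τ.var .q < 2 * S) ∧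
    τ.time ≤ σ.time + 15 * τ.var .b) (fun τ => sg - τ.var .q) ?_ ⟨by simp, by simp, by simp⟩
  rintro τ hfτ ⟨hpow, hle, ht⟩
  have hsgτ : τ.var .sg = sg := by rw [hfτ.1 .sg (by simp)]; simpa using hsg
  have hbN : τ.var .b < 2 ^ τ.var .b := Nat.lt_two_pow_self
  simp only [Expr.safe_lt, Expr.safe_vr, true_and, Expr.val_lt, Expr.val_vr, hsgτ, Expr.safe_cst,
    Expr.val_cst, one_ne_zero, if_false, h1w, Expr.cost_op, Expr.cost_vr, Expr.cost_cst]
  by_cases hlt : τ.var .q < sg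
  · simp only [hlt, if_true, one_ne_zero, if_false, wp_seq, wp_set, Expr.safe_add, Expr.safe_vr,
      Expr.safe_cst, Expr.val_add, Expr.val_vr, Expr.val_cst, Expr.cost_add, Expr.cost_vr,
      Expr.cost_cst, St.var_tick, St.var_setVar, reduceCtorEq, h1w, true_and, St.time_tick,
      St.time_setVar]
    exact ⟨by omega, by omega, ⟨by rw [pow_succ]; omega, by omega, by omega⟩, by omega⟩
  simp only [hlt, if_false, if_true]
  -- the number of bits for one level
  obtain ⟨Q, hQ⟩ : ∃ Q, τ.var .q = Q := ⟨_, rfl⟩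
  obtain ⟨b, hb⟩ : ∃ b, τ.var .b = b := ⟨_, rfl⟩
  rw [hQ, hb] at hpow
  rw [hQ] at hle hlt
  rw [hb] at ht hbN
  have hQ0 : 0 < Q := by
    have : 0 < 2 ^ b := by positivity
    omega
  have hb0 : b ≠ 0 := by
    rintro rfl
    omega
  simp only [wp_seq, wp_set, Expr.safe_add, Expr.safe_vr, Expr.safe_cst, Expr.val_add,
    Expr.val_vr, Expr.val_cst, Expr.cost_add, Expr.cost_vr, Expr.cost_cst, St.var_tick,
    St.var_setVar, reduceCtorEq, if_false, h1w, true_and, hQ]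
  refine ⟨by omega, by omega, ?_⟩
  refine wp_loop (fun υ => υ.var .pw = 4 ^ υ.var .bt ∧ 0 < υ.var .bt ∧ υ.var .pw ≤ max 4 b ∧
    υ.time ≤ σ.time + 15 * b + 20 + 19 * υ.var .bt) (fun υ => max 4 b - υ.var .pw) ?_
    ⟨by simp, by simp, by simp, by simp; omega⟩
  rintro υ hfυ ⟨hpw, hbt0, hpwb, htυ⟩
  have fb : υ.var .b = b := by rw [hfυ.1 .b (by simp)]; simpa using hb
  have fq : υ.var .q = Q := by rw [hfυ.1 .q (by simp)]; simpa using hQ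
  have fnn : υ.var .nn = Q + Q := by rw [hfυ.1 .nn (by simp)]; simp
  obtain ⟨β, hβ⟩ : ∃ β, υ.var .bt = β := ⟨_, rfl⟩
  rw [hβ] at hpw hbt0 htυ
  have hβpw : β < 4 ^ β := Nat.lt_pow_self (by norm_num)
  simp only [Expr.safe_lt, Expr.safe_vr, Expr.safe_cst, Expr.safe_mul, Expr.safe_add, true_and,
    Expr.val_lt, Expr.val_vr, Expr.val_cst, Expr.val_mul, Expr.val_add, fb, hpw, one_ne_zero,
    if_false, h1w, Expr.cost_op, Expr.cost_vr, Expr.cost_cst, Expr.cost_mul, Expr.cost_add,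
    and_true]
  rw [hpw] at hpwb
  refine ⟨⟨⟨by omega, by omega⟩, by omega⟩, ?_⟩
  by_cases hlt' : 4 * 4 ^ β < b + 1
  · simp only [hlt', if_true, one_ne_zero, if_false, wp_seq, wp_set, Expr.safe_add, Expr.safe_mul,
      Expr.safe_vr, Expr.safe_cst, Expr.val_add, Expr.val_mul, Expr.val_vr, Expr.val_cst,
      Expr.cost_add, Expr.cost_mul, Expr.cost_vr, Expr.cost_cst, St.var_tick, St.var_setVar,
      reduceCtorEq, h1w, true_and, St.time_tick, St.time_setVar, hβ, hpw]
    exact ⟨⟨by omega, by omega⟩, by omega, ⟨by rw [pow_succ]; omega, by omega, by omega,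
      by omega⟩, by omega⟩
  simp only [hlt', if_false, if_true]
  -- the remaining parameters
  obtain ⟨F, hF⟩ : ∃ F, F = 2 * β + 4 := ⟨_, rfl⟩
  have hβ2 : 2 ^ 1 ≤ 2 ^ β := Nat.pow_le_pow_right two_pos hbt0
  have h4 : 4 ^ β = 2 ^ β * 2 ^ β := by rw [← mul_pow]; norm_num
  have hF1 : 2 ^ (F - 1) = 8 * (2 ^ β * 2 ^ β) := by
    rw [hF, show 2 * β + 4 - 1 = β + β + 3 by omega, pow_add, pow_add]; ring
  have hwidth := width_mul_le β
  have hbig : 2 ^ (F * 2 ^ β) ≤ 2 ^ 21 * N := by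
    calc 2 ^ (F * 2 ^ β) ≤ 2 ^ (b + 19) := Nat.pow_le_pow_right two_pos (by rw [hF]; omega)
      _ = 2 * Q * 2 ^ 19 := by rw [pow_add, hpow]
      _ ≤ 2 ^ 21 * N := by omega
  have hFle : 2 ^ F ≤ 2 ^ (F * 2 ^ β) :=
    Nat.pow_le_pow_right two_pos (Nat.le_mul_of_pos_right F (by positivity))
  have hF1le : 2 ^ (F - 1) ≤ 2 ^ F := Nat.pow_le_pow_right two_pos (by omega)
  have hFone : 1 ≤ 2 ^ F := Nat.one_le_two_pow
  have hparams : Params N S sg Q b β F :=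
    ⟨hpow, by omega, hle, hbt0, by rw [pow_succ]; omega, hF, by rw [hF1]; nlinarith, hbig⟩
  simp only [wp_seq, wp_set, Expr.safe_add, Expr.safe_sub, Expr.safe_mul, Expr.safe_shl,
    Expr.safe_vr, Expr.safe_cst, Expr.val_add, Expr.val_sub, Expr.val_mul, Expr.val_shl,
    Expr.val_vr, Expr.val_cst, Expr.cost_add, Expr.cost_sub, Expr.cost_mul, Expr.cost_op,
    Expr.cost_vr, Expr.cost_cst, St.var_tick, St.var_setVar, reduceCtorEq, if_false, if_true, h1w,
    true_and, hβ, ← hF, one_mul]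
  refine ⟨⟨⟨by omega, by omega⟩, by omega, by omega⟩, ⟨by omega, by omega⟩, ⟨by omega, hFone⟩, ?_⟩
  refine wp_frame _ (wp_count (E := E) (x := .i) (hi := .q) (fun i χ =>
    (∀ t < i, χ.arr .idn t = t ∧ χ.arr .lab (Q + t) = t + 1) ∧
    χ.time ≤ σ.time + 15 * b + 60 + 19 * β + 27 * i) 0 Q (by simp) (by simp) (by simp)
    (by simp) (by simp) (by simp) (by simpa using fq) (by omega) ⟨by simp, by simp; omega⟩ ?_
    (Φ := fun χ => (∀ t < Q, χ.arr .idn t = t ∧ χ.arr .lab (Q + t) = t + 1) ∧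
      χ.time ≤ σ.time + 500 * N) ?_) ?_
  · rintro i χ - hi ⟨hI, htχ⟩ hvi hvq - -
    simp only [wp_seq, wp_put, Expr.safe_vr, Expr.safe_cst, Expr.safe_add, Expr.val_vr,
      Expr.val_cst, Expr.val_add, Expr.cost_vr, Expr.cost_cst, Expr.cost_add, St.var_tick,
      St.var_setArr, St.arr_tick, St.arr_setVar, St.arr_setArr, reduceCtorEq, if_false, if_true,
      true_and, hvi, hvq, h1w, St.time_tick, St.time_setVar, St.time_setArr]
    refine ⟨by omega, by omega, by omega, by omega, fun t h => ?_, by omega⟩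
    rcases Nat.lt_or_ge t i with h' | h'
    · rw [Function.update_of_ne (by omega), Function.update_of_ne (by omega)]
      exact hI t h'
    · obtain rfl : t = i := by omega
      simp
  · rintro χ ⟨hI, htχ⟩ -
    exact ⟨by simpa using hI, by simp; omega⟩
  rintro χ hfχ ⟨hI, htχ⟩
  have fv : ∀ y, y ≠ .i → ¬ y = .fm → ¬ y = .h → ¬ y = .f → χ.var y = υ.var y := by
    intro y h1 h2 h3 h4
    rw [hfχ.1 y (by simp [h1])]
    simp [h2, h3, h4]
  refine ⟨Q, b, β, F, hparams, ?_, ?_, ?_, ?_, ?_, ?_, ?_, fun t ht => (hI t ht).1,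
    fun t ht => (hI t ht).2, htχ⟩
  · rw [fv _ (by simp) (by simp) (by simp) (by simp), fq]
  · rw [fv _ (by simp) (by simp) (by simp) (by simp), fnn, two_mul]
  · rw [fv _ (by simp) (by simp) (by simp) (by simp), fb]
  · rw [fv _ (by simp) (by simp) (by simp) (by simp), hβ]
  all_goals
    rw [hfχ.1 _ (by simp)]
    simp

/-- Phases of `q` steps each, until all steps are decoded; the last phase may run past the end, with
ranks `0`. -/
def decoder : Stmt :=
  readInput ;; chooseParams ;; .set .base (.cst 0) ;;
  .loop (.op .lt (.vr .base) (.vr .n)) (.cst 1) (phase ;; .set .base (.vr .base + .vr .q))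

theorem not_sets_phase {y : Var} (hy : y = .q ∨ y = .nn ∨ y = .bt ∨ y = .f ∨ y = .h ∨ y = .fm ∨
    y = .b ∨ y = .n ∨ y = .base) : ¬ phase.Sets y := by
  rcases hy with rfl | rfl | rfl | rfl | rfl | rfl | rfl | rfl | rfl <;>
    simp [phase, startPhase, readOff, setPos, compact, descent, level, sortBy, markChunks, descend,
      descendOne, setup, advance]

theorem not_puts_phase {a : Arr} (ha : a = .idn ∨ a = .rank) : ¬ phase.Puts a := by
  rcases ha with rfl | rfl <;>
    simp [phase, startPhase, readOff, setPos, compact, descent, level, sortBy, markChunks, descend,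
      descendOne, setup, advance]

/-- Given access to codes `code g` along a chain `vis` of ranks, the program puts the decoded
symbols at their positions in the text. -/
theorem wp_decoder {E : Env} {N S : ℕ} {vis code : ℕ → ℕ} (hEn : E.n = N) (hN : 0 < N)
    (hSN : S ≤ N) (hstride : E.stride = 8 * N) (hSw : 2 ^ 24 * N ≤ 2 ^ E.w) (h0 : vis 0 = 0)
    (hvis : ∀ g, vis g < N) (hbwt : ∀ g < N, E.inp .bwt (vis g) = code g)
    (hlf : ∀ g < N, E.inp .lf (vis g) = vis (g + 1))
    (hS : ∀ g < N, code g % 2 = 1 → 1 ≤ code g / 2 ∧ code g / 2 ≤ S) :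
    wp E decoder (fun τ => ∃ sg Q b β F, Params N S sg Q b β F ∧
      (∀ g < N, rankOf (code g) < Q) ∧
      (∀ g < N, τ.arr .out (pos N g) =
        decoded (fun g => if g < N then rankOf (code g) else 0) Q g (code g)) ∧
      τ.time ≤ 8000 * N * (b / β + 1)) (St.init N) := by
  set R : ℕ → ℕ := fun g => if g < N then rankOf (code g) else 0 with hRdef
  have h1w : 1 < 2 ^ E.w := by omega
  simp only [decoder, wp_seq]
  refine wp_frame _ (wp_readInput (σ := St.init N) (S := S) (by simp [St.init]) hEn (by omega)
    (by omega) (by simp [St.init, h0]) (by simp [St.init]) (by simp [St.init]) hvis hbwt hlf hS) ?_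
  rintro σ₁ hf₁ ⟨hout₁, hrank₁, hmax, hsg, t₁⟩
  rw [wp_seq]
  refine wp_frame _ (wp_chooseParams rfl hsg hSN hN hstride hSw) ?_
  rintro σ₂ hf₂ ⟨Q, b, β, F, hP, hq, hnn, hb, hbt, hf, hh, hfm, hidn, hlab, t₂⟩
  have hQ0 : 0 < Q := by
    have : 0 < 2 ^ b := by positivity
    have := hP.pow
    omega
  have hRQ' : ∀ g < N, rankOf (code g) < Q := fun g hg => by
    have := hmax g hg
    have := hP.sg_le
    omega
  have hRQ : ∀ g, R g < Q := fun g => by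
    simp only [hRdef]
    split_ifs with h
    · exact hRQ' g h
    · exact hQ0
  have hQN : Q ≤ 2 * N := by have := hP.le; omega
  have hn₂ : σ₂.var .n = N := by
    rw [hf₂.1 _ (by simp [chooseParams]), hf₁.1 _ (by simp [readInput, setPos])]; simp [St.init]
  have hrank₂ : σ₂.arr .rank = σ₁.arr .rank := hf₂.2 _ (by simp [chooseParams])
  have hout₂ : σ₂.arr .out = σ₁.arr .out := hf₂.2 _ (by simp [chooseParams])
  rw [wp_seq, wp_set]
  refine ⟨by simp, ?_⟩
  refine wp_loop (fun τ => ∃ k, τ.var .base = k * Q ∧ k * Q < N + Q ∧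
    (∀ i < Q, τ.arr .lab (Q + i) = (mtfIter (List.range Q) R (k * Q)).getD i 0 + 1) ∧
    (∀ g < N, τ.arr .out (pos N g) = if g < k * Q then decoded R Q g (code g) else code g) ∧
    τ.time ≤ 590 * N + k * ((b / β + 1) * (2100 * Q) + 15)) (fun τ => N - τ.var .base) ?_ ?_
  · rintro τ hfτ ⟨k, hbase, hkN, hlabτ, houtτ, htτ⟩
    have fv : ∀ y, y = .q ∨ y = .nn ∨ y = .bt ∨ y = .f ∨ y = .h ∨ y = .fm ∨ y = .b ∨ y = .n →
        τ.var y = σ₂.var y := by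
      intro y hy
      have hyb : y ≠ .base := by rintro rfl; simp at hy
      have hyp : ¬ phase.Sets y := not_sets_phase (by tauto)
      rw [hfτ.1 y (by simp [hyp, hyb])]
      simp [hyb]
    have fa : ∀ a, a = .idn ∨ a = .rank → τ.arr a = σ₂.arr a := by
      intro a ha
      rw [hfτ.2 a (by simp [not_puts_phase ha])]
      rfl
    have hk1 : (k + 1) * Q = k * Q + Q := by ring
    simp only [Expr.safe_lt, Expr.safe_vr, true_and, Expr.val_lt, Expr.val_vr, hbase,
      fv .n (by simp), hn₂, Expr.safe_cst, Expr.val_cst, one_ne_zero, if_false, h1w,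
      Expr.cost_op, Expr.cost_vr, Expr.cost_cst]
    by_cases hlt : k * Q < N
    · simp only [hlt, if_true, one_ne_zero, if_false, wp_seq]
      refine wp_frame _ (wp_phase (σ := τ.tick _) (R := R) (Q := Q) (β := β) (F := F) (b := b)
        (B := k * Q) (N := N) ((fv _ (by simp)).trans hq) ((fv _ (by simp)).trans hnn)
        ((fv _ (by simp)).trans hbt) ((fv _ (by simp)).trans hf) ((fv _ (by simp)).trans hh)
        ((fv _ (by simp)).trans hfm) ((fv _ (by simp)).trans hb) hbase
        ((fv _ (by simp)).trans hn₂) ?_ ?_ hRQ hlabτ hP.pow hP.pos (by omega) (by omega)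
        (by omega) (by rw [hP.width]; omega) (by omega) hP.small
        (lt_of_le_of_lt hP.big (by omega))) ?_
      · intro t ht
        rw [St.arr_tick, fa _ (by simp), hidn t ht]
      · intro g
        rw [St.arr_tick, fa _ (by simp), hrank₂, hrank₁]
      rintro υ hfυ ⟨hlabυ, houtυ, htυ⟩
      have gv : ∀ y, y = .q ∨ y = .base → υ.var y = τ.var y := by
        intro y hy
        exact hfυ.1 y (not_sets_phase (by tauto))
      simp only [wp_set, Expr.safe_add, Expr.safe_vr, true_and, Expr.val_add, Expr.val_vr,
        Expr.cost_add, Expr.cost_vr, gv .q (by simp), gv .base (by simp), fv .q (by simp), hq,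
        hbase, St.var_tick, St.var_setVar, if_true]
      refine ⟨by omega, ⟨k + 1, hk1.symm, by omega, ?_, fun g hg => ?_, ?_⟩, by omega⟩
      · rw [hk1]; exact hlabυ
      · have h5 := houtυ g hg
        have h6 := houtτ g hg
        simp only [St.arr_tick, St.arr_setVar] at h5 ⊢
        rw [h5, hk1]
        by_cases h7 : g < k * Q
        · rw [if_neg (by omega), h6, if_pos h7, if_pos (by omega)]
        · rw [if_neg h7] at h6
          rw [h6]
          exact if_congr (by omega) rfl rfl
      · have : (k + 1) * ((b / β + 1) * (2100 * Q) + 15) =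
            k * ((b / β + 1) * (2100 * Q) + 15) + ((b / β + 1) * (2100 * Q) + 15) := by ring
        simp only [St.time_tick, St.time_setVar] at htυ ⊢
        omega
    · simp only [hlt, if_true, if_false]
      refine ⟨_, Q, b, β, F, hP, hRQ', fun g hg => ?_, ?_⟩
      · rw [St.arr_tick, houtτ g hg, if_pos (by omega)]
      · have h5 : k * ((b / β + 1) * (2100 * Q) + 15) ≤ (b / β + 1) * (2115 * (k * Q)) := by
          have h8 : k ≤ k * Q := Nat.le_mul_of_pos_right k hQ0
          have h9 : k * Q ≤ (b / β + 1) * (k * Q) := Nat.le_mul_of_pos_left _ (Nat.succ_pos _)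
          rw [show k * ((b / β + 1) * (2100 * Q) + 15) =
            2100 * ((b / β + 1) * (k * Q)) + 15 * k by ring,
            show (b / β + 1) * (2115 * (k * Q)) = 2115 * ((b / β + 1) * (k * Q)) by ring]
          omega
        have h6 : (b / β + 1) * (2115 * (k * Q)) ≤ (b / β + 1) * (2115 * (3 * N)) :=
          Nat.mul_le_mul_left _ (by omega)
        have h7 : N ≤ (b / β + 1) * N := Nat.le_mul_of_pos_left _ (Nat.succ_pos _)
        rw [show (b / β + 1) * (2115 * (3 * N)) = 6345 * ((b / β + 1) * N) by ring] at h6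
        rw [St.time_tick, show 8000 * N * (b / β + 1) = 8000 * ((b / β + 1) * N) by ring]
        omega
  · refine ⟨0, by simp, by simp; omega, fun i hi => ?_, fun g hg => ?_, ?_⟩
    · simp only [St.arr_tick, St.arr_setVar, hlab i hi]
      simp [mtfIter, List.getD_eq_getElem, hi]
    · simp [hout₂, hout₁ g hg]
    · simp [St.init] at t₁ ⊢
      omega

/-! ### The time bound -/

/-- With `b ≤ 2 * x` bits in all and `β` of them per level, the number of levels is
`O(x / log x)`. -/
theorem div_add_one_le {b β : ℕ} {x : ℝ} (hβ : 0 < β) (hb : 0 < b) (hlt : b < 4 ^ (β + 1))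
    (hx : 2 ≤ x) (hbx : (b : ℝ) ≤ 2 * x) : ((b / β : ℕ) : ℝ) + 1 ≤ 18 * (x / Real.logb 2 x) := by
  have h2 : (1 : ℝ) < 2 := one_lt_two
  have hx0 : 0 < x := by linarith
  set y := Real.logb 2 x with hy
  have hy1 : 1 ≤ y := by
    rw [hy, Real.le_logb_iff_rpow_le h2 hx0]; simpa using hx
  have hlog_le : ∀ z : ℝ, 0 < z → Real.logb 2 z ≤ 2 * z := by
    intro z hz
    have h3 := Real.log_two_gt_d9
    rw [Real.logb, div_le_iff₀ (by linarith)]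
    have h4 := Real.log_le_sub_one_of_pos hz
    nlinarith
  have hyx : y ≤ 2 * x := hlog_le x hx0
  have hone : 1 ≤ 2 * (x / y) := by
    rw [← mul_div_assoc]
    exact (one_le_div (by linarith)).2 hyx
  have hβ0 : (0 : ℝ) < β := by exact_mod_cast hβ
  have hdiv : ((b / β : ℕ) : ℝ) ≤ b / β := Nat.cast_div_le
  suffices h : (b : ℝ) / β ≤ 16 * (x / y) by linarith
  rcases le_or_gt ((b : ℝ) ^ 2) x with h | h
  · -- few bits: one bit per level would do
    have h1 : (b : ℝ) / β ≤ b := div_le_self (by positivity) (by exact_mod_cast hβ)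
    have hb1 : (1 : ℝ) ≤ b := by exact_mod_cast hb
    set s := Real.sqrt x with hs
    have hss : s * s = x := Real.mul_self_sqrt hx0.le
    have hs0 : 0 < s := Real.sqrt_pos.2 hx0
    have hbs : (b : ℝ) ≤ s := Real.le_sqrt_of_sq_le h
    have hys : y ≤ 4 * s := by
      have : y = 2 * Real.logb 2 s := by
        rw [hy, ← hss, Real.logb_mul hs0.ne' hs0.ne']; ring
      have := hlog_le s hs0
      linarith
    have : s ≤ 16 * (x / y) := by
      rw [← mul_div_assoc, le_div_iff₀ (by linarith)]
      nlinarith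
    linarith
  · have hb0 : (0 : ℝ) < b := by exact_mod_cast hb
    have h1 : y ≤ 2 * Real.logb 2 b := by
      have : Real.logb 2 x ≤ Real.logb 2 ((b : ℝ) ^ 2) := Real.logb_le_logb_of_le h2 hx0 h.le
      rwa [Real.logb_pow] at this
    have h3 : Real.logb 2 b ≤ 2 * (β + 1) := by
      rw [Real.logb_le_iff_le_rpow h2 hb0]
      have : ((4 ^ (β + 1) : ℕ) : ℝ) = (2 : ℝ) ^ ((2 : ℝ) * (β + 1)) := by
        rw [Real.rpow_mul (by norm_num)]
        push_cast
        rw [show ((2 : ℝ) ^ (2 : ℝ)) = 4 by norm_num]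
        exact_mod_cast rfl
      rw [← this]
      exact_mod_cast hlt.le
    have hβ1 : (1 : ℝ) ≤ β := by exact_mod_cast hβ
    have h4 : y ≤ 8 * β := by linarith
    rw [← mul_div_assoc, div_le_div_iff₀ hβ0 (by linarith)]
    nlinarith

/-- The number of levels of a phase is `O(lg σ / lg lg σ)`. -/
theorem params_le {N S sg Q b β F : ℕ} (h : Params N S sg Q b β F) :
    ((b / β : ℕ) : ℝ) + 1 ≤ 18 * lgOverLgLg S := by
  have h2 : (1 : ℝ) < 2 := one_lt_two
  have hσ : (4 : ℝ) ≤ (max S 4 : ℕ) := by exact_mod_cast le_max_right S 4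
  have hσ0 : (0 : ℝ) < (max S 4 : ℕ) := by linarith
  have hL : 2 ≤ Real.logb 2 (max S 4 : ℕ) := by
    rw [Real.le_logb_iff_rpow_le h2 hσ0]
    norm_num at hσ ⊢
  refine div_add_one_le h.pos ?_ h.lt hL ?_
  · rcases Nat.eq_zero_or_pos b with h0 | h0
    · have := h.pow
      rw [h0] at this
      omega
    · exact h0
  · -- `2 ^ b` is at most `4` times the size of the alphabet
    have h3 : 2 ^ b ≤ 4 * max S 4 := by
      rw [h.pow]
      have := h.le
      omega
    have h4 : (b : ℝ) ≤ Real.logb 2 (4 * (max S 4 : ℕ)) := by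
      rw [Real.le_logb_iff_rpow_le h2 (by positivity), Real.rpow_natCast]
      exact_mod_cast h3
    rw [Real.logb_mul (by norm_num) hσ0.ne'] at h4
    have h5 : Real.logb 2 4 = 2 := by
      rw [show (4 : ℝ) = 2 ^ (2 : ℕ) by norm_num, Real.logb_pow, Real.logb_self_eq_one h2]
      norm_num
    linarith

theorem numParams_le_length {a b : ℕ} (T : List (Sym a b)) : numParams T ≤ T.length :=
  (List.toFinset_card_le _).trans (List.length_filterMap_le _ _)

theorem exists_pos_eq {n k : ℕ} (hk : k < n) : ∃ g < n, pos n g = k := by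
  rcases Nat.lt_or_ge (k + 1) n with h | h
  · exact ⟨n - 2 - k, by omega, by rw [pos, if_pos (by omega)]; omega⟩
  · exact ⟨n - 1, by omega, by rw [pos, if_neg (by omega)]; omega⟩

end PBWT

theorem mainTheorem3 :
    ∃ (P : PBWT.Program) (A : ℕ) (C : ℝ),
      ∀ (a b : ℕ) (T : List (PBWT.Sym a b)), PBWT.HasEndMarker T →
        ∀ w : ℕ, A * T.length ≤ 2 ^ w → 2 * a ≤ 2 ^ w →
          ∃ (t : ℕ) (T' : List (PBWT.Sym a b)),
            (t : ℝ) ≤ C * (T.length * PBWT.lgOverLgLg (PBWT.numParams T)) ∧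
            ((PBWT.step P (PBWT.inputOf w T))^[t] (PBWT.initConfig w T.length)).Halted P ∧
            PBWT.Holds ((PBWT.step P (PBWT.inputOf w T))^[t] (PBWT.initConfig w T.length)).mem T' ∧
            PBWT.PMatch T T' := by
  open PBWT in
  -- `2 ^ 24 * n ≤ 2 ^ w` leaves room for packed words of at most `2 ^ 21 * n` and for `15` arrays
  -- of `8 n` cells; the time is at most `8000 * n * (l / β + 1) + 2`, where `l / β + 1` is at most
  -- `18 * lgOverLgLg σ`
  refine ⟨decoder.program, 2 ^ 24, 8002 * 18, fun a b T hT w hA ha => ?_⟩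
  have hn : 0 < T.length := by
    obtain ⟨u, d, rfl, -⟩ := hT
    simp
  have hbounds := codeAt_bounds T hT hn
  have hSN := numParams_le_length T
  have hcode : ∀ g < T.length, codeAt T hn g < 2 ^ w := by
    intro g hg
    cases hL : pbwt T (visit T hn g) with
    | inl s =>
      rw [codeAt, hL, codeL]
      have := s.isLt
      omega
    | inr k =>
      have hodd : codeAt T hn g % 2 = 1 := by rw [codeAt, hL, codeL]; omega
      have := hbounds g hg hodd
      omega
  let E : Env := ⟨w, T.length, 8 * T.length, fun s i => (inputOf w T s (BitVec.ofNat w i)).toNat⟩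
  have hfits : E.Fits (inputOf w T) :=
    ⟨by change 15 * (8 * T.length) ≤ 2 ^ w; omega, fun _ _ _ => rfl⟩
  have hofNat : ∀ i : Fin T.length, (BitVec.ofNat w i.val).toNat = i.val := fun i => by
    rw [BitVec.toNat_ofNat, Nat.mod_eq_of_lt]
    have := i.isLt
    omega
  have hwp := wp_decoder (E := E) (N := T.length) (S := numParams T)
    (vis := fun g => (visit T hn g).val) (code := codeAt T hn) rfl hn hSN rfl hA rfl
    (fun g => (visit T hn g).isLt)
    (fun g hg => by
      change (inputOf w T .bwt (BitVec.ofNat w (visit T hn g).val)).toNat = _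
      rw [inputOf]
      simp only [hofNat, Fin.is_lt, dif_pos, Fin.eta]
      rw [BitVec.toNat_ofNat]
      exact Nat.mod_eq_of_lt (hcode g hg))
    (fun g hg => by
      change (inputOf w T .lf (BitVec.ofNat w (visit T hn g).val)).toNat = _
      rw [inputOf]
      simp only [hofNat, Fin.is_lt, dif_pos, Fin.eta]
      rw [visit_succ])
    hbounds
  obtain ⟨τ, t, ⟨sg, Q, l, β, F, hP, hQ, hout, htime⟩, ht, hrep, hhalt⟩ :=
    decoder.run hfits rfl hn hwp
  obtain ⟨f, hf⟩ := mtf_decode T hT hn Q hQ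
  refine ⟨t, T.map (Sum.map id f), ?_, hhalt, fun k => ?_, ⟨f, rfl⟩⟩
  · have h1 := params_le hP
    have h2 : (t : ℝ) ≤ 8000 * T.length * (((l / β : ℕ) : ℝ) + 1) + 2 := by
      rw [ht]; exact_mod_cast Nat.add_le_add_right htime 2
    have h3 : (1 : ℝ) ≤ T.length := by exact_mod_cast hn
    have h4 : (0 : ℝ) ≤ ((l / β : ℕ) : ℝ) := Nat.cast_nonneg _
    nlinarith
  · -- every position is visited at some time
    have hk : k.val < T.length := by simpa using k.isLt
    obtain ⟨g, hg, hgk⟩ := exists_pos_eq hk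
    have h1 := hrep.arr .out k.val (by change k.val < 8 * T.length; omega)
    rw [show Arr.out.idx * E.stride + k.val = k.val by simp [Arr.idx, Arr.ctorIdx]] at h1
    refine h1.trans ?_
    have h2 := hf g hg
    simp only [hgk] at h2
    rw [← hgk, hout g hg, decoded, if_pos hg,
      mtfIter_congr (m' := fun g => rankOf (codeAt T hn g)) fun k hk => if_pos (by omega), ← h2]
    simp
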